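/- Setting. For a number $m$ of sensors let $\mathbf a(\varphi)=[1,e^{j\varphi},\dots,e^{j(m-1)\varphi}]^T\in\mathbb C^m$, $\varphi\in[-\pi,\pi]$, be the manifold of the half-wavelength uniform linear array (ULA) in terms of the electrical angle, and $\mathbf d(\varphi)=\mathbf a'(\varphi)$. For a pair $\boldsymbol\phi=[\phi_1\ \phi_2]$ put $\mathbf A=[\mathbf a(\phi_1)\ \mathbf a(\phi_2)]$, $\mathbf B=[\mathbf d(\phi_1)\ \mathbf d(\phi_2)]$, $\mathbf P_{\mathbf A}^\perp=\mathbf I-\mathbf A(\mathbf A^H\mathbf A)^{-1}\mathbf A^H$. Let $T\ge1$ be the number of snapshots and let $\boldsymbol\Xi=[\boldsymbol\xi_1\ \boldsymbol\xi_2]$ range over the matrices $\mathbf U\mathbf U^H$ with $\mathbf U\in\mathbb C^{2\times T}$ having rows of unit norm, i.e. over $\boldsymbol\Xi=\begin{bmatrix}1&\rho\\ \bar\rho&1\end{bmatrix}$ with $|\rho|=1$ if $T=1$ and $|\rho|\le1$ if $T\ge2$; "almost all $\boldsymbol\Xi$" refers to arc length on the circle $|\rho|=1$ if $T=1$, and to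 area on the disk $|\rho|\le1$ if $T\ge2$. With $\odot$ the entrywise product, put $$\mathbf R=\operatorname{Re}[\mathbf B^H\mathbf P_{\mathbf A}^\perp\mathbf B\odot\boldsymbol\Xi^T],\qquad \mathbf D_0=\operatorname{diag}\Big(\mathbf R^{-1}\operatorname{Re}\begin{bmatrix}\mathbf d(\phi_1)^H\mathbf A(\mathbf A^H\mathbf A)^{-1}\boldsymbol\xi_1\\ \mathbf d(\phi_2)^H\mathbf A(\mathbf A^H\mathbf A)^{-1}\boldsymbol\xi_2\end{bmatrix}\Big).$$ The pair $\boldsymbol\phi$ is consistent over $\boldsymbol\Xi$ (for $m$ sensors) if $$\big\|\mathbf a^H(\varphi)\big(\mathbf P_{\mathbf A}^\perp\mathbf B\mathbf D_0-\mathbf A(\mathbf A^H\mathbf A)^{-1}\big)\boldsymbol\Xi^{1/2}\big\|_2\le1\quad\text{for all }\varphi\in[-\pi,\pi].$$ A sequence $\boldsymbol\phi_m$ of pairs is almost asymptotically consistent if for almost all $\boldsymbol\Xi$ there is $M$ such that for every $m>M$ the pair $\boldsymbol\phi_m$ is consistent over $\boldsymbol\Xi$ for $m$ sensors. Limit objects.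 Let $F_a(\delta)=\frac{e^{j\delta}-1}{j\delta}$ (with $F_a(0)=1$), $G_a=F_a'$, $H_a=-G_a'$, $$\mathbf F_a=\begin{bmatrix}1&F_a(\delta)\\F_a(-\delta)&1\end{bmatrix},\quad \mathbf G_a=\begin{bmatrix}\tfrac j2&G_a(\delta)\\G_a(-\delta)&\tfrac j2\end{bmatrix}=[\mathbf g_{a1}\ \mathbf g_{a2}],\quad \mathbf H_a=\begin{bmatrix}\tfrac13&H_a(\delta)\\H_a(-\delta)&\tfrac13\end{bmatrix},$$ $\mathbf f_a(\delta',\delta)=[F_a(\delta')\ \ F_a(\delta+\delta')]$, $\mathbf g_a(\delta',\delta)=[G_a(\delta')\ \ G_a(\delta+\delta')]$, $\mathbf R_a=\operatorname{Re}[(\mathbf H_a-\mathbf G_a^H\mathbf F_a^{-1}\mathbf G_a)\odot\boldsymbol\Xi^T]$ and $\mathbf D_a=\operatorname{diag}(\boldsymbol\beta_a)$ with $$\boldsymbol\beta_a=\mathbf R_a^{-1}\operatorname{Re}\begin{bmatrix}\mathbf g_{a1}^H\mathbf F_a^{-1}\boldsymbol\xi_1\\ \mathbf g_{a2}^H\mathbf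 F_a^{-1}\boldsymbol\xi_2\end{bmatrix}.$$ Proposition. Let $T\ge1$, let $\Delta\phi_m\in[-\pi,\pi]\setminus\{0\}$ and $\boldsymbol\phi_m=[0\ \ \Delta\phi_m]$. (1) Suppose $m\Delta\phi_m\to\delta$ with $\delta\in\mathbb R$, $\delta\neq0$, and consider the condition $$\big\|\big((\mathbf g_a(\delta',\delta)-\mathbf f_a(\delta',\delta)\mathbf F_a^{-1}\mathbf G_a)\mathbf D_a-\mathbf f_a(\delta',\delta)\mathbf F_a^{-1}\big)\boldsymbol\Xi^{1/2}\big\|_2\le1\quad\text{for every }\delta'\in\mathbb R.\tag{$*$}$$ For almost every $\boldsymbol\Xi$: if $(*)$ holds for $\boldsymbol\Xi$, then there is $M$ such that $\boldsymbol\phi_m$ is consistent over $\boldsymbol\Xi$ for all $m>M$. Consequently, if $(*)$ holds for almost all $\boldsymbol\Xi$, then $\boldsymbol\phi_m$ is almost asymptotically consistent. (2) If $m\Delta\phi_m\to+\infty$, then $\boldsymbol\phi_m$ is almost asymptotically consistent. (3) If $m\Delta\phi_m\to0$, then $\boldsymbol\phi_m$ is not almost asymptotically consistent. -/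

import Mathlib

open scoped MatrixOrder

noncomputable section

namespace CLASS

/-! ### Objects attached to a basis manifold `a : ℝ → ℂ^m` and an index vector `θ` -/

section Manifold

variable {m n : ℕ}

/-- The matrix `A(θ) = [a(θ₁) … a(θₙ)]`. -/
def steer (a : ℝ → Fin m → ℂ) (θ : Fin n → ℝ) : Matrix (Fin m) (Fin n) ℂ :=
  Matrix.of fun k i => a (θ i) k

/-- The matrix `B(θ) = [a'(θ₁) … a'(θₙ)]` of derivatives of the manifold. -/
def dsteer (a : ℝ → Fin m → ℂ) (θ : Fin n → ℝ) : Matrix (Fin m) (Fin n) ℂ :=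
  steer (deriv a) θ

/-- `A (Aᴴ A)⁻¹`. -/
def steerDual (a : ℝ → Fin m → ℂ) (θ : Fin n → ℝ) : Matrix (Fin m) (Fin n) ℂ :=
  steer a θ * ((steer a θ).conjTranspose * steer a θ)⁻¹

/-- `P_A^⊥ = I - A (Aᴴ A)⁻¹ Aᴴ`. -/
def projPerp (a : ℝ → Fin m → ℂ) (θ : Fin n → ℝ) : Matrix (Fin m) (Fin m) ℂ :=
  1 - steerDual a θ * (steer a θ).conjTranspose

/-- `R = Re [Bᴴ P_A^⊥ B ⊙ Ξᵀ]`. -/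
def Rmat (a : ℝ → Fin m → ℂ) (θ : Fin n → ℝ) (Ξ : Matrix (Fin n) (Fin n) ℂ) :
    Matrix (Fin n) (Fin n) ℝ :=
  (Matrix.hadamard ((dsteer a θ).conjTranspose * projPerp a θ * dsteer a θ)
    Ξ.transpose).map Complex.re

/-- The vector `R⁻¹ Re [dᵢᴴ A (Aᴴ A)⁻¹ ξᵢ]ᵢ`, where `dᵢ`, `ξᵢ` are the `i`-th columns of `B` and
`Ξ`; it is the normalized first order shift `Γ β` of the estimated indexes. -/
def shift (a : ℝ → Fin m → ℂ) (θ : Fin n → ℝ) (Ξ : Matrix (Fin n) (Fin n) ℂ) : Fin n → ℝ :=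
  Matrix.mulVec (Rmat a θ Ξ)⁻¹
    fun i => (((dsteer a θ).conjTranspose * steerDual a θ * Ξ) i i).re

/-- The diagonal matrix `D₀`. -/
def D0 (a : ℝ → Fin m → ℂ) (θ : Fin n → ℝ) (Ξ : Matrix (Fin n) (Fin n) ℂ) :
    Matrix (Fin n) (Fin n) ℂ :=
  Matrix.diagonal fun i => (shift a θ Ξ i : ℂ)

/-- The index vector `θ` is consistent over `Ξ`, for the manifold `a` on the index set `Θ`:
`‖aᴴ(t) (P_A^⊥ B D₀ - A (Aᴴ A)⁻¹) Ξ^{1/2}‖₂ ≤ 1` for every `t ∈ Θ`. -/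
def ConsistentOver (Θ : Set ℝ) (a : ℝ → Fin m → ℂ) (θ : Fin n → ℝ)
    (Ξ : Matrix (Fin n) (Fin n) ℂ) : Prop :=
  ∀ t ∈ Θ, ‖WithLp.toLp 2 (Matrix.vecMul (star (a t))
    ((projPerp a θ * dsteer a θ * D0 a θ Ξ - steerDual a θ) * CFC.sqrt Ξ))‖ ≤ 1

end Manifold

/-! ### Almost all matrices `Ξ` for two sources -/

/-- The matrix `Ξ = U Uᴴ` for two sources whose normalized amplitude rows (the unit rows of `U`)
have inner product `ρ`. -/
def corr (ρ : ℂ) : Matrix (Fin 2) (Fin 2) ℂ :=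
  !![1, ρ; star ρ, 1]

/-- "For almost all matrices `Ξ`" with `T` snapshots. For `T = 1` the matrices `Ξ = U Uᴴ`, where
`U` is `2 × T` with unit rows, are the `corr ρ` with `|ρ| = 1`, and null sets are those of arc
length on this circle. For `T ≥ 2` they are the `corr ρ` with `|ρ| ≤ 1`, and null sets are those of
area on this disk. -/
def AlmostAll (T : ℕ) (P : Matrix (Fin 2) (Fin 2) ℂ → Prop) : Prop :=
  if T = 1 then
    ∀ᵐ ψ : ℝ, P (corr (Complex.exp (ψ * Complex.I)))
  else
    ∀ᵐ ρ ∂((MeasureTheory.volume : MeasureTheory.Measure ℂ).restrict (Metric.closedBall 0 1)),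
      P (corr ρ)

/-! ### The uniform linear array -/

/-- The half-wavelength ULA manifold as a function of the electrical angle:
`a(φ) = [1, e^{jφ}, …, e^{j(m-1)φ}]ᵀ`. -/
def ula (m : ℕ) (φ : ℝ) : Fin m → ℂ :=
  fun k => Complex.exp (Complex.I * ((k : ℕ) : ℂ) * φ)

/-- The range of the electrical angle `φ = π cos θ`. -/
def electricalAngles : Set ℝ := Set.Icc (-Real.pi) Real.pi

/-- There is `M` such that for every number `m > M` of sensors `φ_m` is consistent over `Ξ`. -/
def EventuallyConsistentOver (φ : ℕ → Fin 2 → ℝ) (Ξ : Matrix (Fin 2) (Fin 2) ℂ) : Prop :=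
  ∃ M : ℕ, ∀ m > M, ConsistentOver electricalAngles (ula m) (φ m) Ξ

/-- The sequence `φ_m` of pairs of electrical angles is almost asymptotically consistent. -/
def AlmostAsymptoticallyConsistent (T : ℕ) (φ : ℕ → Fin 2 → ℝ) : Prop :=
  AlmostAll T (EventuallyConsistentOver φ)

/-! ### The limit functions and the limit test -/

/-- `F_a(δ) = (e^{jδ} - 1) / (jδ)`, extended by continuity at `0`. -/
def Fa (δ : ℝ) : ℂ :=
  if δ = 0 then 1 else (Complex.exp (Complex.I * δ) - 1) / (Complex.I * δ)

/-- `G_a = F_a'`. -/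
def Ga (δ : ℝ) : ℂ := deriv Fa δ

/-- `H_a = -G_a'`. -/
def Ha (δ : ℝ) : ℂ := -deriv Ga δ

/-- The limit matrix `𝐅_a(δ)`. -/
def FaMat (δ : ℝ) : Matrix (Fin 2) (Fin 2) ℂ := !![1, Fa δ; Fa (-δ), 1]

/-- The limit matrix `𝐆_a(δ)`. -/
def GaMat (δ : ℝ) : Matrix (Fin 2) (Fin 2) ℂ :=
  !![Complex.I / 2, Ga δ; Ga (-δ), Complex.I / 2]

/-- The limit matrix `𝐇_a(δ)`. -/
def HaMat (δ : ℝ) : Matrix (Fin 2) (Fin 2) ℂ := !![1 / 3, Ha δ; Ha (-δ), 1 / 3]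

/-- The row vector `𝐟_a(δ', δ) = [F_a(δ'), F_a(δ + δ')]`. -/
def faVec (δ' δ : ℝ) : Fin 2 → ℂ := ![Fa δ', Fa (δ + δ')]

/-- The row vector `𝐠_a(δ', δ) = [G_a(δ'), G_a(δ + δ')]`. -/
def gaVec (δ' δ : ℝ) : Fin 2 → ℂ := ![Ga δ', Ga (δ + δ')]

/-- `R_a = Re [(𝐇_a - 𝐆_aᴴ 𝐅_a⁻¹ 𝐆_a) ⊙ Ξᵀ]`. -/
def RaMat (δ : ℝ) (Ξ : Matrix (Fin 2) (Fin 2) ℂ) : Matrix (Fin 2) (Fin 2) ℝ :=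
  (Matrix.hadamard (HaMat δ - (GaMat δ).conjTranspose * (FaMat δ)⁻¹ * GaMat δ)
    Ξ.transpose).map Complex.re

/-- `β_a = R_a⁻¹ Re [g_{ai}ᴴ 𝐅_a⁻¹ ξᵢ]ᵢ`, where `g_{ai}`, `ξᵢ` are the `i`-th columns of `𝐆_a` and
`Ξ`. -/
def betaA (δ : ℝ) (Ξ : Matrix (Fin 2) (Fin 2) ℂ) : Fin 2 → ℝ :=
  Matrix.mulVec (RaMat δ Ξ)⁻¹
    fun i => (((GaMat δ).conjTranspose * (FaMat δ)⁻¹ * Ξ) i i).re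

/-- The diagonal matrix `D_a` of the elements of `β_a`. -/
def Da (δ : ℝ) (Ξ : Matrix (Fin 2) (Fin 2) ℂ) : Matrix (Fin 2) (Fin 2) ℂ :=
  Matrix.diagonal fun i => (betaA δ Ξ i : ℂ)

/-- The limit test at `δ` over `Ξ`: for every `δ' ∈ ℝ`,
`‖((𝐠_a(δ', δ) - 𝐟_a(δ', δ) 𝐅_a⁻¹ 𝐆_a) D_a - 𝐟_a(δ', δ) 𝐅_a⁻¹) Ξ^{1/2}‖₂ ≤ 1`. -/
def LimitTest (δ : ℝ) (Ξ : Matrix (Fin 2) (Fin 2) ℂ) : Prop :=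
  ∀ δ' : ℝ, ‖WithLp.toLp 2 (Matrix.vecMul
    (Matrix.vecMul (gaVec δ' δ - Matrix.vecMul (faVec δ' δ) ((FaMat δ)⁻¹ * GaMat δ)) (Da δ Ξ)
      - Matrix.vecMul (faVec δ' δ) (FaMat δ)⁻¹)
    (CFC.sqrt Ξ))‖ ≤ 1

end CLASS

end

/-!
Moving the phase reference to the centre of the array makes the kernel `a(x)ᴴ a(y) / m` a real even
function, a scaled Dirichlet kernel in `m (x - y)`, with limit `2 sin (x / 2) / x`. It rotates the
correlation `ρ` by the phase between the sources at the centre, and then only the real part `r` of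
`ρ` matters. The squared norm in the test is `(1 + r) / 2 * V₊ ^ 2 + (1 - r) / 2 * V₋ ^ 2`, where
`V₊` and `V₋` are built from the (anti)symmetric combinations of the kernels of the two sources; it
is `1`, with zero derivative, at the sources.

* Fixed scaled distance: all derivatives of the kernels converge, so a limit power that is below `1`
  off the sources and strictly concave at them forces the power of a large array to stay at most
  `1`. A limit power bounded by `1` fails to be strict in this sense for countably many `r` only. In
  a parameter equivalent to `r`, contact with the level `1` in a direction `x` is a root of a cubic.
  The parameters at a simple root are isolated from one side among those where the power is at most
  `1`, hence countable. A double root is a zero of the discriminant, which is a nonzero analytic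
  function of `x` as soon as the shift depends on `r`.
* Separated sources decouple: the power is strictly concave near each of them and small elsewhere.
* Coalescing sources: the shift is of larger order than the inverse of the residual it multiplies,
  so the power is unbounded.
-/

noncomputable section

namespace CLASS

open Filter Topology Complex MeasureTheory
open scoped ComplexConjugate

/-! ### Centred kernels -/

/-- `D j` is the `j`-th derivative of a real even function `D 0` with `D 0 0 = 1`. -/
structure IsKernel (D : ℕ → ℝ → ℝ) : Prop where
  hasDerivAt : ∀ j x, HasDerivAt (D j) (D (j + 1) x) x
  neg : ∀ j x, D j (-x) = (-1) ^ j * D j x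
  one : D 0 0 = 1

namespace IsKernel

variable {D : ℕ → ℝ → ℝ}

lemma deriv_eq (hD : IsKernel D) (j : ℕ) : deriv (D j) = D (j + 1) :=
  funext fun x => (hD.hasDerivAt j x).deriv

lemma neg_zero (hD : IsKernel D) (x : ℝ) : D 0 (-x) = D 0 x := by
  simpa using hD.neg 0 x

lemma neg_one (hD : IsKernel D) (x : ℝ) : D 1 (-x) = -D 1 x := by
  simpa using hD.neg 1 x

lemma apply_zero_of_odd (hD : IsKernel D) {j : ℕ} (hj : Odd j) : D j 0 = 0 := by
  have := hD.neg j 0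
  rw [_root_.neg_zero, hj.neg_one_pow] at this
  linarith

end IsKernel

/-- The distribution of the normalized element positions of a centred linear array: a symmetric
probability measure on `[-1/2, 1/2]`. -/
structure IsAperture (μ : Measure ℝ) : Prop where
  isProbabilityMeasure : IsProbabilityMeasure μ
  isNegInvariant : μ.IsNegInvariant
  abs_le_half : ∀ᵐ u ∂μ, |u| ≤ 1 / 2

/-- The `j`-th derivative `∫ u ^ j cos (u x + j π / 2) dμ(u)` of the beam pattern
`∫ cos (u x) dμ(u)` of an aperture `μ`. -/
def kernel (μ : Measure ℝ) (j : ℕ) (x : ℝ) : ℝ :=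
  ∫ u, u ^ j * Real.cos (u * x + j * (Real.pi / 2)) ∂μ

lemma kernel_zero_eq (μ : Measure ℝ) (x : ℝ) : kernel μ 0 x = ∫ u, Real.cos (u * x) ∂μ := by
  simp [kernel]

lemma kernel_one_eq (μ : Measure ℝ) (x : ℝ) : kernel μ 1 x = -∫ u, u * Real.sin (u * x) ∂μ := by
  simp [kernel, Real.cos_add_pi_div_two, integral_neg]

lemma kernel_two_eq (μ : Measure ℝ) (x : ℝ) :
    kernel μ 2 x = -∫ u, u ^ 2 * Real.cos (u * x) ∂μ := by
  simp [kernel, mul_div_cancel₀, Real.cos_add_pi, integral_neg]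

lemma continuous_pow_mul_cos (j : ℕ) (x c : ℝ) :
    Continuous fun u : ℝ => u ^ j * Real.cos (u * x + c) := by fun_prop

lemma abs_pow_mul_cos_le {u : ℝ} (hu : |u| ≤ 1) (j : ℕ) (y : ℝ) :
    |u ^ j * Real.cos y| ≤ 1 := by
  rw [abs_mul, abs_pow]
  exact mul_le_one₀ (pow_le_one₀ (abs_nonneg u) hu) (abs_nonneg _) (Real.abs_cos_le_one y)

namespace IsAperture

variable {μ : Measure ℝ}

lemma abs_le_one (hμ : IsAperture μ) : ∀ᵐ u ∂μ, |u| ≤ 1 :=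
  hμ.abs_le_half.mono fun _ hu => hu.trans (by norm_num)

lemma integrable (hμ : IsAperture μ) {E : Type*} [NormedAddCommGroup E] {f : ℝ → E}
    (hf : Continuous f) : Integrable f μ := by
  have := hμ.isProbabilityMeasure
  obtain ⟨C, hC⟩ := (isCompact_Icc (a := (-1 / 2 : ℝ)) (b := 1 / 2)).exists_bound_of_continuousOn
    hf.continuousOn
  refine Integrable.of_bound hf.aestronglyMeasurable C ?_
  filter_upwards [hμ.abs_le_half] with u hu
  exact hC u ⟨by linarith [(abs_le.1 hu).1], (abs_le.1 hu).2⟩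

lemma abs_kernel_le_one (hμ : IsAperture μ) (j : ℕ) (x : ℝ) : |kernel μ j x| ≤ 1 := by
  have := hμ.isProbabilityMeasure
  have h : ∀ᵐ u ∂μ, ‖u ^ j * Real.cos (u * x + j * (Real.pi / 2))‖ ≤ 1 :=
    hμ.abs_le_one.mono fun u hu => abs_pow_mul_cos_le hu j _
  simpa [kernel] using norm_integral_le_of_norm_le_const h

lemma hasDerivAt_kernel (hμ : IsAperture μ) (j : ℕ) (x : ℝ) :
    HasDerivAt (kernel μ j) (kernel μ (j + 1) x) x := by
  have := hμ.isProbabilityMeasure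
  refine (hasDerivAt_integral_of_dominated_loc_of_deriv_le (bound := fun _ => 1)
    (F' := fun y u => u ^ (j + 1) * Real.cos (u * y + (j + 1 : ℕ) * (Real.pi / 2))) univ_mem
    (.of_forall fun y => (continuous_pow_mul_cos j y _).aestronglyMeasurable)
    (hμ.integrable (continuous_pow_mul_cos j x _))
    (continuous_pow_mul_cos (j + 1) x _).aestronglyMeasurable
    (hμ.abs_le_one.mono fun u hu y _ => abs_pow_mul_cos_le hu _ _)
    (integrable_const 1) (.of_forall fun u y _ => ?_)).2
  have h := (((hasDerivAt_id y).const_mul u).add_const (j * (Real.pi / 2))).cos.const_mul (u ^ j)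
  refine h.congr_deriv ?_
  rw [Nat.cast_succ, add_one_mul, ← add_assoc, Real.cos_add_pi_div_two, pow_succ]
  simp only [id_eq]
  ring

lemma kernel_neg (hμ : IsAperture μ) (j : ℕ) (x : ℝ) :
    kernel μ j (-x) = (-1) ^ j * kernel μ j x := by
  have := hμ.isNegInvariant
  rw [kernel, ← integral_neg_eq_self, kernel, ← integral_const_mul]
  refine integral_congr_ae (.of_forall fun u => ?_)
  simp only [neg_mul_neg, neg_pow u j]
  ring

lemma isKernel (hμ : IsAperture μ) : IsKernel (kernel μ) where
  hasDerivAt := hμ.hasDerivAt_kernel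
  neg := hμ.kernel_neg
  one := by
    have := hμ.isProbabilityMeasure
    simp [kernel]

lemma integral_exp_eq_kernel (hμ : IsAperture μ) (x : ℝ) :
    ∫ u, exp (I * u * x) ∂μ = kernel μ 0 x := by
  have := hμ.isNegInvariant
  have hsin : ∫ u, Real.sin (u * x) ∂μ = 0 := by
    have h := integral_neg_eq_self (fun u => Real.sin (u * x)) μ
    simp only [neg_mul, Real.sin_neg, integral_neg] at h
    linarith
  have hexp : ∀ u : ℝ, exp (I * u * x) = (Real.cos (u * x) : ℂ) + Real.sin (u * x) * I := by
    intro u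
    rw [mul_assoc, mul_comm I, ← ofReal_mul, exp_mul_I, ofReal_cos, ofReal_sin]
  simp only [hexp]
  rw [integral_add (hμ.integrable (by fun_prop)) (hμ.integrable (by fun_prop)),
    integral_mul_const, integral_complex_ofReal, integral_complex_ofReal,
    hsin, kernel_zero_eq]
  simp

lemma analyticAt_kernel (hμ : IsAperture μ) (j : ℕ) (x : ℝ) : AnalyticAt ℝ (kernel μ j) x := by
  have := hμ.isProbabilityMeasure
  induction j generalizing x with
  | succ j ih => exact hμ.isKernel.deriv_eq j ▸ (ih x).deriv
  | zero =>
    have hset : ProbabilityTheory.integrableExpSet id μ = Set.univ :=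
      Set.eq_univ_of_forall fun t => hμ.integrable (by fun_prop)
    have hmgf : AnalyticAt ℂ (fun z => ProbabilityTheory.complexMGF id μ (z * I)) x :=
      (ProbabilityTheory.analyticAt_complexMGF (by simp [hset])).fun_comp_of_eq
        (by fun_prop) rfl
    refine hmgf.re_ofReal.congr (.of_forall fun y => ?_)
    rw [← ofReal_re (kernel μ 0 y), ← hμ.integral_exp_eq_kernel]
    have hexp : ∀ u : ℝ, I * u * y = y * I * u := fun u => by ring
    simp only [hexp, ProbabilityTheory.complexMGF, id]

end IsAperture

/-- Position of the `k`-th element of the centred array of `m` sensors, in units of its length. -/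
def pos (m k : ℕ) : ℝ := (k + 1 / 2) / m - 1 / 2

/-- Left end of the cell of length `1 / m` centred at `pos m k`; these cells tile
`[-1/2, 1/2]`. -/
def edge (m k : ℕ) : ℝ := k / m - 1 / 2

/-- The aperture of the uniform linear array of `m` sensors. -/
def arrayAperture (m : ℕ) : Measure ℝ :=
  (m : ENNReal)⁻¹ • ∑ k ∈ Finset.range m, Measure.dirac (pos m k)

/-- The aperture of a continuous array, the limit of the apertures of the uniform linear arrays. -/
def uniformAperture : Measure ℝ := volume.restrict (Set.Icc (-1 / 2) (1 / 2))

/-- The derivatives of the normalized beam pattern of the array of `m` sensors. -/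
abbrev arrayKernel (m : ℕ) : ℕ → ℝ → ℝ := kernel (arrayAperture m)

/-- The derivatives of the limit `2 sin (x / 2) / x` of the beam patterns. -/
abbrev limitKernel : ℕ → ℝ → ℝ := kernel uniformAperture

lemma pos_succ_sub_pos (m k : ℕ) : pos m (k + 1) - pos m k = 1 / m := by
  rw [pos, pos, Nat.cast_succ]
  ring

lemma edge_succ_sub_edge (m k : ℕ) : edge m (k + 1) - edge m k = 1 / m := by
  rw [edge, edge, Nat.cast_succ]
  ring

lemma edge_add_half_cell (m k : ℕ) : edge m k + 1 / (2 * m) = pos m k := by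
  rw [pos, edge]
  ring

lemma edge_zero (m : ℕ) : edge m 0 = -1 / 2 := by
  norm_num [edge]

lemma edge_self {m : ℕ} (hm : m ≠ 0) : edge m m = 1 / 2 := by
  norm_num [edge, hm]

lemma edge_mem_Icc {m k : ℕ} (hm : m ≠ 0) (hk : k ≤ m) :
    edge m k ∈ Set.Icc (-1 / 2 : ℝ) (1 / 2) := by
  have hk' : (k : ℝ) / m ≤ 1 := div_le_one_of_le₀ (by exact_mod_cast hk) (by positivity)
  rw [edge]
  constructor <;> linarith [show 0 ≤ (k : ℝ) / m by positivity]

lemma pos_mem_Icc {m k : ℕ} (hk : k < m) : pos m k ∈ Set.Icc (-1 / 2 : ℝ) (1 / 2) := by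
  have hm : m ≠ 0 := by omega
  have hleft := (edge_mem_Icc hm hk.le).1
  have hright := (edge_mem_Icc hm hk).2
  have hcell : 0 ≤ 1 / (2 * m : ℝ) := by positivity
  have hhalf : 1 / (m : ℝ) = 2 * (1 / (2 * m)) := by ring
  constructor <;> linarith [edge_add_half_cell m k, edge_succ_sub_edge m k]

lemma abs_pos_le_half {m k : ℕ} (hk : k < m) : |pos m k| ≤ 1 / 2 :=
  abs_le.2 ⟨by linarith [(pos_mem_Icc hk).1], (pos_mem_Icc hk).2⟩

lemma pos_reflect {m k : ℕ} (hk : k < m) : pos m (m - 1 - k) = -pos m k := by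
  have hm : (m : ℝ) ≠ 0 := by exact_mod_cast (k.zero_le.trans_lt hk).ne'
  have hcast : ((m - 1 - k : ℕ) : ℝ) = m - 1 - k := by
    rw [Nat.sub_sub, Nat.cast_sub (by omega)]
    push_cast
    ring
  rw [pos, pos, hcast]
  field_simp
  ring

lemma integral_arrayAperture {E : Type*} [NormedAddCommGroup E] [NormedSpace ℝ E]
    [CompleteSpace E] (m : ℕ) (f : ℝ → E) :
    ∫ u, f u ∂arrayAperture m = (m : ℝ)⁻¹ • ∑ k ∈ Finset.range m, f (pos m k) := by
  rw [arrayAperture, integral_smul_measure,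
    integral_finsetSum_measure fun k _ => integrable_dirac enorm_lt_top]
  simp

lemma integral_uniformAperture {E : Type*} [NormedAddCommGroup E] [NormedSpace ℝ E]
    (f : ℝ → E) : ∫ u, f u ∂uniformAperture = ∫ u in (-1 / 2)..(1 / 2), f u := by
  rw [uniformAperture, integral_Icc_eq_integral_Ioc,
    intervalIntegral.integral_of_le (by norm_num)]

lemma isAperture_arrayAperture {m : ℕ} (hm : m ≠ 0) : IsAperture (arrayAperture m) where
  isProbabilityMeasure := ⟨by
    simp [arrayAperture, ENNReal.inv_mul_cancel, hm]⟩
  isNegInvariant := ⟨by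
    rw [Measure.neg, arrayAperture, Measure.map_smul, ← Measure.mapₗ_apply_of_measurable
      measurable_neg, map_sum, ← Finset.sum_range_reflect]
    congr 1
    refine Finset.sum_congr rfl fun k hk => ?_
    rw [Measure.mapₗ_apply_of_measurable measurable_neg, Measure.map_dirac' measurable_neg,
      pos_reflect (Finset.mem_range.1 hk), neg_neg]⟩
  abs_le_half := by
    rw [arrayAperture, ae_iff, Measure.smul_apply, Measure.finsetSum_apply]
    refine smul_eq_zero_of_right _ (Finset.sum_eq_zero fun k hk => ?_)
    rw [Measure.dirac_apply]
    simpa using abs_pos_le_half (Finset.mem_range.1 hk)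

lemma isAperture_uniformAperture : IsAperture uniformAperture where
  isProbabilityMeasure := ⟨by norm_num [uniformAperture]⟩
  isNegInvariant := ⟨by
    have h := ((Measure.measurePreserving_neg (volume : Measure ℝ)).restrict_preimage
      (measurableSet_Icc (a := (-1 / 2 : ℝ)) (b := 1 / 2))).map_eq
    rwa [Set.neg_preimage, Set.neg_Icc, neg_div, neg_neg, ← neg_div] at h⟩
  abs_le_half := by
    refine (ae_restrict_mem measurableSet_Icc).mono fun u hu => ?_
    exact abs_le.2 ⟨by linarith [hu.1], hu.2⟩

lemma isKernel_arrayKernel {m : ℕ} (hm : m ≠ 0) : IsKernel (arrayKernel m) :=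
  (isAperture_arrayAperture hm).isKernel

lemma isKernel_limitKernel : IsKernel limitKernel :=
  isAperture_uniformAperture.isKernel

lemma abs_integral_arrayAperture_sub_le {f : ℝ → ℝ} (hf : Continuous f) {m : ℕ} (hm : m ≠ 0)
    {ε : ℝ} (hε : ∀ u ∈ Set.Icc (-1 / 2 : ℝ) (1 / 2), ∀ v ∈ Set.Icc (-1 / 2 : ℝ) (1 / 2),
      |u - v| ≤ 1 / m → |f u - f v| ≤ ε) :
    |(∫ u, f u ∂uniformAperture) - ∫ u, f u ∂arrayAperture m| ≤ ε := by
  have hm' : (0 : ℝ) < m := by exact_mod_cast hm.bot_lt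
  have hsplit : (∫ u, f u ∂uniformAperture) - ∫ u, f u ∂arrayAperture m =
      ∑ k ∈ Finset.range m, ∫ u in edge m k..edge m (k + 1), (f u - f (pos m k)) := by
    rw [integral_uniformAperture, integral_arrayAperture, ← edge_zero m, ← edge_self hm,
      ← intervalIntegral.sum_integral_adjacent_intervals fun k _ => hf.intervalIntegrable _ _,
      Finset.smul_sum, ← Finset.sum_sub_distrib]
    refine Finset.sum_congr rfl fun k _ => ?_
    rw [intervalIntegral.integral_sub (hf.intervalIntegrable _ _) intervalIntegrable_const,
      intervalIntegral.integral_const, edge_succ_sub_edge, one_div]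
  have hcell : ∀ k ∈ Finset.range m,
      |∫ u in edge m k..edge m (k + 1), (f u - f (pos m k))| ≤ ε * (1 / m) := by
    intro k hk
    have hkm := Finset.mem_range.1 hk
    have hstep := edge_succ_sub_edge m k
    have hhalf : 1 / (m : ℝ) = 2 * (1 / (2 * m)) := by ring
    have hinv := one_div_pos.2 hm'
    have h := intervalIntegral.norm_integral_le_of_norm_le_const (a := edge m k)
      (b := edge m (k + 1)) (f := fun u => f u - f (pos m k)) (C := ε) fun u hu => by
        rw [Set.uIoc_of_le (by linarith)] at hu
        refine hε u ⟨?_, ?_⟩ _ (pos_mem_Icc hkm) (abs_le.2 ⟨?_, ?_⟩) <;>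
          linarith [hu.1, hu.2, edge_add_half_cell m k, (edge_mem_Icc hm hkm.le).1,
            (edge_mem_Icc hm hkm).2]
    rwa [hstep, abs_of_pos hinv] at h
  calc _ ≤ ∑ k ∈ Finset.range m, |∫ u in edge m k..edge m (k + 1), (f u - f (pos m k))| :=
        hsplit ▸ Finset.abs_sum_le_sum_abs _ _
    _ ≤ ∑ k ∈ Finset.range m, ε * (1 / m) := Finset.sum_le_sum hcell
    _ = ε := by
      rw [Finset.sum_const, Finset.card_range, nsmul_eq_mul]
      field_simp

lemma tendsto_integral_arrayAperture {f : ℝ → ℝ} (hf : Continuous f) :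
    Tendsto (fun m => ∫ u, f u ∂arrayAperture m) atTop (𝓝 (∫ u, f u ∂uniformAperture)) := by
  refine Metric.tendsto_nhds.2 fun ε hε => ?_
  obtain ⟨η, hη, hfη⟩ := Metric.uniformContinuousOn_iff_le.1
    ((isCompact_Icc (a := (-1 / 2 : ℝ)) (b := 1 / 2)).uniformContinuousOn_of_continuous
      hf.continuousOn) (ε / 2) (by positivity)
  filter_upwards [eventually_ne_atTop 0,
    tendsto_one_div_atTop_nhds_zero_nat.eventually_le_const hη] with m hm hmη
  rw [dist_comm]
  exact (abs_integral_arrayAperture_sub_le hf hm fun u hu v hv huv =>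
    hfη u hu v hv (huv.trans hmη)).trans_lt (half_lt_self hε)

/-- The beam patterns are `1`-Lipschitz, so their pointwise convergence is a continuous one. -/
lemma tendsto_arrayKernel {α : Type*} {F : Filter α} {n : α → ℕ} {y : α → ℝ} {y₀ : ℝ}
    (hn : Tendsto n F atTop) (hy : Tendsto y F (𝓝 y₀)) (j : ℕ) :
    Tendsto (fun p => arrayKernel (n p) j (y p)) F (𝓝 (limitKernel j y₀)) := by
  have hpoint : Tendsto (fun p => arrayKernel (n p) j y₀) F (𝓝 (limitKernel j y₀)) :=
    (tendsto_integral_arrayAperture (continuous_pow_mul_cos j y₀ _)).comp hn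
  have hlip : Tendsto (fun p => arrayKernel (n p) j (y p) - arrayKernel (n p) j y₀) F (𝓝 0) := by
    refine squeeze_zero_norm' ?_ (tendsto_iff_dist_tendsto_zero.1 hy)
    filter_upwards [hn.eventually_ne_atTop 0] with p hp
    have hμ := isAperture_arrayAperture hp
    have h := convex_univ.norm_image_sub_le_of_norm_hasDerivWithin_le (C := 1)
      (fun x _ => (hμ.hasDerivAt_kernel j x).hasDerivWithinAt)
      (fun x _ => hμ.abs_kernel_le_one (j + 1) x) (Set.mem_univ y₀) (Set.mem_univ (y p))
    rwa [one_mul] at h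
  simpa using hlip.add hpoint

lemma arrayKernel_eq_sum (m j : ℕ) (x : ℝ) : arrayKernel m j x =
    (m : ℝ)⁻¹ * ∑ k ∈ Finset.range m, pos m k ^ j * Real.cos (pos m k * x + j * (Real.pi / 2)) :=
  integral_arrayAperture m _

lemma arrayKernel_add_period (m j : ℕ) (x : ℝ) :
    arrayKernel m j (x + 2 * Real.pi * m) = (-1) ^ (m + 1) * arrayKernel m j x := by
  rcases eq_or_ne m 0 with rfl | hm
  · simp [arrayKernel_eq_sum]
  have hm' : (m : ℝ) ≠ 0 := by exact_mod_cast hm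
  rw [arrayKernel_eq_sum, arrayKernel_eq_sum, mul_left_comm]
  congr 1
  rw [Finset.mul_sum]
  refine Finset.sum_congr rfl fun k _ => ?_
  have harg : pos m k * (x + 2 * Real.pi * m) + j * (Real.pi / 2) =
      pos m k * x + j * (Real.pi / 2) + ((m + 1 : ℕ) : ℤ) * Real.pi + (k - m : ℤ) * (2 * Real.pi)
      := by
    have : pos m k * m = k + 1 / 2 - m / 2 := by
      rw [pos]
      field_simp
    push_cast
    linear_combination 2 * Real.pi * this
  rw [harg, Real.cos_add_int_mul_two_pi, Real.cos_add_int_mul_pi, zpow_natCast]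
  ring

lemma abs_pow_sub_pow_le_of_abs_le_one {a b : ℝ} (ha : |a| ≤ 1) (hb : |b| ≤ 1) (n : ℕ) :
    |a ^ n - b ^ n| ≤ n * |a - b| := by
  refine (abs_pow_sub_pow_le a b n).trans ?_
  rw [mul_comm |a - b|]
  exact mul_le_of_le_one_right (by positivity) (pow_le_one₀ (by positivity) (max_le ha hb))

lemma two_mul_sin_mul_cos_eq_edge_sub (m k : ℕ) (x c : ℝ) :
    2 * Real.sin (x / (2 * m)) * Real.cos (pos m k * x + c) =
      Real.sin (edge m (k + 1) * x + c) - Real.sin (edge m k * x + c) := by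
  have hstep := edge_succ_sub_edge m k
  have hmid := edge_add_half_cell m k
  rw [Real.sin_sub_sin]
  congr 3
  · linear_combination (-x / 2) * hstep
  · linear_combination (-x / 2) * hstep - x * hmid

lemma abs_sum_mul_sub_le {a s : ℕ → ℝ} {m : ℕ} {B C : ℝ} (ha : ∀ k < m, |a k| ≤ 1)
    (hC : 0 ≤ C) (hac : ∀ k, k + 1 < m → |a (k + 1) - a k| ≤ C) (hs : ∀ k, |s k - s 0| ≤ B) :
    |∑ k ∈ Finset.range m, a k * (s (k + 1) - s k)| ≤ B + m * (C * B) := by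
  have hB : 0 ≤ B := (abs_nonneg _).trans (hs 0)
  rcases m.eq_zero_or_pos with rfl | hm
  · simpa using hB
  have hparts := Finset.sum_range_by_parts a (fun k => s (k + 1) - s k) m
  simp only [Finset.sum_range_sub, smul_eq_mul] at hparts
  have hlast : |a (m - 1) * (s m - s 0)| ≤ B := by
    rw [abs_mul]
    exact (mul_le_of_le_one_left (abs_nonneg _) (ha _ (by omega))).trans (hs m)
  have hterm : ∀ k ∈ Finset.range (m - 1), |(a (k + 1) - a k) * (s (k + 1) - s 0)| ≤ C * B := by
    intro k hk
    have hk' : k + 1 < m := by have := Finset.mem_range.1 hk; omega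
    rw [abs_mul]
    exact mul_le_mul (hac k hk') (hs _) (abs_nonneg _) hC
  rw [hparts]
  refine (abs_sub _ _).trans (add_le_add hlast ((Finset.abs_sum_le_sum_abs _ _).trans
    ((Finset.sum_le_sum hterm).trans ?_)))
  rw [Finset.sum_const, Finset.card_range, nsmul_eq_mul]
  gcongr
  omega

/-- Summation by parts: multiplication by `sin (x / 2 m)` telescopes the sum of the cosines. -/
lemma abs_arrayKernel_mul_le {m : ℕ} (hm : m ≠ 0) (j : ℕ) (x : ℝ) :
    |arrayKernel m j x| * (m * |Real.sin (x / (2 * m))|) ≤ 1 + j := by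
  have hm' : (0 : ℝ) < m := by exact_mod_cast hm.bot_lt
  have hpos {k : ℕ} (hk : k < m) : |pos m k| ≤ 1 := (abs_pos_le_half hk).trans (by norm_num)
  set s : ℕ → ℝ := fun k => Real.sin (edge m k * x + j * (Real.pi / 2)) with hs_def
  have hs (k : ℕ) : |s k - s 0| ≤ 2 := by
    have h := abs_sub (s k) (s 0)
    linarith [Real.abs_sin_le_one (edge m k * x + j * (Real.pi / 2)),
      Real.abs_sin_le_one (edge m 0 * x + j * (Real.pi / 2))]
  have hsum : 2 * (arrayKernel m j x * (m * Real.sin (x / (2 * m)))) =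
      ∑ k ∈ Finset.range m, pos m k ^ j * (s (k + 1) - s k) := by
    rw [arrayKernel_eq_sum, mul_mul_mul_comm, inv_mul_cancel₀ hm'.ne', one_mul, Finset.sum_mul,
      Finset.mul_sum]
    refine Finset.sum_congr rfl fun k _ => ?_
    rw [hs_def, ← two_mul_sin_mul_cos_eq_edge_sub]
    ring
  have hdiff (k : ℕ) (hk : k + 1 < m) : |pos m (k + 1) ^ j - pos m k ^ j| ≤ j * (1 / m) := by
    have h := abs_pow_sub_pow_le_of_abs_le_one (hpos hk) (hpos (by omega : k < m)) j
    rwa [pos_succ_sub_pos, abs_of_pos (by positivity : 0 < 1 / (m : ℝ))] at h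
  have habel := abs_sum_mul_sub_le (a := fun k => pos m k ^ j)
    (fun k hk => (abs_pow _ _).trans_le (pow_le_one₀ (abs_nonneg _) (hpos hk)))
    (by positivity) hdiff hs
  rw [← hsum, abs_mul, abs_two, abs_mul, abs_mul, abs_of_pos hm'] at habel
  have hC : m * (j * (1 / m) * 2) = 2 * (j : ℝ) := by field_simp
  linarith

/-! ### The power pattern of a pair of sources -/

section Definitions

variable (D : ℕ → ℝ → ℝ) (δ ε : ℝ)

/-- The symmetric (`ε = 1`) or antisymmetric (`ε = -1`) combination of the kernels `D j` of two
sources at distance `δ`, scaled so that it is one at the first source when `j = 0`. -/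
def interp (j : ℕ) (x : ℝ) : ℝ := (D j x + ε * D j (x + δ)) / (1 + ε * D 0 δ)

/-- The part of the differentiated kernels of the two sources that is orthogonal to the kernels
themselves, of parity opposite to `ε`. It vanishes at both sources when `j = 0`. -/
def residual (j : ℕ) (x : ℝ) : ℝ :=
  D (j + 1) x - ε * D (j + 1) (x + δ) + ε * D 1 δ * interp D δ ε j x

/-- The `j`-th derivative of the signed amplitude `interp - t * residual`, where `t` is the first
order relative shift of the sources. -/
def ampl (t : ℝ) (j : ℕ) (x : ℝ) : ℝ := interp D δ ε j x - t * residual D δ ε j x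

/-- The two eigenvalues (`ε = ±1`) of the Schur complement `H - Gᴴ F⁻¹ G` of the kernels. -/
def schurEigen : ℝ := -(D 2 0 + ε * D 2 δ) - D 1 δ ^ 2 / (1 - ε * D 0 δ)

/-- The mean of the two Schur eigenvalues with weights `(1 - r) / 2` and `(1 + r) / 2`; it is one
of the two eigenvalues of `R`, the other one being its value at `-r`. -/
def shiftDenom (r : ℝ) : ℝ :=
  ((1 - r) * schurEigen D δ 1 + (1 + r) * schurEigen D δ (-1)) / 2

/-- The first order relative shift of two sources with effective correlation `r`. -/
def relShift (r : ℝ) : ℝ := D 1 δ / (1 - D 0 δ ^ 2) * (D 0 δ - r) / shiftDenom D δ r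

/-- The squared norm in the consistency test, for sources at `0` and `-δ` with effective
correlation `r`. -/
def power (r x : ℝ) : ℝ :=
  (1 + r) / 2 * ampl D δ 1 (relShift D δ r) 0 x ^ 2 +
    (1 - r) / 2 * ampl D δ (-1) (relShift D δ r) 0 x ^ 2

/-- The first derivative of `power`. -/
def power1 (r x : ℝ) : ℝ :=
  (1 + r) * (ampl D δ 1 (relShift D δ r) 0 x * ampl D δ 1 (relShift D δ r) 1 x) +
    (1 - r) * (ampl D δ (-1) (relShift D δ r) 0 x * ampl D δ (-1) (relShift D δ r) 1 x)

/-- The second derivative of `power`. -/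
def power2 (r x : ℝ) : ℝ :=
  (1 + r) * (ampl D δ 1 (relShift D δ r) 1 x ^ 2 +
      ampl D δ 1 (relShift D δ r) 0 x * ampl D δ 1 (relShift D δ r) 2 x) +
    (1 - r) * (ampl D δ (-1) (relShift D δ r) 1 x ^ 2 +
      ampl D δ (-1) (relShift D δ r) 0 x * ampl D δ (-1) (relShift D δ r) 2 x)

/-- Two sources with effective correlation `r` for which the Gram matrix and `R` are positive
definite. -/
structure IsNondegenerate (r : ℝ) : Prop where
  abs_lt : |D 0 δ| < 1
  shiftDenom_pos : 0 < shiftDenom D δ r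
  shiftDenom_neg_pos : 0 < shiftDenom D δ (-r)

end Definitions

lemma one_add_mul_pos {ε s : ℝ} (hε : ε ^ 2 = 1) (hs : |s| < 1) : 0 < 1 + ε * s := by
  obtain ⟨h₁, h₂⟩ := abs_lt.1 hs
  rcases sq_eq_one_iff.1 hε with rfl | rfl <;> linarith

section Power

variable {D : ℕ → ℝ → ℝ} {δ ε r t : ℝ}

lemma shiftDenom_pos_of_schurEigen_pos (h₁ : 0 < schurEigen D δ 1) (h₂ : 0 < schurEigen D δ (-1))
    (hr : |r| ≤ 1) : 0 < shiftDenom D δ r := by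
  obtain ⟨hr₁, hr₂⟩ := abs_le.1 hr
  rw [shiftDenom]
  rcases hr₁.eq_or_lt with rfl | hr₁
  · linarith
  · have := mul_nonneg (sub_nonneg.2 hr₂) h₁.le
    have := mul_pos (neg_lt_iff_pos_add'.1 hr₁) h₂
    linarith

namespace IsKernel

lemma hasDerivAt_add (hD : IsKernel D) (j : ℕ) (x : ℝ) :
    HasDerivAt (fun x => D j (x + δ)) (D (j + 1) (x + δ)) x :=
  (hD.hasDerivAt j (x + δ)).comp_add_const x δ

lemma hasDerivAt_interp (hD : IsKernel D) (j : ℕ) (x : ℝ) :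
    HasDerivAt (interp D δ ε j) (interp D δ ε (j + 1) x) x :=
  ((hD.hasDerivAt j x).fun_add ((hD.hasDerivAt_add j x).const_mul ε)).div_const _

lemma hasDerivAt_ampl (hD : IsKernel D) (j : ℕ) (x : ℝ) :
    HasDerivAt (ampl D δ ε t j) (ampl D δ ε t (j + 1) x) x :=
  (hD.hasDerivAt_interp j x).fun_sub ((((hD.hasDerivAt (j + 1) x).fun_sub
    ((hD.hasDerivAt_add (j + 1) x).const_mul ε)).fun_add
      ((hD.hasDerivAt_interp j x).const_mul _)).const_mul t)

lemma hasDerivAt_power (hD : IsKernel D) (x : ℝ) :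
    HasDerivAt (power D δ r) (power1 D δ r x) x := by
  have hsq (ε : ℝ) := (hD.hasDerivAt_ampl (δ := δ) (ε := ε) (t := relShift D δ r) 0 x).fun_pow 2
  refine (((hsq 1).const_mul _).fun_add ((hsq (-1)).const_mul _)).congr_deriv ?_
  rw [power1]
  push_cast
  ring

lemma hasDerivAt_power1 (hD : IsKernel D) (x : ℝ) :
    HasDerivAt (power1 D δ r) (power2 D δ r x) x := by
  have hV (ε : ℝ) (j : ℕ) := hD.hasDerivAt_ampl (δ := δ) (ε := ε) (t := relShift D δ r) j x
  refine ((((hV 1 0).fun_mul (hV 1 1)).const_mul _).fun_add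
    (((hV (-1) 0).fun_mul (hV (-1) 1)).const_mul _)).congr_deriv ?_
  rw [power2]
  ring

lemma interp_zero_zero (hD : IsKernel D) (hε : ε ^ 2 = 1) (hs : |D 0 δ| < 1) :
    interp D δ ε 0 0 = 1 := by
  rw [interp, zero_add, hD.one, div_self (one_add_mul_pos hε hs).ne']

lemma ampl_zero_zero (hD : IsKernel D) (hε : ε ^ 2 = 1) (hs : |D 0 δ| < 1) :
    ampl D δ ε t 0 0 = 1 := by
  simp only [ampl, residual, hD.interp_zero_zero hε hs, zero_add,
    hD.apply_zero_of_odd odd_one]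
  ring

lemma ampl_one_zero (hD : IsKernel D) (hε : ε ^ 2 = 1) :
    ampl D δ ε t 1 0 = ε * D 1 δ / (1 + ε * D 0 δ) + t * schurEigen D δ (-ε) := by
  simp only [ampl, residual, interp, schurEigen, zero_add, hD.apply_zero_of_odd odd_one,
    neg_mul, sub_neg_eq_add]
  linear_combination -t * D 1 δ ^ 2 / (1 + ε * D 0 δ) * hε

lemma power_zero (hD : IsKernel D) (hs : |D 0 δ| < 1) : power D δ r 0 = 1 := by
  rw [power, hD.ampl_zero_zero (one_pow 2) hs, hD.ampl_zero_zero (by norm_num) hs]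
  ring

-- The relative shift is the value of `t` that makes the power stationary at the sources.
lemma power1_zero (hD : IsKernel D) (h : IsNondegenerate D δ r) : power1 D δ r 0 = 0 := by
  have hs₁ : 1 + D 0 δ ≠ 0 := by simpa using (one_add_mul_pos (one_pow 2) h.abs_lt).ne'
  have hs₂ : 1 - D 0 δ ≠ 0 := by
    simpa [sub_eq_add_neg] using (one_add_mul_pos (ε := -1) (by norm_num) h.abs_lt).ne'
  have ht : relShift D δ r * shiftDenom D δ r = D 1 δ / (1 - D 0 δ ^ 2) * (D 0 δ - r) :=
    div_mul_cancel₀ _ h.shiftDenom_pos.ne'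
  have hsplit : D 1 δ / (1 - D 0 δ ^ 2) * (D 0 δ - r) * 2 =
      (1 - r) * (D 1 δ / (1 - D 0 δ)) - (1 + r) * (D 1 δ / (1 + D 0 δ)) := by
    rw [show 1 - D 0 δ ^ 2 = (1 - D 0 δ) * (1 + D 0 δ) by ring]
    field_simp
    ring
  rw [power1, hD.ampl_zero_zero (one_pow 2) h.abs_lt, hD.ampl_zero_zero (by norm_num) h.abs_lt,
    hD.ampl_one_zero (one_pow 2), hD.ampl_one_zero (by norm_num), neg_neg]
  rw [shiftDenom] at ht
  linear_combination 2 * ht + hsplit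

lemma interp_reflect (hD : IsKernel D) (hε : ε ^ 2 = 1) (x : ℝ) :
    interp D δ ε 0 (-δ - x) = ε * interp D δ ε 0 x := by
  rw [interp, interp, show -δ - x + δ = -x by ring, show -δ - x = -(x + δ) by ring, hD.neg_zero,
    hD.neg_zero]
  linear_combination -D 0 (x + δ) / (1 + ε * D 0 δ) * hε

lemma ampl_reflect (hD : IsKernel D) (hε : ε ^ 2 = 1) (x : ℝ) :
    ampl D δ ε t 0 (-δ - x) = ε * ampl D δ ε t 0 x := by
  simp only [ampl, residual, hD.interp_reflect hε, zero_add]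
  rw [show -δ - x + δ = -x by ring, show -δ - x = -(x + δ) by ring, hD.neg_one, hD.neg_one]
  linear_combination -t * D 1 (x + δ) * hε

lemma power_reflect (hD : IsKernel D) (x : ℝ) : power D δ r (-δ - x) = power D δ r x := by
  rw [power, power, hD.ampl_reflect (one_pow 2), hD.ampl_reflect (by norm_num)]
  ring

end IsKernel

end Power

/-! ### The power near a source -/

lemma exists_eq_add_second_deriv_of_pos {h h₁ h₂ : ℝ → ℝ} (hh : ∀ x, HasDerivAt h (h₁ x) x)
    (hh₁ : ∀ x, HasDerivAt h₁ (h₂ x) x) (h0 : h₁ 0 = 0) {x : ℝ} (hx : 0 < x) :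
    ∃ ζ, |ζ| ≤ x ∧ h x = h 0 + h₂ ζ / 2 * x ^ 2 := by
  have hc : Continuous h := continuous_iff_continuousAt.2 fun x => (hh x).continuousAt
  have hc₁ : Continuous h₁ := continuous_iff_continuousAt.2 fun x => (hh₁ x).continuousAt
  obtain ⟨ξ, ⟨hξ, hξx⟩, hξ_eq⟩ := exists_ratio_hasDerivAt_eq_ratio_slope h h₁ hx hc.continuousOn
    (fun y _ => hh y) (fun y => y ^ 2) (fun y => 2 * y) (by fun_prop)
    (fun y _ => by simpa using hasDerivAt_pow 2 y)
  obtain ⟨ζ, ⟨hζ, hζξ⟩, hζ_eq⟩ := exists_hasDerivAt_eq_slope h₁ h₂ hξ hc₁.continuousOn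
    fun y _ => hh₁ y
  refine ⟨ζ, by rw [abs_of_pos hζ]; linarith, mul_left_cancel₀ hξ.ne' ?_⟩
  rw [h0, sub_zero, sub_zero, eq_div_iff hξ.ne'] at hζ_eq
  linear_combination -hξ_eq / 2 - hζ_eq * x ^ 2 / 2

lemma exists_eq_add_second_deriv {h h₁ h₂ : ℝ → ℝ} (hh : ∀ x, HasDerivAt h (h₁ x) x)
    (hh₁ : ∀ x, HasDerivAt h₁ (h₂ x) x) (h0 : h₁ 0 = 0) (x : ℝ) :
    ∃ ζ, |ζ| ≤ |x| ∧ h x = h 0 + h₂ ζ / 2 * x ^ 2 := by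
  rcases lt_trichotomy x 0 with hx | rfl | hx
  · obtain ⟨ζ, hζ, hζ_eq⟩ := exists_eq_add_second_deriv_of_pos (h := fun y => h (-y))
      (h₁ := fun y => -h₁ (-y)) (h₂ := fun y => h₂ (-y))
      (fun y => by simpa [Function.comp_def] using (hh (-y)).scomp y (hasDerivAt_neg y))
      (fun y => by simpa [Function.comp_def] using ((hh₁ (-y)).scomp y (hasDerivAt_neg y)).fun_neg)
      (by simp [h0])
      (neg_pos.2 hx)
    exact ⟨-ζ, by rwa [abs_neg, abs_of_neg hx], by simpa using hζ_eq⟩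
  · exact ⟨0, by simp⟩
  · obtain ⟨ζ, hζ, hζ_eq⟩ := exists_eq_add_second_deriv_of_pos hh hh₁ h0 hx
    exact ⟨ζ, by rwa [abs_of_pos hx], hζ_eq⟩

lemma eventually_power_le_one_near_zero {D : ℕ → ℕ → ℝ → ℝ} {δ r : ℕ → ℝ}
    (hD : ∀ᶠ m in atTop, IsKernel (D m))
    (hN : ∀ᶠ m in atTop, IsNondegenerate (D m) (δ m) (r m))
    (h2 : ∀ᶠ p : ℕ × ℝ in atTop ×ˢ 𝓝 0, power2 (D p.1) (δ p.1) (r p.1) p.2 ≤ 0) :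
    ∀ᶠ p : ℕ × ℝ in atTop ×ˢ 𝓝 0, power (D p.1) (δ p.1) (r p.1) p.2 ≤ 1 := by
  obtain ⟨pa, ha, pb, hb, hab⟩ := eventually_prod_iff.1 h2
  obtain ⟨η, hη, hball⟩ := Metric.eventually_nhds_iff.1 hb
  refine eventually_prod_iff.2 ⟨_, (ha.and hD).and hN, _,
    Metric.ball_mem_nhds (0 : ℝ) hη, fun {m} hm x hx => ?_⟩
  obtain ⟨⟨hma, hmD⟩, hmN⟩ := hm
  obtain ⟨ζ, hζ, hζ_eq⟩ := exists_eq_add_second_deriv (hmD.hasDerivAt_power (δ := δ m) (r := r m))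
    hmD.hasDerivAt_power1 (hmD.power1_zero hmN) x
  have hζη : dist ζ 0 < η := by
    rw [Real.dist_0_eq_abs] at hx ⊢
    exact hζ.trans_lt hx
  rw [hζ_eq, hmD.power_zero hmN.abs_lt]
  nlinarith [mul_nonpos_of_nonpos_of_nonneg (hab hma (hball hζη)) (sq_nonneg x)]

lemma eventually_forall_abs_le {P : ℕ → ℝ → Prop} {C : ℝ}
    (h : ∀ x₀, ∀ᶠ p : ℕ × ℝ in atTop ×ˢ 𝓝 x₀, P p.1 p.2) :
    ∀ᶠ m in atTop, ∀ x, |x| ≤ C → P m x := by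
  have hIcc : ∀ᶠ m in atTop, ∀ x ∈ Set.Icc (-C) C, P m x := by
    refine (isCompact_Icc (a := -C) (b := C)).induction_on
      (p := fun s => ∀ᶠ m in atTop, ∀ x ∈ s, P m x) (by simp)
      (fun s t hst ht => ht.mono fun m hm x hx => hm x (hst hx))
      (fun s t hs ht => (hs.and ht).mono fun m hm x hx => hx.elim (hm.1 x) (hm.2 x))
      fun x _ => ?_
    obtain ⟨pa, ha, pb, hb, hab⟩ := eventually_prod_iff.1 (h x)
    exact ⟨{y | pb y}, mem_nhdsWithin_of_mem_nhds hb, ha.mono fun m hm y hy => hab hm hy⟩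
  exact hIcc.mono fun m hm x hx => hm x (abs_le.1 hx)

/-! ### Gram matrices of the test -/

section GramRow

variable {n : ℕ}

open Matrix

/-- The shift `R⁻¹ Re [gᵢᴴ F⁻¹ ξᵢ]ᵢ`, `R = Re [(H - Gᴴ F⁻¹ G) ⊙ Ξᵀ]`, in terms of the Gram matrices
`F = AᴴA`, `G = AᴴB`, `H = BᴴB`. -/
def gramShift (F G H Ξ : Matrix (Fin n) (Fin n) ℂ) : Fin n → ℝ :=
  ((hadamard (H - Gᴴ * F⁻¹ * G) Ξᵀ).map Complex.re)⁻¹ *ᵥ fun i => ((Gᴴ * F⁻¹ * Ξ) i i).re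

/-- The row vector `(g - f F⁻¹ G) D - f F⁻¹` of the test, where `D` is the diagonal matrix of
`gramShift`. -/
def gramRow (F G H : Matrix (Fin n) (Fin n) ℂ) (f g : Fin n → ℂ)
    (Ξ : Matrix (Fin n) (Fin n) ℂ) : Fin n → ℂ :=
  (g - f ᵥ* (F⁻¹ * G)) ᵥ* diagonal (fun i => (gramShift F G H Ξ i : ℂ)) - f ᵥ* F⁻¹

variable {F G H Ξ : Matrix (Fin n) (Fin n) ℂ} {f g : Fin n → ℂ}

lemma inv_smul_of_ne_zero {K : Type*} [Field K] {c : K} (hc : c ≠ 0)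
    (A : Matrix (Fin n) (Fin n) K) : (c • A)⁻¹ = c⁻¹ • A⁻¹ := by
  by_cases hA : IsUnit A.det
  · exact Matrix.inv_smul' (k := Units.mk0 c hc) (A := A) hA
  · have hcA : ¬IsUnit (c • A).det := by
      rwa [det_smul, IsUnit.mul_iff, not_and, imp_iff_right ((isUnit_iff_ne_zero.2 hc).pow _)]
    rw [nonsing_inv_apply_not_isUnit _ hA, nonsing_inv_apply_not_isUnit _ hcA, smul_zero]

lemma gramShift_smul {c l : ℝ} (hc : c ≠ 0) (hl : l ≠ 0) :
    gramShift ((c : ℂ) • F) (((c * l : ℝ) : ℂ) • G) (((c * l ^ 2 : ℝ) : ℂ) • H) Ξ =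
      (c * l)⁻¹ • gramShift F G H Ξ := by
  have hcC : (c : ℂ) ≠ 0 := by exact_mod_cast hc
  have hGF : (((c * l : ℝ) : ℂ) • G)ᴴ * ((c : ℂ) • F)⁻¹ = (l : ℂ) • (Gᴴ * F⁻¹) := by
    rw [inv_smul_of_ne_zero hcC, conjTranspose_smul, smul_mul_smul_comm, Complex.star_def,
      conj_ofReal]
    congr 1
    push_cast
    field_simp
  have hR : (hadamard (((c * l ^ 2 : ℝ) : ℂ) • H - (l : ℂ) • (Gᴴ * F⁻¹) *
      (((c * l : ℝ) : ℂ) • G)) Ξᵀ).map Complex.re =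
        (c * l ^ 2) • (hadamard (H - Gᴴ * F⁻¹ * G) Ξᵀ).map Complex.re := by
    rw [smul_mul_smul_comm, show (l : ℂ) * ((c * l : ℝ) : ℂ) = ((c * l ^ 2 : ℝ) : ℂ) by
      push_cast; ring, ← smul_sub, smul_hadamard]
    ext i j
    simp only [map_apply, Matrix.smul_apply, smul_eq_mul, re_ofReal_mul]
  have hrhs : (fun i => (((l : ℂ) • (Gᴴ * F⁻¹) * Ξ) i i).re) =
      l • fun i => ((Gᴴ * F⁻¹ * Ξ) i i).re := by
    ext i
    simp only [Matrix.smul_mul, Matrix.smul_apply, smul_eq_mul, re_ofReal_mul, Pi.smul_apply]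
  rw [gramShift, hGF, hR, hrhs, inv_smul_of_ne_zero (mul_ne_zero hc (pow_ne_zero 2 hl)),
    smul_mulVec, mulVec_smul, smul_smul, gramShift]
  congr 1
  field_simp

lemma gramRow_smul {c l : ℝ} (hc : c ≠ 0) (hl : l ≠ 0) :
    gramRow ((c : ℂ) • F) (((c * l : ℝ) : ℂ) • G) (((c * l ^ 2 : ℝ) : ℂ) • H) ((c : ℂ) • f)
      (((c * l : ℝ) : ℂ) • g) Ξ = gramRow F G H f g Ξ := by
  have hcC : (c : ℂ) ≠ 0 := by exact_mod_cast hc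
  have hlC : (l : ℂ) ≠ 0 := by exact_mod_cast hl
  rw [gramRow, gramShift_smul hc hl, inv_smul_of_ne_zero hcC, gramRow, smul_mul_smul_comm]
  ext i
  simp only [Pi.sub_apply, vecMul_diagonal, vecMul_smul, smul_vecMul, Pi.smul_apply, smul_eq_mul]
  push_cast
  field_simp

lemma gramRow_shift (hF : F.IsHermitian) (hdet : IsUnit F.det) (hG : Gᴴ = -G)
    (hΞ : Ξ.IsHermitian) (κ : ℝ) :
    gramRow F (G + (I * κ) • F) (H - (2 * I * κ) • G + ((κ : ℂ) ^ 2) • F) f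
      (g + (I * κ) • f) Ξ = gramRow F G H f g Ξ := by
  have hGF : (G + (I * κ) • F)ᴴ * F⁻¹ = -(G * F⁻¹) - (I * κ) • 1 := by
    rw [conjTranspose_add, conjTranspose_smul, hF.eq, hG, add_mul, smul_mul_assoc,
      mul_nonsing_inv _ hdet]
    simp [sub_eq_add_neg]
  have hR : H - (2 * I * κ) • G + ((κ : ℂ) ^ 2) • F -
      (-(G * F⁻¹) - (I * κ) • 1) * (G + (I * κ) • F) = H - -(G * F⁻¹) * G := by
    have hFF : G * F⁻¹ * F = G := by rw [mul_assoc, nonsing_inv_mul _ hdet, mul_one]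
    simp only [sub_mul, mul_add, neg_mul, mul_smul_comm, smul_mul_assoc, one_mul, hFF, smul_sub,
      smul_neg, smul_smul]
    rw [show I * (κ : ℂ) * (I * κ) = -κ ^ 2 by linear_combination κ ^ 2 * I_sq]
    module
  have hrhs : ∀ i, (((-(G * F⁻¹) - (I * κ) • 1) * Ξ) i i).re = ((-(G * F⁻¹) * Ξ) i i).re := by
    intro i
    have him : (Ξ i i).im = 0 := Complex.conj_eq_iff_im.1 (hΞ.apply i i)
    simp [sub_mul, him]
  have hshift : gramShift F (G + (I * κ) • F) (H - (2 * I * κ) • G + ((κ : ℂ) ^ 2) • F) Ξ =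
      gramShift F G H Ξ := by
    simp only [gramShift, hGF, hR, hrhs, hG, neg_mul]
  rw [gramRow, gramRow, hshift, mul_add, mul_smul_comm, nonsing_inv_mul _ hdet, vecMul_add,
    vecMul_smul, vecMul_one, add_sub_add_right_eq_sub]

lemma gramRow_diagonal {d : Fin n → ℂ} (hd : ∀ i, d i * conj (d i) = 1) :
    gramRow ((diagonal d)ᴴ * F * diagonal d) ((diagonal d)ᴴ * G * diagonal d)
      ((diagonal d)ᴴ * H * diagonal d) (f ᵥ* diagonal d) (g ᵥ* diagonal d) Ξ =
        gramRow F G H f g (diagonal d * Ξ * (diagonal d)ᴴ) ᵥ* diagonal d := by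
  set P := diagonal d
  have hP : P * Pᴴ = 1 := by
    rw [diagonal_conjTranspose, diagonal_mul_diagonal, ← diagonal_one]
    exact congrArg diagonal (funext hd)
  have hinv : (Pᴴ * F * P)⁻¹ = Pᴴ * F⁻¹ * P := by
    rw [Matrix.mul_inv_rev, Matrix.mul_inv_rev, inv_eq_left_inv hP, inv_eq_right_inv hP, mul_assoc]
  have hcancel (X Y : Matrix (Fin n) (Fin n) ℂ) :
      Pᴴ * X * P * (Pᴴ * Y * P) = Pᴴ * (X * Y) * P := by
    simp only [mul_assoc]
    rw [← mul_assoc P, hP, one_mul]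
  have hGF : (Pᴴ * G * P)ᴴ * (Pᴴ * F * P)⁻¹ = Pᴴ * (Gᴴ * F⁻¹) * P := by
    rw [hinv, conjTranspose_mul, conjTranspose_mul, conjTranspose_conjTranspose,
      ← mul_assoc Pᴴ Gᴴ P, hcancel]
  have hR (X : Matrix (Fin n) (Fin n) ℂ) :
      hadamard (Pᴴ * X * P) Ξᵀ = hadamard X (P * Ξ * Pᴴ)ᵀ := by
    ext i j
    simp only [P, hadamard_apply, diagonal_conjTranspose, mul_diagonal, diagonal_mul,
      transpose_apply, Pi.star_apply]
    ring
  have hrhs (Y : Matrix (Fin n) (Fin n) ℂ) (i : Fin n) :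
      (Pᴴ * Y * P * Ξ) i i = (Y * (P * Ξ * Pᴴ)) i i := by
    rw [show Pᴴ * Y * P * Ξ = Pᴴ * (Y * P * Ξ) by simp only [mul_assoc],
      show Y * (P * Ξ * Pᴴ) = Y * P * Ξ * Pᴴ by simp only [mul_assoc]]
    simp only [P, diagonal_conjTranspose, diagonal_mul, mul_diagonal, mul_comm]
  have hshift : gramShift (Pᴴ * F * P) (Pᴴ * G * P) (Pᴴ * H * P) Ξ =
      gramShift F G H (P * Ξ * Pᴴ) := by
    simp only [gramShift, hGF, hcancel, ← sub_mul, ← mul_sub, hR, hrhs]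
  have hvec (v : Fin n → ℂ) (X : Matrix (Fin n) (Fin n) ℂ) :
      (v ᵥ* P) ᵥ* (Pᴴ * X * P) = (v ᵥ* X) ᵥ* P := by
    simp only [vecMul_vecMul, ← mul_assoc, hP, one_mul]
  rw [gramRow, gramRow, hshift, hinv, hcancel, hvec, hvec, ← sub_vecMul]
  ext i
  simp only [P, Pi.sub_apply, vecMul_diagonal]
  ring

end GramRow

section KernelNormSq

variable {n : ℕ}

open Matrix

/-- The squared norm of `gramRow * Ξ ^ (1 / 2)`. -/
def gramNormSq (F G H : Matrix (Fin n) (Fin n) ℂ) (f g : Fin n → ℂ)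
    (Ξ : Matrix (Fin n) (Fin n) ℂ) : ℝ :=
  (gramRow F G H f g Ξ ⬝ᵥ Ξ *ᵥ star (gramRow F G H f g Ξ)).re

/-- The Gram matrix at the indexes `θ` of a manifold with `a(x)ᴴ a(y) = K (y - x)`. -/
def kernelGram (K : ℝ → ℂ) (θ : Fin n → ℝ) : Matrix (Fin n) (Fin n) ℂ :=
  Matrix.of fun i j => K (θ j - θ i)

/-- The row vector `a(-x)ᴴ A(θ)` of a manifold with `a(x)ᴴ a(y) = K (y - x)`. -/
def kernelRow (K : ℝ → ℂ) (θ : Fin n → ℝ) (x : ℝ) : Fin n → ℂ :=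
  fun j => K (θ j + x)

/-- The squared norm in the consistency test at `-x`, for a manifold with
`a(x)ᴴ a(y) = K (y - x)`. -/
def kernelNormSq (K : ℝ → ℂ) (θ : Fin n → ℝ) (Ξ : Matrix (Fin n) (Fin n) ℂ) (x : ℝ) : ℝ :=
  gramNormSq (kernelGram K θ) (kernelGram (deriv K) θ) (-kernelGram (deriv (deriv K)) θ)
    (kernelRow K θ x) (kernelRow (deriv K) θ x) Ξ

variable {F G H Ξ : Matrix (Fin n) (Fin n) ℂ} {f g : Fin n → ℂ} {K : ℝ → ℂ} {θ : Fin n → ℝ}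

lemma gramRow_smul_smul (e : ℂ) : gramRow F G H (e • f) (e • g) Ξ = e • gramRow F G H f g Ξ := by
  rw [gramRow, gramRow, smul_vecMul, smul_vecMul, ← smul_sub, smul_vecMul, ← smul_sub]

lemma gramNormSq_diagonal {e : ℂ} (he : e * conj e = 1) {d : Fin n → ℂ}
    (hd : ∀ i, d i * conj (d i) = 1) :
    gramNormSq ((diagonal d)ᴴ * F * diagonal d) ((diagonal d)ᴴ * G * diagonal d)
      ((diagonal d)ᴴ * H * diagonal d) (e • f ᵥ* diagonal d) (e • g ᵥ* diagonal d) Ξ =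
        gramNormSq F G H f g (diagonal d * Ξ * (diagonal d)ᴴ) := by
  rw [gramNormSq, gramRow_smul_smul, gramRow_diagonal hd, star_smul, mulVec_smul,
    smul_dotProduct, dotProduct_smul, smul_smul, Complex.star_def, he, one_smul, star_vecMul,
    dotProduct_mulVec, dotProduct_mulVec, vecMul_vecMul, vecMul_vecMul, ← dotProduct_mulVec,
    mul_assoc, gramNormSq]

lemma kernelNormSq_const_mul_comp_mul {c l : ℝ} (hc : c ≠ 0) (hl : l ≠ 0) (x : ℝ) :
    kernelNormSq (fun y => c * K (l * y)) θ Ξ x = kernelNormSq K (l • θ) Ξ (l * x) := by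
  have hderiv : deriv (fun y => c * K (l * y)) = fun y => ((c * l : ℝ) : ℂ) * deriv K (l * y) := by
    ext y
    rw [deriv_const_mul_field, deriv_comp_mul_left, real_smul]
    push_cast
    ring
  have hderiv₂ : deriv (deriv fun y => c * K (l * y)) =
      fun y => ((c * l ^ 2 : ℝ) : ℂ) * deriv (deriv K) (l * y) := by
    ext y
    rw [hderiv, deriv_const_mul_field, deriv_comp_mul_left, real_smul]
    push_cast
    ring
  have hgram (K : ℝ → ℂ) (a : ℂ) :
      kernelGram (fun y => a * K (l * y)) θ = a • kernelGram K (l • θ) := by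
    ext i j
    simp [kernelGram, mul_sub]
  have hrow (K : ℝ → ℂ) (a : ℂ) :
      kernelRow (fun y => a * K (l * y)) θ x = a • kernelRow K (l • θ) (l * x) := by
    ext j
    simp [kernelRow, mul_add]
  rw [kernelNormSq, hderiv₂, hderiv, hgram, hgram, hgram, hrow, hrow, ← smul_neg, gramNormSq,
    gramRow_smul hc hl, kernelNormSq, gramNormSq]

lemma deriv_neg_of_hermitian (hK : ∀ y, K (-y) = conj (K y)) (y : ℝ) :
    deriv K (-y) = -conj (deriv K y) := by
  have h : deriv (fun y => K (-y)) y = deriv (fun y => star (K y)) y :=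
    congrArg (deriv · y) (funext hK)
  rw [deriv_comp_neg, deriv.star] at h
  rw [← neg_neg (deriv K (-y)), h, Complex.star_def]

lemma kernelGram_conjTranspose (hK : ∀ y, K (-y) = conj (K y)) :
    (kernelGram K θ)ᴴ = kernelGram K θ := by
  ext i j
  rw [conjTranspose_apply, kernelGram, of_apply, of_apply, Complex.star_def, ← hK, neg_sub]

lemma kernelGram_deriv_conjTranspose (hK : ∀ y, K (-y) = conj (K y)) :
    (kernelGram (deriv K) θ)ᴴ = -kernelGram (deriv K) θ := by
  ext i j
  rw [conjTranspose_apply, neg_apply, kernelGram, of_apply, of_apply, Complex.star_def,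
    ← neg_sub, deriv_neg_of_hermitian hK, map_neg, conj_conj]

/-- The diagonal unitary matrix of the phases `exp (I κ θᵢ)`. -/
def phaseMatrix (κ : ℝ) (θ : Fin n → ℝ) : Matrix (Fin n) (Fin n) ℂ :=
  diagonal fun i => cexp (I * κ * θ i)

lemma exp_mul_conj_exp (κ x : ℝ) : cexp (I * κ * x) * conj (cexp (I * κ * x)) = 1 := by
  rw [mul_conj, normSq_eq_norm_sq, mul_assoc, ← ofReal_mul, norm_exp_I_mul_ofReal, one_pow,
    ofReal_one]

lemma hasDerivAt_exp_mul {K₁ : ℝ → ℂ} (κ : ℝ) {y : ℝ} (hK : HasDerivAt K (K₁ y) y) :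
    HasDerivAt (fun y : ℝ => cexp (I * κ * y) * K y)
      (cexp (I * κ * y) * (K₁ y + I * κ * K y)) y := by
  have hexp : HasDerivAt (fun y : ℝ => cexp (I * κ * y)) (cexp (I * κ * y) * (I * κ * 1)) y :=
    (((hasDerivAt_id (y : ℂ)).const_mul (I * κ)).cexp).comp_ofReal
  exact (hexp.fun_mul hK).congr_deriv (by ring)

lemma kernelGram_exp_mul (κ : ℝ) : kernelGram (fun y => cexp (I * κ * y) * K y) θ =
    (phaseMatrix κ θ)ᴴ * kernelGram K θ * phaseMatrix κ θ := by
  ext i j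
  rw [phaseMatrix, diagonal_conjTranspose, mul_diagonal, diagonal_mul, Pi.star_apply,
    Complex.star_def, ← exp_conj]
  simp only [kernelGram, of_apply, map_mul, conj_I, conj_ofReal]
  rw [mul_right_comm (cexp _) (K _), ← Complex.exp_add]
  push_cast
  ring_nf

lemma kernelRow_exp_mul (κ x : ℝ) : kernelRow (fun y => cexp (I * κ * y) * K y) θ x =
    cexp (I * κ * x) • kernelRow K θ x ᵥ* phaseMatrix κ θ := by
  ext j
  rw [phaseMatrix, Pi.smul_apply, vecMul_diagonal, smul_eq_mul, kernelRow, kernelRow, mul_comm _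
    (cexp (I * κ * θ j)), ← mul_assoc, ← Complex.exp_add]
  push_cast
  ring_nf

lemma kernelNormSq_exp_mul (hK : ∀ y, K (-y) = conj (K y)) (hdiff : Differentiable ℝ K)
    (hdiff' : Differentiable ℝ (deriv K)) (hdet : IsUnit (kernelGram K θ).det)
    (hΞ : Ξ.IsHermitian) (κ x : ℝ) :
    kernelNormSq (fun y => cexp (I * κ * y) * K y) θ Ξ x =
      kernelNormSq K θ (phaseMatrix κ θ * Ξ * (phaseMatrix κ θ)ᴴ) x := by
  set K' : ℝ → ℂ := fun y => deriv K y + I * κ * K y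
  set K'' : ℝ → ℂ := fun y => deriv (deriv K) y + 2 * I * κ * deriv K y + (I * κ) ^ 2 * K y
  have hderiv : deriv (fun y : ℝ => cexp (I * κ * y) * K y) =
      fun y : ℝ => cexp (I * κ * y) * K' y :=
    funext fun y => (hasDerivAt_exp_mul κ (hdiff y).hasDerivAt).deriv
  have hderiv₂ : deriv (fun y : ℝ => cexp (I * κ * y) * K' y) =
      fun y : ℝ => cexp (I * κ * y) * K'' y := by
    ext y
    have hK' := (hdiff' y).hasDerivAt.fun_add ((hdiff y).hasDerivAt.const_mul (I * κ))
    rw [(hasDerivAt_exp_mul (K₁ := fun y => deriv (deriv K) y + I * κ * deriv K y) κ hK').deriv]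
    simp only [K'']
    ring
  have hG : kernelGram K' θ = kernelGram (deriv K) θ + (I * κ) • kernelGram K θ := rfl
  have hH : -kernelGram K'' θ = -kernelGram (deriv (deriv K)) θ -
      (2 * I * κ) • kernelGram (deriv K) θ + ((κ : ℂ) ^ 2) • kernelGram K θ := by
    ext i j
    simp only [kernelGram, K'', Matrix.neg_apply, of_apply, Matrix.add_apply, Matrix.sub_apply,
      Matrix.smul_apply, smul_eq_mul]
    linear_combination -(κ ^ 2) * K (θ j - θ i) * I_sq
  have hg : kernelRow K' θ x = kernelRow (deriv K) θ x + (I * κ) • kernelRow K θ x := rfl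
  have hΞ' : (phaseMatrix κ θ * Ξ * (phaseMatrix κ θ)ᴴ).IsHermitian :=
    isHermitian_mul_mul_conjTranspose _ hΞ
  rw [kernelNormSq, hderiv, hderiv₂, kernelGram_exp_mul, kernelGram_exp_mul, kernelGram_exp_mul,
    kernelRow_exp_mul, kernelRow_exp_mul, ← neg_mul, ← mul_neg, hH, hG, hg, phaseMatrix,
    gramNormSq_diagonal (exp_mul_conj_exp κ x) fun i => exp_mul_conj_exp κ (θ i), ← phaseMatrix,
    gramNormSq, gramRow_shift (kernelGram_conjTranspose hK) hdet
      (kernelGram_deriv_conjTranspose hK) hΞ', kernelNormSq, gramNormSq]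

end KernelNormSq

section TwoSources

open Matrix

-- The eigenvectors are `(1, 1)` and `(1, -1)`.
lemma inv_symm_circulant {K : Type*} [Field K] [CharZero K] {a b : K} (h₁ : a + b ≠ 0)
    (h₂ : a - b ≠ 0) :
    (!![a, b; b, a])⁻¹ =
      !![((a + b)⁻¹ + (a - b)⁻¹) / 2, ((a + b)⁻¹ - (a - b)⁻¹) / 2;
        ((a + b)⁻¹ - (a - b)⁻¹) / 2, ((a + b)⁻¹ + (a - b)⁻¹) / 2] := by
  refine inv_eq_right_inv ?_
  ext i j
  fin_cases i <;> fin_cases j <;>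
    simp only [Fin.zero_eta, Fin.mk_one, mul_apply, Fin.sum_univ_two, of_apply, cons_val',
      cons_val_zero, cons_val_one, cons_val_fin_one, one_apply, Fin.isValue, zero_ne_one,
      one_ne_zero, if_true, if_false] <;>
    field_simp <;> ring

lemma corr_isHermitian (ρ : ℂ) : (corr ρ).IsHermitian := by
  ext i j
  fin_cases i <;> fin_cases j <;> simp [corr]

variable {D : ℕ → ℝ → ℝ} {δ x : ℝ} {ρ : ℂ}

lemma kernelGram_pair (K : ℝ → ℂ) :
    kernelGram K ![0, δ] = !![K 0, K δ; K (-δ), K 0] := by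
  ext i j
  fin_cases i <;> fin_cases j <;> simp [kernelGram]

lemma kernelRow_pair (K : ℝ → ℂ) : kernelRow K ![0, δ] x = ![K x, K (x + δ)] := by
  ext j
  fin_cases j <;> simp [kernelRow, add_comm]

namespace IsKernel

lemma deriv_ofReal (hD : IsKernel D) (j : ℕ) :
    deriv (fun y => (D j y : ℂ)) = fun y => (D (j + 1) y : ℂ) :=
  funext fun y => (hD.hasDerivAt j y).ofReal_comp.deriv

lemma kernelGram_zero_pair (hD : IsKernel D) :
    kernelGram (fun y => (D 0 y : ℂ)) ![0, δ] = !![(1 : ℂ), D 0 δ; D 0 δ, 1] := by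
  rw [kernelGram_pair, hD.neg_zero, hD.one, ofReal_one]

lemma kernelGram_one_pair (hD : IsKernel D) :
    kernelGram (fun y => (D 1 y : ℂ)) ![0, δ] = !![(0 : ℂ), D 1 δ; -D 1 δ, 0] := by
  rw [kernelGram_pair, hD.neg_one, hD.apply_zero_of_odd odd_one, ofReal_neg, ofReal_zero]

lemma kernelGram_two_pair (hD : IsKernel D) :
    kernelGram (fun y => (D 2 y : ℂ)) ![0, δ] = !![(D 2 0 : ℂ), D 2 δ; D 2 δ, D 2 0] := by
  rw [kernelGram_pair, hD.neg 2, neg_one_sq, one_mul]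

lemma kernelGram_zero_pair_inv (hD : IsKernel D) (hs : |D 0 δ| < 1) :
    (kernelGram (fun y => (D 0 y : ℂ)) ![0, δ])⁻¹ =
      !![((((1 + D 0 δ)⁻¹ + (1 - D 0 δ)⁻¹) / 2 : ℝ) : ℂ),
          (((1 + D 0 δ)⁻¹ - (1 - D 0 δ)⁻¹) / 2 : ℝ);
        (((1 + D 0 δ)⁻¹ - (1 - D 0 δ)⁻¹) / 2 : ℝ),
          (((1 + D 0 δ)⁻¹ + (1 - D 0 δ)⁻¹) / 2 : ℝ)] := by
  obtain ⟨hs₁, hs₂⟩ := abs_lt.1 hs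
  have hs₁C : (1 : ℂ) + D 0 δ ≠ 0 := by exact_mod_cast (neg_lt_iff_pos_add'.1 hs₁).ne'
  have hs₂C : (1 : ℂ) - D 0 δ ≠ 0 := by exact_mod_cast (sub_pos.2 hs₂).ne'
  rw [hD.kernelGram_zero_pair, inv_symm_circulant hs₁C hs₂C]
  push_cast
  rfl

lemma schur_pair (hD : IsKernel D) (hs : |D 0 δ| < 1) :
    -kernelGram (fun y => (D 2 y : ℂ)) ![0, δ] - (kernelGram (fun y => (D 1 y : ℂ)) ![0, δ])ᴴ *
      (kernelGram (fun y => (D 0 y : ℂ)) ![0, δ])⁻¹ * kernelGram (fun y => (D 1 y : ℂ)) ![0, δ] =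
      !![(((schurEigen D δ 1 + schurEigen D δ (-1)) / 2 : ℝ) : ℂ),
          ((schurEigen D δ 1 - schurEigen D δ (-1)) / 2 : ℝ);
        ((schurEigen D δ 1 - schurEigen D δ (-1)) / 2 : ℝ),
          ((schurEigen D δ 1 + schurEigen D δ (-1)) / 2 : ℝ)] := by
  rw [hD.kernelGram_zero_pair_inv hs, hD.kernelGram_one_pair, hD.kernelGram_two_pair]
  ext i j
  fin_cases i <;> fin_cases j <;> simp [schurEigen, mul_apply, Fin.sum_univ_two] <;> ring

lemma gramShift_pair (hD : IsKernel D) (h : IsNondegenerate D δ ρ.re) :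
    gramShift (kernelGram (fun y => (D 0 y : ℂ)) ![0, δ])
      (kernelGram (fun y => (D 1 y : ℂ)) ![0, δ]) (-kernelGram (fun y => (D 2 y : ℂ)) ![0, δ])
      (corr ρ) = ![relShift D δ ρ.re, -relShift D δ ρ.re] := by
  obtain ⟨hs₁, hs₂⟩ := abs_lt.1 h.abs_lt
  set k := (schurEigen D δ 1 + schurEigen D δ (-1)) / 2
  set l := (schurEigen D δ 1 - schurEigen D δ (-1)) / 2
  have hplus : k + l * ρ.re = shiftDenom D δ (-ρ.re) := by rw [shiftDenom]; ring
  have hminus : k - l * ρ.re = shiftDenom D δ ρ.re := by rw [shiftDenom]; ring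
  have hR : (hadamard !![(k : ℂ), l; l, k] (corr ρ)ᵀ).map Complex.re =
      !![k, l * ρ.re; l * ρ.re, k] := by
    ext i j
    fin_cases i <;> fin_cases j <;> simp [corr]
  have hrhs : (fun i => (((kernelGram (fun y => (D 1 y : ℂ)) ![0, δ])ᴴ *
      (kernelGram (fun y => (D 0 y : ℂ)) ![0, δ])⁻¹ * corr ρ) i i).re) =
        (D 1 δ / (1 - D 0 δ ^ 2) * (D 0 δ - ρ.re)) • ![1, -1] := by
    rw [hD.kernelGram_zero_pair_inv h.abs_lt, hD.kernelGram_one_pair]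
    ext i
    have h₁ : 1 + D 0 δ ≠ 0 := (neg_lt_iff_pos_add'.1 hs₁).ne'
    have h₂ : 1 - D 0 δ ≠ 0 := (sub_pos.2 hs₂).ne'
    rw [show 1 - D 0 δ ^ 2 = (1 + D 0 δ) * (1 - D 0 δ) by ring]
    fin_cases i <;>
      simp [corr, mul_apply, Fin.sum_univ_two, -ofReal_mul, -ofReal_div, -ofReal_sub,
        -ofReal_add, -ofReal_inv] <;> field_simp <;> ring
  rw [gramShift, hD.schur_pair h.abs_lt, hR, hrhs, inv_symm_circulant
    (hplus ▸ h.shiftDenom_neg_pos.ne') (hminus ▸ h.shiftDenom_pos.ne'), mulVec_smul, hplus, hminus]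
  ext i
  fin_cases i <;> simp [relShift] <;> ring

lemma kernelNormSq_pair (hD : IsKernel D) (h : IsNondegenerate D δ ρ.re) :
    kernelNormSq (fun y => (D 0 y : ℂ)) ![0, δ] (corr ρ) x = power D δ ρ.re x := by
  set t := relShift D δ ρ.re
  have hrow : gramRow (kernelGram (fun y => (D 0 y : ℂ)) ![0, δ])
      (kernelGram (fun y => (D 1 y : ℂ)) ![0, δ]) (-kernelGram (fun y => (D 2 y : ℂ)) ![0, δ])
      (kernelRow (fun y => (D 0 y : ℂ)) ![0, δ] x) (kernelRow (fun y => (D 1 y : ℂ)) ![0, δ] x)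
      (corr ρ) = ![((-(ampl D δ 1 t 0 x + ampl D δ (-1) t 0 x) / 2 : ℝ) : ℂ),
        ((-(ampl D δ 1 t 0 x - ampl D δ (-1) t 0 x) / 2 : ℝ) : ℂ)] := by
    rw [gramRow, hD.gramShift_pair h, hD.kernelGram_zero_pair_inv h.abs_lt,
      hD.kernelGram_one_pair, kernelRow_pair, kernelRow_pair]
    ext j
    fin_cases j <;> simp [ampl, residual, interp, vecMul_diagonal, t] <;> ring
  rw [kernelNormSq, hD.deriv_ofReal, hD.deriv_ofReal, gramNormSq, hrow, power]
  simp only [dotProduct, neg_add_rev, neg_sub, mulVec, corr, RCLike.star_def, of_apply, cons_val',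
    cons_val_fin_one, Pi.star_apply, Fin.sum_univ_two, Fin.isValue, cons_val_zero, conj_ofReal,
    cons_val_one, one_mul, add_re, mul_re, ofReal_re, ofReal_im, mul_zero, sub_zero, add_im, mul_im,
    zero_add, zero_mul, conj_re, conj_im, neg_mul, add_zero, mul_neg, _root_.neg_zero]
  ring

end IsKernel

end TwoSources

section Modulation

open Matrix

/-- The effective correlation of two sources with correlation `ρ` after centring the array, which
multiplies the second source by `exp (I a)`. -/
def effCorr (ρ : ℂ) (a : ℝ) : ℝ := (ρ * conj (cexp (I * a))).re

lemma abs_effCorr_le (ρ : ℂ) (a : ℝ) : |effCorr ρ a| ≤ ‖ρ‖ := by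
  refine (abs_re_le_norm _).trans_eq ?_
  rw [norm_mul, norm_conj, mul_comm I, norm_exp_ofReal_mul_I, mul_one]

variable {D : ℕ → ℝ → ℝ} {δ x : ℝ} {ρ : ℂ}

lemma phaseMatrix_mul_corr (κ δ : ℝ) (ρ : ℂ) :
    phaseMatrix κ ![0, δ] * corr ρ * (phaseMatrix κ ![0, δ])ᴴ =
      corr (ρ * conj (cexp (I * ((κ * δ : ℝ) : ℂ)))) := by
  have hunit := exp_mul_conj_exp κ δ
  rw [ofReal_mul, ← mul_assoc]
  generalize hz : cexp (I * κ * δ) = z at hunit ⊢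
  ext i j
  rw [phaseMatrix, diagonal_conjTranspose, mul_diagonal, diagonal_mul]
  fin_cases i <;> fin_cases j <;> simp [corr, hz, hunit, mul_comm z]

lemma IsKernel.kernelNormSq_exp_mul_pair (hD : IsKernel D) {κ : ℝ}
    (h : IsNondegenerate D δ (effCorr ρ (κ * δ))) :
    kernelNormSq (fun y => cexp (I * κ * y) * D 0 y) ![0, δ] (corr ρ) x =
      power D δ (effCorr ρ (κ * δ)) x := by
  have hdet : IsUnit (kernelGram (fun y => (D 0 y : ℂ)) ![0, δ]).det := by
    have hsq : D 0 δ ^ 2 < 1 := (sq_lt_one_iff_abs_lt_one _).2 h.abs_lt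
    rw [hD.kernelGram_zero_pair, det_fin_two_of, isUnit_iff_ne_zero]
    exact_mod_cast (by nlinarith : 1 * 1 - D 0 δ * D 0 δ ≠ 0)
  rw [_root_.CLASS.kernelNormSq_exp_mul (K := fun y => (D 0 y : ℂ)) (by simp [hD.neg_zero])
    (fun y => (hD.hasDerivAt 0 y).ofReal_comp.differentiableAt)
    (by rw [hD.deriv_ofReal]; exact fun y => (hD.hasDerivAt 1 y).ofReal_comp.differentiableAt)
    hdet (corr_isHermitian ρ), phaseMatrix_mul_corr, hD.kernelNormSq_pair h]
  rfl

end Modulation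

section ManifoldTest

open Matrix
open scoped ComplexOrder

variable {m n : ℕ}

lemma norm_sq_vecMul_sqrt {Ξ : Matrix (Fin n) (Fin n) ℂ} (hΞ : 0 ≤ Ξ) (v : Fin n → ℂ) :
    ‖WithLp.toLp 2 (v ᵥ* CFC.sqrt Ξ)‖ ^ 2 = (v ⬝ᵥ Ξ *ᵥ star v).re := by
  have hherm : (CFC.sqrt Ξ)ᴴ = CFC.sqrt Ξ :=
    (nonneg_iff_posSemidef.1 (CFC.sqrt_nonneg Ξ)).isHermitian
  have hsq : v ⬝ᵥ Ξ *ᵥ star v = (v ᵥ* CFC.sqrt Ξ) ⬝ᵥ star (v ᵥ* CFC.sqrt Ξ) := by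
    rw [star_vecMul, hherm, ← dotProduct_mulVec, mulVec_mulVec, CFC.sqrt_mul_sqrt_self Ξ hΞ]
  rw [hsq, EuclideanSpace.norm_sq_eq, dotProduct, re_sum]
  refine Finset.sum_congr rfl fun i _ => ?_
  rw [Pi.star_apply, Complex.star_def, mul_conj, ofReal_re, normSq_eq_norm_sq]

lemma corr_nonneg {ρ : ℂ} (hρ : ‖ρ‖ ≤ 1) : 0 ≤ corr ρ := by
  set L : Matrix (Fin 2) (Fin 2) ℂ := !![1, 0; conj ρ, √(1 - ‖ρ‖ ^ 2)]
  have hsqrt : (√(1 - ‖ρ‖ ^ 2) : ℂ) * √(1 - ‖ρ‖ ^ 2) = 1 - ρ * conj ρ := by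
    rw [← ofReal_mul, Real.mul_self_sqrt (sub_nonneg.2 (pow_le_one₀ (norm_nonneg ρ) hρ)),
      mul_conj']
    push_cast
    ring
  have hL : corr ρ = L * Lᴴ := by
    ext i j
    fin_cases i <;> fin_cases j <;> simp [corr, L, mul_apply, Fin.sum_univ_two, hsqrt]
    ring
  rw [hL, nonneg_iff_posSemidef]
  exact posSemidef_self_mul_conjTranspose L

variable {a : ℝ → Fin m → ℂ} {θ : Fin n → ℝ} {K : ℝ → ℂ}

lemma vecMul_test_eq_gramRow (Ξ : Matrix (Fin n) (Fin n) ℂ) (v : Fin m → ℂ) :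
    v ᵥ* (projPerp a θ * dsteer a θ * D0 a θ Ξ - steerDual a θ) =
      gramRow ((steer a θ)ᴴ * steer a θ) ((steer a θ)ᴴ * dsteer a θ)
        ((dsteer a θ)ᴴ * dsteer a θ) (v ᵥ* steer a θ) (v ᵥ* dsteer a θ) Ξ := by
  have hschur : (dsteer a θ)ᴴ * projPerp a θ * dsteer a θ = (dsteer a θ)ᴴ * dsteer a θ -
      ((steer a θ)ᴴ * dsteer a θ)ᴴ * ((steer a θ)ᴴ * steer a θ)⁻¹ *
        ((steer a θ)ᴴ * dsteer a θ) := by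
    simp only [projPerp, steerDual, conjTranspose_mul, conjTranspose_conjTranspose, Matrix.mul_sub,
      Matrix.sub_mul, Matrix.mul_one, Matrix.mul_assoc]
  have hdual : (dsteer a θ)ᴴ * steerDual a θ =
      ((steer a θ)ᴴ * dsteer a θ)ᴴ * ((steer a θ)ᴴ * steer a θ)⁻¹ := by
    simp only [steerDual, conjTranspose_mul, conjTranspose_conjTranspose, Matrix.mul_assoc]
  have hproj : projPerp a θ * dsteer a θ = dsteer a θ - steer a θ *
      (((steer a θ)ᴴ * steer a θ)⁻¹ * ((steer a θ)ᴴ * dsteer a θ)) := by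
    simp only [projPerp, steerDual, Matrix.sub_mul, Matrix.one_mul, Matrix.mul_assoc]
  have hrow : v ᵥ* steerDual a θ = v ᵥ* steer a θ ᵥ* ((steer a θ)ᴴ * steer a θ)⁻¹ :=
    (vecMul_vecMul _ _ _).symm
  rw [gramRow, gramShift, ← hschur, ← hdual, hproj, vecMul_sub, hrow, ← vecMul_vecMul,
    vecMul_sub, ← vecMul_vecMul]
  rfl

lemma hasDerivAt_dotProduct (ha : Differentiable ℝ a) (v : Fin m → ℂ) (x : ℝ) :
    HasDerivAt (fun x => v ⬝ᵥ a x) (v ⬝ᵥ deriv a x) x :=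
  HasDerivAt.fun_sum fun k _ => ((hasDerivAt_pi.1 (ha x).hasDerivAt k).const_mul (v k))

lemma hasDerivAt_star_dotProduct (ha : Differentiable ℝ a) (v : Fin m → ℂ) (x : ℝ) :
    HasDerivAt (fun x => star (a x) ⬝ᵥ v) (star (deriv a x) ⬝ᵥ v) x :=
  HasDerivAt.fun_sum fun k _ => ((hasDerivAt_pi.1 (ha x).hasDerivAt k).star.mul_const (v k))

lemma star_dotProduct_deriv (ha : Differentiable ℝ a)
    (hK : ∀ x y, star (a x) ⬝ᵥ a y = K (y - x)) (x y : ℝ) :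
    star (a x) ⬝ᵥ deriv a y = deriv K (y - x) := by
  rw [← (hasDerivAt_dotProduct ha (star (a x)) y).deriv, funext (hK x), deriv_comp_sub_const]

lemma star_deriv_dotProduct_deriv (ha : Differentiable ℝ a)
    (hK : ∀ x y, star (a x) ⬝ᵥ a y = K (y - x)) (x y : ℝ) :
    star (deriv a x) ⬝ᵥ deriv a y = -deriv (deriv K) (y - x) := by
  rw [← (hasDerivAt_star_dotProduct ha (deriv a y) x).deriv,
    funext fun x => star_dotProduct_deriv ha hK x y, deriv_comp_const_sub]

lemma norm_sq_test_eq_kernelNormSq (ha : Differentiable ℝ a)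
    (hK : ∀ x y, star (a x) ⬝ᵥ a y = K (y - x)) {Ξ : Matrix (Fin n) (Fin n) ℂ} (hΞ : 0 ≤ Ξ)
    (t : ℝ) :
    ‖WithLp.toLp 2 (star (a t) ᵥ*
      ((projPerp a θ * dsteer a θ * D0 a θ Ξ - steerDual a θ) * CFC.sqrt Ξ))‖ ^ 2 =
        kernelNormSq K θ Ξ (-t) := by
  have hF : (steer a θ)ᴴ * steer a θ = kernelGram K θ := by
    ext i j
    exact hK (θ i) (θ j)
  have hG : (steer a θ)ᴴ * dsteer a θ = kernelGram (deriv K) θ := by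
    ext i j
    exact star_dotProduct_deriv ha hK (θ i) (θ j)
  have hH : (dsteer a θ)ᴴ * dsteer a θ = -kernelGram (deriv (deriv K)) θ := by
    ext i j
    exact star_deriv_dotProduct_deriv ha hK (θ i) (θ j)
  have hf : star (a t) ᵥ* steer a θ = kernelRow K θ (-t) := by
    ext j
    exact hK t (θ j)
  have hg : star (a t) ᵥ* dsteer a θ = kernelRow (deriv K) θ (-t) := by
    ext j
    exact star_dotProduct_deriv ha hK t (θ j)
  rw [← vecMul_vecMul, norm_sq_vecMul_sqrt hΞ, vecMul_test_eq_gramRow, hF, hG, hH, hf, hg]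
  rfl

end ManifoldTest

section Array

open Matrix

lemma star_ula_dotProduct_ula (m : ℕ) (x y : ℝ) :
    star (ula m x) ⬝ᵥ ula m y = ∑ k ∈ Finset.range m, cexp (I * k * ((y - x : ℝ) : ℂ)) := by
  rw [dotProduct, ← Fin.sum_univ_eq_sum_range (fun k => cexp (I * k * ((y - x : ℝ) : ℂ)))]
  refine Finset.sum_congr rfl fun k _ => ?_
  rw [Pi.star_apply, ula, ula, Complex.star_def, ← exp_conj, ← Complex.exp_add]
  simp only [map_mul, conj_I, conj_ofReal, map_natCast]
  push_cast
  ring_nf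

-- The phase factor moves the reference point from the first sensor to the centre of the array.
lemma sum_exp_eq_arrayKernel {m : ℕ} (hm : m ≠ 0) (y : ℝ) :
    ∑ k ∈ Finset.range m, cexp (I * k * y) =
      m * (cexp (I * (((m - 1) / (2 * m) : ℝ) : ℂ) * ((m * y : ℝ) : ℂ)) *
        arrayKernel m 0 (m * y)) := by
  have hmC : (m : ℂ) ≠ 0 := by exact_mod_cast hm
  rw [← (isAperture_arrayAperture hm).integral_exp_eq_kernel, integral_arrayAperture, real_smul,
    ofReal_inv, ofReal_natCast, mul_left_comm, mul_inv_cancel_left₀ hmC, Finset.mul_sum]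
  refine Finset.sum_congr rfl fun k _ => ?_
  rw [← Complex.exp_add, pos]
  push_cast
  field_simp
  ring_nf

lemma differentiable_ula (m : ℕ) : Differentiable ℝ (ula m) :=
  differentiable_pi.2 fun _ => (ofRealCLM.differentiable.const_mul _).cexp

lemma ula_test_le_one_iff {m : ℕ} (hm : m ≠ 0) {ρ : ℂ} (hρ : ‖ρ‖ ≤ 1) {Δ : ℝ}
    (h : IsNondegenerate (arrayKernel m) (m * Δ) (effCorr ρ ((m - 1) / (2 * m) * (m * Δ))))
    (y : ℝ) :
    ‖WithLp.toLp 2 (star (ula m y) ᵥ* ((projPerp (ula m) ![0, Δ] * dsteer (ula m) ![0, Δ] *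
      D0 (ula m) ![0, Δ] (corr ρ) - steerDual (ula m) ![0, Δ]) * CFC.sqrt (corr ρ)))‖ ≤ 1 ↔
      power (arrayKernel m) (m * Δ) (effCorr ρ ((m - 1) / (2 * m) * (m * Δ))) (-(m * y)) ≤ 1 := by
  have hmR : (m : ℝ) ≠ 0 := by exact_mod_cast hm
  have hpair : (m : ℝ) • ![0, Δ] = ![0, m * Δ] := by simp
  have hK : ∀ x y : ℝ, star (ula m x) ⬝ᵥ ula m y = ((m : ℝ) : ℂ) *
      (cexp (I * (((m - 1) / (2 * m) : ℝ) : ℂ) * ((m * (y - x) : ℝ) : ℂ)) *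
        arrayKernel m 0 (m * (y - x))) := fun x y => by
    rw [star_ula_dotProduct_ula, sum_exp_eq_arrayKernel hm, ofReal_natCast]
  rw [← sq_le_one_iff₀ (norm_nonneg _), norm_sq_test_eq_kernelNormSq (differentiable_ula m)
    (K := fun z => ((m : ℝ) : ℂ) * (cexp (I * (((m - 1) / (2 * m) : ℝ) : ℂ) * ((m * z : ℝ) : ℂ)) *
        arrayKernel m 0 (m * z))) hK (corr_nonneg hρ),
    kernelNormSq_const_mul_comp_mul
      (K := fun z => cexp (I * (((m - 1) / (2 * m) : ℝ) : ℂ) * z) * arrayKernel m 0 z) hmR hmR,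
    hpair, (isKernel_arrayKernel hm).kernelNormSq_exp_mul_pair h, mul_neg]

end Array

section LimitTest

open Matrix

lemma integral_cos_mul {x : ℝ} (hx : x ≠ 0) :
    ∫ u in (-1 / 2 : ℝ)..1 / 2, Real.cos (u * x) = 2 * Real.sin (x / 2) / x := by
  rw [intervalIntegral.integral_comp_mul_right _ hx, integral_cos, smul_eq_mul,
    show -1 / 2 * x = -(x / 2) by ring, show 1 / 2 * x = x / 2 by ring, Real.sin_neg]
  ring

lemma limitKernel_zero_eq {x : ℝ} (hx : x ≠ 0) : limitKernel 0 x = 2 * Real.sin (x / 2) / x := by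
  rw [limitKernel, kernel_zero_eq, integral_uniformAperture, integral_cos_mul hx]

lemma Fa_eq (x : ℝ) : Fa x = cexp (I * ((1 / 2 : ℝ) : ℂ) * x) * limitKernel 0 x := by
  rw [Fa]
  split_ifs with h
  · simp [h, isKernel_limitKernel.one]
  · have hx : (x : ℂ) ≠ 0 := by exact_mod_cast h
    rw [limitKernel_zero_eq h]
    push_cast
    rw [Complex.sin, show I * (x : ℂ) = x / 2 * I + x / 2 * I by ring, Complex.exp_add,
      show I * (1 / 2) * (x : ℂ) = x / 2 * I by ring, neg_mul, Complex.exp_neg]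
    field_simp
    rw [I_sq]
    ring

lemma limitKernel_two_zero : limitKernel 2 0 = -(1 / 12) := by
  rw [limitKernel, kernel_two_eq, integral_uniformAperture]
  simp only [mul_zero, Real.cos_zero, mul_one]
  rw [integral_pow]
  norm_num

lemma abs_limitKernel_zero_lt_one {x : ℝ} (hx : x ≠ 0) : |limitKernel 0 x| < 1 := by
  have hsin := Real.abs_sin_lt_abs (x := x / 2) (by simpa using hx)
  rw [abs_div, abs_two] at hsin
  rw [limitKernel_zero_eq hx, abs_div, div_lt_one (abs_pos.2 hx), abs_mul, abs_two]
  linarith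

lemma hasDerivAt_Fa (x : ℝ) :
    HasDerivAt Fa (cexp (I * ((1 / 2 : ℝ) : ℂ) * x) *
      (limitKernel 1 x + I * ((1 / 2 : ℝ) : ℂ) * limitKernel 0 x)) x := by
  rw [funext Fa_eq]
  exact hasDerivAt_exp_mul (K₁ := fun x => limitKernel 1 x) _
    (isKernel_limitKernel.hasDerivAt 0 x).ofReal_comp

lemma Ga_zero : Ga 0 = I / 2 := by
  have hD := isKernel_limitKernel
  rw [Ga, (hasDerivAt_Fa 0).deriv, hD.one, hD.apply_zero_of_odd odd_one]
  simp [div_eq_mul_inv]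

lemma Ha_zero : Ha 0 = 1 / 3 := by
  have hD := isKernel_limitKernel
  have hGa : Ga = fun x : ℝ => cexp (I * ((1 / 2 : ℝ) : ℂ) * x) *
      (limitKernel 1 x + I * ((1 / 2 : ℝ) : ℂ) * limitKernel 0 x) :=
    funext fun x => (hasDerivAt_Fa x).deriv
  have h := hasDerivAt_exp_mul
    (K := fun x => limitKernel 1 x + I * ((1 / 2 : ℝ) : ℂ) * limitKernel 0 x)
    (K₁ := fun x => limitKernel 2 x + I * ((1 / 2 : ℝ) : ℂ) * limitKernel 1 x) (1 / 2)
    ((hD.hasDerivAt 1 0).ofReal_comp.fun_add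
      ((hD.hasDerivAt 0 0).ofReal_comp.const_mul (I * ((1 / 2 : ℝ) : ℂ))))
  rw [Ha, hGa, h.deriv, hD.one, hD.apply_zero_of_odd odd_one, limitKernel_two_zero]
  push_cast
  rw [mul_zero, Complex.exp_zero]
  linear_combination (-1 / 4) * I_sq

variable {δ : ℝ} {ρ : ℂ}

lemma limitTest_vec_eq_gramRow (δ' δ : ℝ) (Ξ : Matrix (Fin 2) (Fin 2) ℂ) :
    (gaVec δ' δ - faVec δ' δ ᵥ* ((FaMat δ)⁻¹ * GaMat δ)) ᵥ* Da δ Ξ - faVec δ' δ ᵥ* (FaMat δ)⁻¹ =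
      gramRow (kernelGram Fa ![0, δ]) (kernelGram (deriv Fa) ![0, δ])
        (-kernelGram (deriv (deriv Fa)) ![0, δ]) (kernelRow Fa ![0, δ] δ')
        (kernelRow (deriv Fa) ![0, δ] δ') Ξ := by
  have hF : kernelGram Fa ![0, δ] = FaMat δ := by
    rw [kernelGram_pair, FaMat, Fa, if_pos rfl]
  have hG : kernelGram (deriv Fa) ![0, δ] = GaMat δ := by
    rw [kernelGram_pair, GaMat, ← Ga_zero]
    rfl
  have hH : -kernelGram (deriv (deriv Fa)) ![0, δ] = HaMat δ := by
    rw [kernelGram_pair, HaMat, ← Ha_zero]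
    ext i j
    fin_cases i <;> fin_cases j <;> rfl
  have hf : kernelRow Fa ![0, δ] δ' = faVec δ' δ := by
    rw [kernelRow_pair, faVec, add_comm]
  have hg : kernelRow (deriv Fa) ![0, δ] δ' = gaVec δ' δ := by
    rw [kernelRow_pair, gaVec, add_comm]
    rfl
  rw [hF, hG, hH, hf, hg]
  rfl

lemma limitTest_iff (hρ : ‖ρ‖ ≤ 1)
    (h : IsNondegenerate limitKernel δ (effCorr ρ (1 / 2 * δ))) :
    LimitTest δ (corr ρ) ↔ ∀ x, power limitKernel δ (effCorr ρ (1 / 2 * δ)) x ≤ 1 := by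
  refine forall_congr' fun x => ?_
  rw [← sq_le_one_iff₀ (norm_nonneg _), norm_sq_vecMul_sqrt (corr_nonneg hρ),
    limitTest_vec_eq_gramRow, ← isKernel_limitKernel.kernelNormSq_exp_mul_pair h,
    ← funext Fa_eq]
  rfl

end LimitTest

/-! ### Uniform bounds for the array -/

section Chord

variable {m : ℕ} {x : ℝ}

/-- The distance from `x` to the multiples of the period `2πm`, up to a bounded factor: half the
chord of the angle `x / m`, scaled by `m`. -/
def chord (m : ℕ) (x : ℝ) : ℝ := m * |Real.sin (x / (2 * m))|

lemma chord_neg (m : ℕ) (x : ℝ) : chord m (-x) = chord m x := by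
  rw [chord, chord, neg_div, Real.sin_neg, abs_neg]

lemma chord_add_le (m : ℕ) (x y : ℝ) : chord m (x + y) ≤ chord m x + chord m y := by
  rw [chord, chord, chord, ← mul_add, add_div, Real.sin_add]
  refine mul_le_mul_of_nonneg_left ((abs_add_le _ _).trans (add_le_add ?_ ?_)) (Nat.cast_nonneg m)
  · rw [abs_mul]
    exact mul_le_of_le_one_right (abs_nonneg _) (Real.abs_cos_le_one _)
  · rw [abs_mul]
    exact mul_le_of_le_one_left (abs_nonneg _) (Real.abs_cos_le_one _)

lemma chord_le_abs (m : ℕ) (x : ℝ) : chord m x ≤ |x| := by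
  rcases m.eq_zero_or_pos with rfl | hm
  · simp [chord]
  have hmR : (0 : ℝ) < m := by exact_mod_cast hm
  have hsin : |Real.sin (x / (2 * m))| ≤ |x| / (2 * m) := by
    simpa only [abs_div, abs_of_pos (mul_pos two_pos hmR)] using
      Real.abs_sin_le_abs (x := x / (2 * m))
  calc chord m x ≤ m * (|x| / (2 * m)) := mul_le_mul_of_nonneg_left hsin hmR.le
    _ = |x| / 2 := by field_simp
    _ ≤ |x| := half_le_self (abs_nonneg x)

lemma div_pi_le_chord (hx : |x| ≤ Real.pi * m) : |x| / Real.pi ≤ chord m x := by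
  rcases m.eq_zero_or_pos with rfl | hm
  · simp_all [chord]
  have hmR : (0 : ℝ) < m := by exact_mod_cast hm
  have habs : |x / (2 * m)| = |x| / (2 * m) := by
    rw [abs_div, abs_of_pos (mul_pos two_pos hmR)]
  have hle : |x / (2 * m)| ≤ Real.pi / 2 := by
    rw [habs, div_le_div_iff₀ (by positivity) two_pos]
    linarith
  calc |x| / Real.pi = m * (2 / Real.pi * |x / (2 * m)|) := by
        rw [habs]
        field_simp
    _ ≤ chord m x := mul_le_mul_of_nonneg_left (Real.mul_abs_le_abs_sin hle) hmR.le

lemma chord_add_period (hm : m ≠ 0) (x : ℝ) : chord m (x + 2 * Real.pi * m) = chord m x := by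
  have hmR : (m : ℝ) ≠ 0 := by exact_mod_cast hm
  have hdiv : (x + 2 * Real.pi * m) / (2 * m) = x / (2 * m) + Real.pi := by field_simp
  rw [chord, chord, hdiv, Real.sin_add_pi, abs_neg]

lemma abs_arrayKernel_le_of_le_chord (hm : m ≠ 0) {j : ℕ} {η : ℝ} (hη : 0 < η)
    (hx : (1 + j) / η ≤ chord m x) : |arrayKernel m j x| ≤ η := by
  have hj : (0 : ℝ) < 1 + j := by positivity
  have h := (mul_le_mul_of_nonneg_left hx (abs_nonneg _)).trans (abs_arrayKernel_mul_le hm j x)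
  rwa [← mul_div_assoc, div_le_iff₀ hη, mul_comm, mul_le_mul_iff_right₀ hj] at h

lemma tendsto_arrayKernel_zero {α : Type*} {F : Filter α} {n : α → ℕ} {y : α → ℝ}
    (hy : Tendsto (fun p => chord (n p) (y p)) F atTop) (j : ℕ) :
    Tendsto (fun p => arrayKernel (n p) j (y p)) F (𝓝 0) := by
  have h : Tendsto (fun p => (1 + j : ℝ) / chord (n p) (y p)) F (𝓝 0) :=
    tendsto_const_nhds.div_atTop hy
  refine squeeze_zero_norm' ?_ h
  filter_upwards [hy.eventually_gt_atTop 0] with p hpos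
  have hn : n p ≠ 0 := fun h0 => hpos.ne' (by simp [chord, h0])
  rw [Real.norm_eq_abs, le_div_iff₀ hpos]
  exact abs_arrayKernel_mul_le hn j (y p)

lemma power_add_period (m : ℕ) (δ r x : ℝ) :
    power (arrayKernel m) δ r (x + 2 * Real.pi * m) = power (arrayKernel m) δ r x := by
  have hsq : ((-1 : ℝ) ^ (m + 1)) ^ 2 = 1 := by rw [← pow_mul, mul_comm, pow_mul]; simp
  have hampl : ∀ ε t, ampl (arrayKernel m) δ ε t 0 (x + 2 * Real.pi * m) =
      (-1) ^ (m + 1) * ampl (arrayKernel m) δ ε t 0 x := fun ε t => by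
    simp only [ampl, residual, interp, add_right_comm x _ δ, arrayKernel_add_period]
    ring
  rw [power, power, hampl, hampl, mul_pow, mul_pow, hsq, one_mul, one_mul]

-- By periodicity and the symmetry exchanging the sources.
lemma forall_power_le_one_of_chord_le (hm : m ≠ 0) {δ r : ℝ}
    (h : ∀ x, |x| ≤ Real.pi * m → chord m x ≤ chord m (x + δ) →
      power (arrayKernel m) δ r x ≤ 1) (x : ℝ) : power (arrayKernel m) δ r x ≤ 1 := by
  have hmR : (0 : ℝ) < m := by exact_mod_cast Nat.pos_of_ne_zero hm
  have hperiodic : Function.Periodic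
      (fun x => (power (arrayKernel m) δ r x, chord m x, chord m (x + δ))) (2 * Real.pi * m) :=
    fun x => by
      simp only [power_add_period, chord_add_period hm, add_right_comm x _ δ]
  have hnear : ∀ x, chord m x ≤ chord m (x + δ) → power (arrayKernel m) δ r x ≤ 1 := by
    intro x hx
    obtain ⟨y, hy, hxy⟩ := hperiodic.exists_mem_Ioc (mul_pos Real.two_pi_pos hmR) x (-(Real.pi * m))
    simp only [Prod.mk.injEq] at hxy
    rw [hxy.1]
    refine h y (abs_le.2 ⟨hy.1.le, hy.2.trans (by linarith)⟩) ?_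
    rwa [← hxy.2.1, ← hxy.2.2]
  rcases le_total (chord m x) (chord m (x + δ)) with hx | hx
  · exact hnear x hx
  · rw [← (isKernel_arrayKernel hm).power_reflect]
    refine hnear _ ?_
    rwa [show -δ - x + δ = -x by ring, show -δ - x = -(x + δ) by ring, chord_neg, chord_neg]

end Chord

section FarBound

variable {D : ℕ → ℝ → ℝ} {δ ε r t x c η τ : ℝ}

lemma power_le_one_of_sq_le (hr : |r| ≤ 1)
    (h : ∀ ε : ℝ, ε ^ 2 = 1 → ampl D δ ε (relShift D δ r) 0 x ^ 2 ≤ 1) : power D δ r x ≤ 1 := by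
  obtain ⟨hr₁, hr₂⟩ := abs_le.1 hr
  have h₁ := h 1 (one_pow 2)
  have h₂ := h (-1) (by norm_num)
  rw [power]
  nlinarith

lemma abs_ampl_le (hε : ε ^ 2 = 1) (hc : 0 < c) (hs : |D 0 δ| ≤ 1 - c) (h₁ : |D 1 δ| ≤ 1)
    (hx : ∀ j ≤ 1, |D j x| ≤ η) (hxδ : ∀ j ≤ 1, |D j (x + δ)| ≤ η) :
    |ampl D δ ε t 0 x| ≤ (2 / c + |t| * (2 + 2 / c)) * η := by
  have hε₁ : |ε| = 1 := (sq_eq_sq₀ (abs_nonneg ε) zero_le_one).1 (by rw [sq_abs, hε, one_pow])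
  have hmul : ∀ y, |ε * y| = |y| := fun y => by rw [abs_mul, hε₁, one_mul]
  have hden : c ≤ |1 + ε * D 0 δ| := by
    have := neg_abs_le (ε * D 0 δ)
    rw [hmul] at this
    exact le_trans (by linarith) (le_abs_self _)
  have hη : 0 ≤ η := (abs_nonneg _).trans (hx 0 zero_le_one)
  have hU : |interp D δ ε 0 x| ≤ 2 * η / c := by
    rw [interp, abs_div]
    refine div_le_div₀ (by positivity) ((abs_add_le _ _).trans ?_) hc hden
    rw [hmul]
    linarith [hx 0 zero_le_one, hxδ 0 zero_le_one]
  have hW : |residual D δ ε 0 x| ≤ 2 * η + 2 * η / c := by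
    refine (abs_add_le _ _).trans (add_le_add ((abs_sub _ _).trans ?_) ?_)
    · rw [hmul]
      linarith [hx 1 le_rfl, hxδ 1 le_rfl]
    · rw [mul_assoc, hmul, abs_mul]
      exact (mul_le_of_le_one_left (abs_nonneg _) h₁).trans hU
  calc |ampl D δ ε t 0 x| ≤ |interp D δ ε 0 x| + |t * residual D δ ε 0 x| := abs_sub _ _
    _ ≤ 2 * η / c + |t| * (2 * η + 2 * η / c) :=
        add_le_add hU (abs_mul t _ ▸ mul_le_mul_of_nonneg_left hW (abs_nonneg t))
    _ = (2 / c + |t| * (2 + 2 / c)) * η := by ring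

lemma exists_pos_forall_power_le_one (hc : 0 < c) (hτ : 0 ≤ τ) :
    ∃ η > 0, ∀ (D : ℕ → ℝ → ℝ) (δ r x : ℝ), |r| ≤ 1 → |D 0 δ| ≤ 1 - c → |D 1 δ| ≤ 1 →
      |relShift D δ r| ≤ τ → (∀ j ≤ 1, |D j x| ≤ η) → (∀ j ≤ 1, |D j (x + δ)| ≤ η) →
        power D δ r x ≤ 1 := by
  set B : ℝ := 2 / c + τ * (2 + 2 / c)
  have hB : 0 < B := by positivity
  refine ⟨B⁻¹, inv_pos.2 hB, fun D δ r x hr hs h₁ ht hx hxδ => ?_⟩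
  refine power_le_one_of_sq_le hr fun ε hε => (sq_le_one_iff_abs_le_one _).2 ?_
  calc |ampl D δ ε (relShift D δ r) 0 x| ≤ (2 / c + |relShift D δ r| * (2 + 2 / c)) * B⁻¹ :=
        abs_ampl_le hε hc hs h₁ hx hxδ
    _ ≤ (2 / c + τ * (2 + 2 / c)) * B⁻¹ := by gcongr
    _ = 1 := mul_inv_cancel₀ hB.ne'

end FarBound

lemma eventually_forall_power_le_one {δ r : ℕ → ℝ} {c τ : ℝ} (hc : 0 < c) (hr : ∀ m, |r m| ≤ 1)
    (hs : ∀ᶠ m in atTop, |arrayKernel m 0 (δ m)| ≤ 1 - c)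
    (ht : ∀ᶠ m in atTop, |relShift (arrayKernel m) (δ m) (r m)| ≤ τ)
    (hpt : ∀ x₀, ∀ᶠ p : ℕ × ℝ in atTop ×ˢ 𝓝 x₀,
      power (arrayKernel p.1) (δ p.1) (r p.1) p.2 ≤ 1) :
    ∀ᶠ m in atTop, ∀ x, power (arrayKernel m) (δ m) (r m) x ≤ 1 := by
  have hτ : 0 ≤ τ := let ⟨m, hm⟩ := ht.exists; (abs_nonneg _).trans hm
  obtain ⟨η, hη, hfar⟩ := exists_pos_forall_power_le_one hc hτ
  filter_upwards [eventually_ne_atTop 0, hs, ht, eventually_forall_abs_le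
    (P := fun m x => power (arrayKernel m) (δ m) (r m) x ≤ 1) (C := Real.pi * (2 / η)) hpt]
    with m hm hsm htm hnear
  refine forall_power_le_one_of_chord_le hm fun x hx hxδ => ?_
  rcases le_or_gt |x| (Real.pi * (2 / η)) with hxC | hxC
  · exact hnear x hxC
  have hdist : 2 / η ≤ chord m x :=
    ((le_div_iff₀' Real.pi_pos).2 hxC.le).trans (div_pi_le_chord hx)
  have hsmall : ∀ y, 2 / η ≤ chord m y → ∀ j ≤ 1, |arrayKernel m j y| ≤ η := fun y hy j hj => by
    have hj' : (j : ℝ) ≤ 1 := by exact_mod_cast hj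
    exact abs_arrayKernel_le_of_le_chord hm hη
      ((div_le_div_of_nonneg_right (by linarith) hη.le).trans hy)
  exact hfar _ _ _ x (hr m) hsm ((isAperture_arrayAperture hm).abs_kernel_le_one 1 _) htm
    (hsmall x hdist) (hsmall _ (hdist.trans hxδ))

/-! ### Limits of the power pattern -/

section Limits

variable {α : Type*} {F : Filter α} {D : α → ℕ → ℝ → ℝ} {δ t x : α → ℝ} {ε a a₁ b b₁ s s₁ t₀ : ℝ}

lemma tendsto_interp {j : ℕ} (ha : Tendsto (fun p => D p j (x p)) F (𝓝 a))
    (hb : Tendsto (fun p => D p j (x p + δ p)) F (𝓝 b))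
    (hs : Tendsto (fun p => D p 0 (δ p)) F (𝓝 s)) (h : 1 + ε * s ≠ 0) :
    Tendsto (fun p => interp (D p) (δ p) ε j (x p)) F (𝓝 ((a + ε * b) / (1 + ε * s))) :=
  (ha.add (hb.const_mul ε)).div ((hs.const_mul ε).const_add 1) h

lemma tendsto_ampl {j : ℕ} (ha : Tendsto (fun p => D p j (x p)) F (𝓝 a))
    (ha₁ : Tendsto (fun p => D p (j + 1) (x p)) F (𝓝 a₁))
    (hb : Tendsto (fun p => D p j (x p + δ p)) F (𝓝 b))
    (hb₁ : Tendsto (fun p => D p (j + 1) (x p + δ p)) F (𝓝 b₁))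
    (hs : Tendsto (fun p => D p 0 (δ p)) F (𝓝 s)) (hs₁ : Tendsto (fun p => D p 1 (δ p)) F (𝓝 s₁))
    (ht : Tendsto t F (𝓝 t₀)) (h : 1 + ε * s ≠ 0) :
    Tendsto (fun p => ampl (D p) (δ p) ε (t p) j (x p)) F
      (𝓝 ((a + ε * b) / (1 + ε * s) -
        t₀ * (a₁ - ε * b₁ + ε * s₁ * ((a + ε * b) / (1 + ε * s))))) :=
  have hU := tendsto_interp ha hb hs h
  hU.sub (ht.mul ((ha₁.sub (hb₁.const_mul ε)).add ((hs₁.const_mul ε).mul hU)))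

lemma tendsto_schurEigen {κ s₂ : ℝ} (h0 : Tendsto (fun p => D p 2 0) F (𝓝 κ))
    (hs : Tendsto (fun p => D p 0 (δ p)) F (𝓝 s)) (hs₁ : Tendsto (fun p => D p 1 (δ p)) F (𝓝 s₁))
    (hs₂ : Tendsto (fun p => D p 2 (δ p)) F (𝓝 s₂)) (h : 1 - ε * s ≠ 0) :
    Tendsto (fun p => schurEigen (D p) (δ p) ε) F
      (𝓝 (-(κ + ε * s₂) - s₁ ^ 2 / (1 - ε * s))) :=
  (h0.add (hs₂.const_mul ε)).neg.sub ((hs₁.pow 2).div ((hs.const_mul ε).const_sub 1) h)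

end Limits

/-! ### Separated sources -/

section Separated

variable {δ r : ℕ → ℝ}

lemma tendsto_chord_of_abs_le (hδ : Tendsto δ atTop atTop) (hle : ∀ m, |δ m| ≤ Real.pi * m) :
    Tendsto (fun m => chord m (δ m)) atTop atTop :=
  tendsto_atTop_mono (fun m => div_pi_le_chord (hle m))
    ((tendsto_abs_atTop_atTop.comp hδ).atTop_div_const Real.pi_pos)

lemma tendsto_chord_add (hδ : Tendsto (fun m => chord m (δ m)) atTop atTop) (x₀ : ℝ) :
    Tendsto (fun p : ℕ × ℝ => chord p.1 (p.2 + δ p.1)) (atTop ×ˢ 𝓝 x₀) atTop := by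
  have hle (p : ℕ × ℝ) : chord p.1 (δ p.1) + -|p.2| ≤ chord p.1 (p.2 + δ p.1) := by
    have h := chord_add_le p.1 (-p.2) (p.2 + δ p.1)
    rw [neg_add_cancel_left, chord_neg] at h
    linarith [chord_le_abs p.1 p.2]
  exact tendsto_atTop_mono hle ((hδ.comp tendsto_fst).atTop_add tendsto_snd.abs.neg)

lemma tendsto_schurEigen_of_separated (hδ : Tendsto (fun m => chord m (δ m)) atTop atTop) (ε : ℝ) :
    Tendsto (fun m => schurEigen (arrayKernel m) (δ m) ε) atTop (𝓝 (1 / 12)) := by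
  have h := tendsto_schurEigen (ε := ε) (tendsto_arrayKernel tendsto_id tendsto_const_nhds 2)
    (tendsto_arrayKernel_zero hδ 0) (tendsto_arrayKernel_zero hδ 1) (tendsto_arrayKernel_zero hδ 2)
    (by norm_num)
  simpa [limitKernel_two_zero] using h

lemma tendsto_mul_zero_of_abs_le_one {f : ℕ → ℝ} (hr : ∀ m, |r m| ≤ 1)
    (hf : Tendsto f atTop (𝓝 0)) : Tendsto (fun m => r m * f m) atTop (𝓝 0) :=
  bdd_le_mul_tendsto_zero' 1 (Eventually.of_forall hr) hf

lemma tendsto_shiftDenom_of_separated (hδ : Tendsto (fun m => chord m (δ m)) atTop atTop)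
    (hr : ∀ m, |r m| ≤ 1) :
    Tendsto (fun m => shiftDenom (arrayKernel m) (δ m) (r m)) atTop (𝓝 (1 / 12)) := by
  have h₁ := tendsto_schurEigen_of_separated hδ 1
  have h₂ := tendsto_schurEigen_of_separated hδ (-1)
  have hdiff := tendsto_mul_zero_of_abs_le_one hr (by simpa only [sub_self] using h₂.sub h₁)
  convert ((h₁.add h₂).add hdiff).div_const 2 using 2
  · rw [shiftDenom]
    ring
  · norm_num

lemma tendsto_relShift_of_separated (hδ : Tendsto (fun m => chord m (δ m)) atTop atTop)
    (hr : ∀ m, |r m| ≤ 1) :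
    Tendsto (fun m => relShift (arrayKernel m) (δ m) (r m)) atTop (𝓝 0) := by
  have hs := tendsto_arrayKernel_zero hδ 0
  have hc : Tendsto (fun m => arrayKernel m 1 (δ m) / (1 - arrayKernel m 0 (δ m) ^ 2)) atTop
      (𝓝 0) := by
    simpa [Pi.div_def] using
      (tendsto_arrayKernel_zero hδ 1).div ((hs.pow 2).const_sub 1) (by norm_num)
  have hnum := (hc.mul hs).sub (tendsto_mul_zero_of_abs_le_one hr hc)
  convert hnum.div (tendsto_shiftDenom_of_separated hδ hr) (by norm_num) using 2
  · rw [relShift, Pi.div_apply]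
    ring
  · norm_num

lemma eventually_isNondegenerate_of_separated
    (hδ : Tendsto (fun m => chord m (δ m)) atTop atTop) (hr : ∀ m, |r m| ≤ 1) :
    ∀ᶠ m in atTop, IsNondegenerate (arrayKernel m) (δ m) (r m) := by
  have hs := (tendsto_arrayKernel_zero hδ 0).abs.eventually_lt_const (u := 1) (by norm_num)
  have hr' : ∀ m, |(-r m)| ≤ 1 := fun m => (abs_neg (r m)).trans_le (hr m)
  filter_upwards [hs,
    (tendsto_shiftDenom_of_separated hδ hr).eventually_const_lt (u := 0) (by norm_num),
    (tendsto_shiftDenom_of_separated hδ hr').eventually_const_lt (u := 0) (by norm_num)]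
    with m h₁ h₂ h₃ using ⟨h₁, h₂, h₃⟩

lemma tendsto_ampl_of_separated (hδ : Tendsto (fun m => chord m (δ m)) atTop atTop)
    (hr : ∀ m, |r m| ≤ 1) (ε : ℝ) (j : ℕ) (x₀ : ℝ) :
    Tendsto (fun p : ℕ × ℝ => ampl (arrayKernel p.1) (δ p.1) ε
      (relShift (arrayKernel p.1) (δ p.1) (r p.1)) j p.2) (atTop ×ˢ 𝓝 x₀)
      (𝓝 (limitKernel j x₀)) := by
  have ha := tendsto_arrayKernel (tendsto_fst (f := atTop) (g := 𝓝 x₀)) tendsto_snd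
  have hb := tendsto_arrayKernel_zero (tendsto_chord_add hδ x₀)
  have hs (j : ℕ) := (tendsto_arrayKernel_zero hδ j).comp (tendsto_fst (g := 𝓝 x₀))
  have h := tendsto_ampl (D := fun p : ℕ × ℝ => arrayKernel p.1) (x := Prod.snd) (ε := ε)
    (ha j) (ha (j + 1)) (hb j) (hb (j + 1)) (hs 0) (hs 1)
    ((tendsto_relShift_of_separated hδ hr).comp tendsto_fst) (by norm_num)
  simpa using h

lemma eventually_power_le_one_near_of_separated
    (hδ : Tendsto (fun m => chord m (δ m)) atTop atTop) (hr : ∀ m, |r m| ≤ 1) (x₀ : ℝ) :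
    ∀ᶠ p : ℕ × ℝ in atTop ×ˢ 𝓝 x₀, power (arrayKernel p.1) (δ p.1) (r p.1) p.2 ≤ 1 := by
  have hV := tendsto_ampl_of_separated hδ hr
  rcases eq_or_ne x₀ 0 with rfl | hx
  · refine eventually_power_le_one_near_zero
      ((eventually_ne_atTop 0).mono fun m hm => isKernel_arrayKernel hm)
      (eventually_isNondegenerate_of_separated hδ hr) ?_
    have hneg : limitKernel 1 0 ^ 2 + limitKernel 0 0 * limitKernel 2 0 < 0 := by
      rw [isKernel_limitKernel.one, isKernel_limitKernel.apply_zero_of_odd odd_one,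
        limitKernel_two_zero]
      norm_num
    have hneg' (ε : ℝ) :=
      (((hV ε 1 0).pow 2).add ((hV ε 0 0).mul (hV ε 2 0))).eventually_lt_const hneg
    filter_upwards [hneg' 1, hneg' (-1)] with p h₁ h₂
    have := abs_le.1 (hr p.1)
    rw [power2]
    nlinarith
  · have hlt : limitKernel 0 x₀ ^ 2 < 1 := (sq_lt_one_iff_abs_lt_one _).2
      (abs_limitKernel_zero_lt_one hx)
    have hlt' (ε : ℝ) := ((hV ε 0 x₀).pow 2).eventually_lt_const hlt
    filter_upwards [hlt' 1, hlt' (-1)] with p h₁ h₂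
    refine power_le_one_of_sq_le (hr p.1) fun ε hε => ?_
    rcases sq_eq_one_iff.1 hε with rfl | rfl
    exacts [h₁.le, h₂.le]

lemma eventually_power_le_one_of_separated
    (hδ : Tendsto (fun m => chord m (δ m)) atTop atTop) (hr : ∀ m, |r m| ≤ 1) :
    ∀ᶠ m in atTop, ∀ x, power (arrayKernel m) (δ m) (r m) x ≤ 1 := by
  refine eventually_forall_power_le_one (c := 1 / 2) (τ := 1) (by norm_num) hr ?_ ?_
    (eventually_power_le_one_near_of_separated hδ hr)
  · exact (tendsto_arrayKernel_zero hδ 0).abs.eventually_le_const (by norm_num)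
  · exact (tendsto_relShift_of_separated hδ hr).abs.eventually_le_const (by norm_num)

end Separated

/-! ### Sources at a fixed scaled distance -/

section FixedDistance

variable {δ r : ℕ → ℝ} {δ₀ r₀ : ℝ}

lemma tendsto_arrayKernel_apply (hδ : Tendsto δ atTop (𝓝 δ₀)) (j : ℕ) :
    Tendsto (fun m => arrayKernel m j (δ m)) atTop (𝓝 (limitKernel j δ₀)) :=
  tendsto_arrayKernel tendsto_id hδ j

lemma tendsto_shiftDenom (hδ : Tendsto δ atTop (𝓝 δ₀)) (hr : Tendsto r atTop (𝓝 r₀))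
    (hs : |limitKernel 0 δ₀| < 1) :
    Tendsto (fun m => shiftDenom (arrayKernel m) (δ m) (r m)) atTop
      (𝓝 (shiftDenom limitKernel δ₀ r₀)) := by
  have hK {ε : ℝ} (hε : ε ^ 2 = 1) : Tendsto (fun m => schurEigen (arrayKernel m) (δ m) ε) atTop
      (𝓝 (schurEigen limitKernel δ₀ ε)) :=
    have hden := one_add_mul_pos (ε := -ε) (by rwa [neg_sq]) hs
    tendsto_schurEigen (tendsto_arrayKernel_apply tendsto_const_nhds 2)
      (tendsto_arrayKernel_apply hδ 0) (tendsto_arrayKernel_apply hδ 1)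
      (tendsto_arrayKernel_apply hδ 2) (by linarith : 0 < 1 - ε * limitKernel 0 δ₀).ne'
  exact (((hr.const_sub 1).mul (hK (one_pow 2))).add
    ((hr.const_add 1).mul (hK (by norm_num)))).div_const 2

lemma tendsto_relShift (hδ : Tendsto δ atTop (𝓝 δ₀)) (hr : Tendsto r atTop (𝓝 r₀))
    (hN : IsNondegenerate limitKernel δ₀ r₀) :
    Tendsto (fun m => relShift (arrayKernel m) (δ m) (r m)) atTop
      (𝓝 (relShift limitKernel δ₀ r₀)) := by
  have hs := tendsto_arrayKernel_apply hδ 0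
  have hne : 1 - limitKernel 0 δ₀ ^ 2 ≠ 0 :=
    (sub_pos.2 ((sq_lt_one_iff_abs_lt_one _).2 hN.abs_lt)).ne'
  exact (((tendsto_arrayKernel_apply hδ 1).div ((hs.pow 2).const_sub 1) hne).mul (hs.sub hr)).div
    (tendsto_shiftDenom hδ hr hN.abs_lt) hN.shiftDenom_pos.ne'

lemma eventually_isNondegenerate (hδ : Tendsto δ atTop (𝓝 δ₀)) (hr : Tendsto r atTop (𝓝 r₀))
    (hN : IsNondegenerate limitKernel δ₀ r₀) :
    ∀ᶠ m in atTop, IsNondegenerate (arrayKernel m) (δ m) (r m) := by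
  filter_upwards [(tendsto_arrayKernel_apply hδ 0).abs.eventually_lt_const hN.abs_lt,
    (tendsto_shiftDenom hδ hr hN.abs_lt).eventually_const_lt hN.shiftDenom_pos,
    (tendsto_shiftDenom hδ hr.neg hN.abs_lt).eventually_const_lt hN.shiftDenom_neg_pos]
    with m h₁ h₂ h₃ using ⟨h₁, h₂, h₃⟩

lemma tendsto_ampl_arrayKernel (hδ : Tendsto δ atTop (𝓝 δ₀)) (hr : Tendsto r atTop (𝓝 r₀))
    (hN : IsNondegenerate limitKernel δ₀ r₀) {ε : ℝ} (hε : ε ^ 2 = 1) (j : ℕ) (x₀ : ℝ) :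
    Tendsto (fun p : ℕ × ℝ => ampl (arrayKernel p.1) (δ p.1) ε
      (relShift (arrayKernel p.1) (δ p.1) (r p.1)) j p.2) (atTop ×ˢ 𝓝 x₀)
      (𝓝 (ampl limitKernel δ₀ ε (relShift limitKernel δ₀ r₀) j x₀)) := by
  have ha := tendsto_arrayKernel (tendsto_fst (f := atTop) (g := 𝓝 x₀)) tendsto_snd
  have hb := tendsto_arrayKernel (tendsto_fst (f := atTop) (g := 𝓝 x₀))
    (tendsto_snd.add (hδ.comp tendsto_fst))
  have hs (j : ℕ) := (tendsto_arrayKernel_apply hδ j).comp (tendsto_fst (g := 𝓝 x₀))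
  exact tendsto_ampl (D := fun p : ℕ × ℝ => arrayKernel p.1) (x := Prod.snd)
    (ha j) (ha (j + 1)) (hb j) (hb (j + 1)) (hs 0) (hs 1)
    ((tendsto_relShift hδ hr hN).comp tendsto_fst) (one_add_mul_pos hε hN.abs_lt).ne'

lemma eventually_power_le_one_near_zero_of_power2_neg (hδ : Tendsto δ atTop (𝓝 δ₀))
    (hr : Tendsto r atTop (𝓝 r₀)) (hN : IsNondegenerate limitKernel δ₀ r₀)
    (h2 : power2 limitKernel δ₀ r₀ 0 < 0) :
    ∀ᶠ p : ℕ × ℝ in atTop ×ˢ 𝓝 0, power (arrayKernel p.1) (δ p.1) (r p.1) p.2 ≤ 1 := by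
  refine eventually_power_le_one_near_zero
    ((eventually_ne_atTop 0).mono fun m hm => isKernel_arrayKernel hm)
    (eventually_isNondegenerate hδ hr hN) ?_
  have hr' := hr.comp (tendsto_fst (g := 𝓝 (0 : ℝ)))
  have hV₁ (j : ℕ) := tendsto_ampl_arrayKernel hδ hr hN (one_pow 2) j 0
  have hV₂ (j : ℕ) := tendsto_ampl_arrayKernel hδ hr hN (ε := -1) (by norm_num) j 0
  have hp := ((hr'.const_add 1).mul (((hV₁ 1).pow 2).add ((hV₁ 0).mul (hV₁ 2)))).add
    ((hr'.const_sub 1).mul (((hV₂ 1).pow 2).add ((hV₂ 0).mul (hV₂ 2))))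
  exact hp.eventually_le_const h2

lemma eventually_power_le_one_near_of_power_lt (hδ : Tendsto δ atTop (𝓝 δ₀))
    (hr : Tendsto r atTop (𝓝 r₀)) (hN : IsNondegenerate limitKernel δ₀ r₀) {x₀ : ℝ}
    (hlt : power limitKernel δ₀ r₀ x₀ < 1) :
    ∀ᶠ p : ℕ × ℝ in atTop ×ˢ 𝓝 x₀, power (arrayKernel p.1) (δ p.1) (r p.1) p.2 ≤ 1 := by
  have hr' := hr.comp (tendsto_fst (g := 𝓝 x₀))
  have hV₁ := tendsto_ampl_arrayKernel hδ hr hN (one_pow 2) 0 x₀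
  have hV₂ := tendsto_ampl_arrayKernel hδ hr hN (ε := -1) (by norm_num) 0 x₀
  have hp := (((hr'.const_add 1).div_const 2).mul (hV₁.pow 2)).add
    (((hr'.const_sub 1).div_const 2).mul (hV₂.pow 2))
  exact hp.eventually_le_const hlt

lemma eventually_power_le_one_of_tendsto (hδ : Tendsto δ atTop (𝓝 δ₀))
    (hr : Tendsto r atTop (𝓝 r₀)) (hr₁ : ∀ m, |r m| ≤ 1) (hN : IsNondegenerate limitKernel δ₀ r₀)
    (hlt : ∀ x, x ≠ 0 → x ≠ -δ₀ → power limitKernel δ₀ r₀ x < 1)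
    (h2 : power2 limitKernel δ₀ r₀ 0 < 0) :
    ∀ᶠ m in atTop, ∀ x, power (arrayKernel m) (δ m) (r m) x ≤ 1 := by
  have hnear := eventually_power_le_one_near_zero_of_power2_neg hδ hr hN h2
  have hs := (tendsto_arrayKernel_apply hδ 0).abs
  refine eventually_forall_power_le_one (c := (1 - |limitKernel 0 δ₀|) / 2)
    (τ := |relShift limitKernel δ₀ r₀| + 1) (half_pos (sub_pos.2 hN.abs_lt)) hr₁
    (hs.eventually_le_const (by linarith [hN.abs_lt]))
    ((tendsto_relShift hδ hr hN).abs.eventually_le_const (lt_add_one _)) fun x₀ => ?_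
  rcases eq_or_ne x₀ 0 with rfl | h0
  · exact hnear
  rcases eq_or_ne x₀ (-δ₀) with rfl | h1
  · have hmap : Tendsto (fun p : ℕ × ℝ => (p.1, -δ p.1 - p.2)) (atTop ×ˢ 𝓝 (-δ₀))
        (atTop ×ˢ 𝓝 0) := by
      refine tendsto_fst.prodMk ?_
      simpa only [sub_self, Function.comp_apply] using
        (hδ.comp tendsto_fst).neg.sub (tendsto_snd (g := 𝓝 (-δ₀)))
    filter_upwards [hmap.eventually hnear, tendsto_fst.eventually (eventually_ne_atTop 0)]
      with p hp hm
    rwa [(isKernel_arrayKernel hm).power_reflect] at hp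
  · exact eventually_power_le_one_near_of_power_lt hδ hr hN (hlt x₀ h0 h1)

end FixedDistance

/-! ### Positivity of the Gram matrices -/

section Aperture

variable {μ : Measure ℝ} {δ ε : ℝ}

lemma half_sum_sq_eq (hε : ε ^ 2 = 1) (u c θ : ℝ) :
    ((u * (1 + ε * Real.cos θ) - c * (ε * Real.sin θ)) ^ 2 +
      (u * (ε * Real.sin θ) - c * (1 - ε * Real.cos θ)) ^ 2) / 2 =
    u ^ 2 + ε * (u ^ 2 * Real.cos θ) - 2 * c * ε * (u * Real.sin θ) +
      c ^ 2 * (1 - ε * Real.cos θ) := by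
  linear_combination (u ^ 2 + c ^ 2) / 2 * ε ^ 2 * Real.sin_sq_add_cos_sq θ +
    (u ^ 2 + c ^ 2) / 2 * hε

-- The right side is the squared distance of the (anti)symmetric derivative of the sources to the
-- multiples of their (anti)symmetric combination of the other sign.
lemma IsAperture.schurForm_eq_integral (hμ : IsAperture μ) (hε : ε ^ 2 = 1) (δ c : ℝ) :
    -(kernel μ 2 0 + ε * kernel μ 2 δ) + 2 * c * ε * kernel μ 1 δ +
        c ^ 2 * (1 - ε * kernel μ 0 δ) =
      ∫ u, ((u * (1 + ε * Real.cos (u * δ)) - c * (ε * Real.sin (u * δ))) ^ 2 +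
        (u * (ε * Real.sin (u * δ)) - c * (1 - ε * Real.cos (u * δ))) ^ 2) / 2 ∂μ := by
  have := hμ.isProbabilityMeasure
  have hi {f : ℝ → ℝ} (hf : Continuous f) : Integrable f μ := hμ.integrable hf
  simp_rw [half_sum_sq_eq hε]
  rw [integral_add (hi (by fun_prop)) (hi (by fun_prop)),
    integral_sub (hi (by fun_prop)) (hi (by fun_prop)),
    integral_add (hi (by fun_prop)) (hi (by fun_prop))]
  simp only [integral_const_mul]
  rw [integral_sub (hi (by fun_prop)) (hi (by fun_prop)), integral_const_mul, integral_const,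
    probReal_univ, kernel_two_eq, kernel_two_eq, kernel_one_eq, kernel_zero_eq]
  simp only [mul_zero, Real.cos_zero, mul_one, smul_eq_mul]
  ring

lemma IsAperture.schurEigen_eq_integral (hμ : IsAperture μ) (hε : ε ^ 2 = 1)
    (hs : |kernel μ 0 δ| < 1) :
    ∃ c, schurEigen (kernel μ) δ ε =
      ∫ u, ((u * (1 + ε * Real.cos (u * δ)) - c * (ε * Real.sin (u * δ))) ^ 2 +
        (u * (ε * Real.sin (u * δ)) - c * (1 - ε * Real.cos (u * δ))) ^ 2) / 2 ∂μ := by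
  have hne : 1 - ε * kernel μ 0 δ ≠ 0 := by
    simpa [sub_eq_add_neg] using (one_add_mul_pos (ε := -ε) (by rwa [neg_sq]) hs).ne'
  refine ⟨-(ε * kernel μ 1 δ) / (1 - ε * kernel μ 0 δ), ?_⟩
  rw [← hμ.schurForm_eq_integral hε, schurEigen]
  field_simp
  linear_combination kernel μ 1 δ ^ 2 * hε

lemma IsAperture.schurEigen_nonneg (hμ : IsAperture μ) (hε : ε ^ 2 = 1)
    (hs : |kernel μ 0 δ| < 1) : 0 ≤ schurEigen (kernel μ) δ ε := by
  obtain ⟨c, hc⟩ := hμ.schurEigen_eq_integral hε hs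
  rw [hc]
  exact integral_nonneg fun u => by positivity

lemma IsAperture.gramForm_eq_integral (hμ : IsAperture μ) (δ x a b : ℝ) :
    1 + a ^ 2 + b ^ 2 - 2 * a * kernel μ 0 x - 2 * b * kernel μ 0 (x + δ) +
        2 * a * b * kernel μ 0 δ =
      ∫ u, ((Real.cos (u * x) - a - b * Real.cos (u * δ)) ^ 2 +
        (Real.sin (u * x) + b * Real.sin (u * δ)) ^ 2) ∂μ := by
  have := hμ.isProbabilityMeasure
  have hi {f : ℝ → ℝ} (hf : Continuous f) : Integrable f μ := hμ.integrable hf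
  have hexpand (u : ℝ) : (Real.cos (u * x) - a - b * Real.cos (u * δ)) ^ 2 +
      (Real.sin (u * x) + b * Real.sin (u * δ)) ^ 2 = 1 + a ^ 2 + b ^ 2 -
        2 * a * Real.cos (u * x) - 2 * b * Real.cos (u * (x + δ)) +
        2 * a * b * Real.cos (u * δ) := by
    rw [mul_add, Real.cos_add]
    linear_combination Real.sin_sq_add_cos_sq (u * x) + b ^ 2 * Real.sin_sq_add_cos_sq (u * δ)
  simp_rw [hexpand]
  rw [integral_add (hi (by fun_prop)) (hi (by fun_prop)),
    integral_sub (hi (by fun_prop)) (hi (by fun_prop)),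
    integral_sub (hi (by fun_prop)) (hi (by fun_prop)), integral_const_mul, integral_const_mul,
    integral_const_mul, integral_const, probReal_univ, one_smul, ← kernel_zero_eq,
    ← kernel_zero_eq, ← kernel_zero_eq]

end Aperture

section Uniform

variable {δ ε x : ℝ}

lemma integral_uniformAperture_pos {f : ℝ → ℝ} (hf : Continuous f) (h0 : ∀ u, 0 ≤ f u)
    (h : ∃ u, |u| ≤ 1 / 2 ∧ f u ≠ 0) : 0 < ∫ u, f u ∂uniformAperture := by
  obtain ⟨u, hu, hne⟩ := h
  rw [integral_uniformAperture]
  exact intervalIntegral.integral_pos (by norm_num) hf.continuousOn (fun u _ => h0 u)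
    ⟨u, by rwa [Set.mem_Icc, neg_div, ← abs_le], (h0 u).lt_of_ne' hne⟩

lemma exists_cos_mul_mem_Ioo {δ : ℝ} (hδ : δ ≠ 0) :
    ∃ u, 0 < u ∧ u ≤ 1 / 4 ∧ Real.cos (u * δ) ∈ Set.Ioo 0 1 := by
  have hpos : 0 < |δ| := abs_pos.2 hδ
  refine ⟨1 / (4 * (1 + |δ|)), by positivity, ?_, ?_⟩
  · rw [div_le_div_iff₀ (by positivity) (by norm_num)]
    linarith
  have hlt : 1 / (4 * (1 + |δ|)) * |δ| < 1 := by
    rw [div_mul_eq_mul_div, one_mul, div_lt_one (by positivity)]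
    linarith
  have h0 : 0 < 1 / (4 * (1 + |δ|)) * |δ| := by positivity
  rw [← Real.cos_abs, abs_mul, abs_of_pos (by positivity : 0 < 1 / (4 * (1 + |δ|)))]
  refine ⟨Real.cos_pos_of_mem_Ioo ⟨by linarith [Real.pi_pos], by linarith [Real.pi_gt_three]⟩, ?_⟩
  have h := Real.cos_lt_cos_of_nonneg_of_le_pi le_rfl (by linarith [Real.pi_gt_three]) h0
  rwa [Real.cos_zero] at h

lemma schurEigen_limitKernel_pos (hδ : δ ≠ 0) (hε : ε ^ 2 = 1) :
    0 < schurEigen limitKernel δ ε := by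
  obtain ⟨c, hc⟩ := isAperture_uniformAperture.schurEigen_eq_integral hε
    (abs_limitKernel_zero_lt_one hδ)
  rw [hc]
  refine integral_uniformAperture_pos (by fun_prop) (fun u => by positivity) ?_
  by_contra! h
  obtain ⟨u, hu, hu4, hcos, hcos₁⟩ := exists_cos_mul_mem_Ioo hδ
  have hzero (v : ℝ) (hv : |v| ≤ 1 / 2) :
      v * (1 + ε * Real.cos (v * δ)) - c * (ε * Real.sin (v * δ)) = 0 :=
    pow_eq_zero_iff two_ne_zero |>.1
      ((add_eq_zero_iff_of_nonneg (sq_nonneg _) (sq_nonneg _)).1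
        ((div_eq_zero_iff.1 (h v hv)).resolve_right two_ne_zero)).1
  have h₁ := hzero u (by rw [abs_of_pos hu]; linarith)
  have h₂ := hzero (2 * u) (by rw [abs_of_pos (by linarith)]; linarith)
  rw [mul_assoc 2 u δ, Real.sin_two_mul, Real.cos_two_mul] at h₂
  have hprod : 2 * u * ((Real.cos (u * δ) - 1) * (ε * Real.cos (u * δ) + ε - 1)) = 0 := by
    linear_combination h₂ - 2 * Real.cos (u * δ) * h₁
  have hfactor : ε * Real.cos (u * δ) + ε - 1 = 0 :=
    (mul_eq_zero.1 ((mul_eq_zero.1 hprod).resolve_left (by positivity))).resolve_left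
      (sub_neg.2 hcos₁).ne
  rcases sq_eq_one_iff.1 hε with rfl | rfl <;> linarith

lemma shiftDenom_limitKernel_pos (hδ : δ ≠ 0) {r : ℝ} (hr : |r| ≤ 1) :
    0 < shiftDenom limitKernel δ r :=
  shiftDenom_pos_of_schurEigen_pos (schurEigen_limitKernel_pos hδ (one_pow 2))
    (schurEigen_limitKernel_pos hδ (by norm_num)) hr

lemma isNondegenerate_limitKernel (hδ : δ ≠ 0) {r : ℝ} (hr : |r| ≤ 1) :
    IsNondegenerate limitKernel δ r :=
  ⟨abs_limitKernel_zero_lt_one hδ, shiftDenom_limitKernel_pos hδ hr,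
    shiftDenom_limitKernel_pos hδ ((abs_neg r).trans_le hr)⟩

lemma eq_zero_of_forall_sin_mul_eq_zero (h : ∀ u : ℝ, |u| ≤ 1 / 2 → Real.sin (u * x) = 0) :
    x = 0 := by
  by_contra hx
  obtain ⟨u, hu, hu4, hcos, hcos₁⟩ := exists_cos_mul_mem_Ioo hx
  have hsq := Real.sin_sq_add_cos_sq (u * x)
  rw [h u (by rw [abs_of_pos hu]; linarith)] at hsq
  nlinarith

-- No steering direction is a linear combination of two other ones.
lemma exists_cos_mul_ne_or_sin_mul_ne (hδ : δ ≠ 0) (hx : x ≠ 0) (hxδ : x ≠ -δ) (a b : ℝ) :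
    ∃ u, |u| ≤ 1 / 2 ∧ (Real.cos (u * x) - a - b * Real.cos (u * δ) ≠ 0 ∨
      Real.sin (u * x) + b * Real.sin (u * δ) ≠ 0) := by
  by_contra! h
  have hcos (u : ℝ) (hu : |u| ≤ 1 / 2) : Real.cos (u * x) = a + b * Real.cos (u * δ) := by
    linear_combination (h u hu).1
  have hsin (u : ℝ) (hu : |u| ≤ 1 / 2) : Real.sin (u * x) = -b * Real.sin (u * δ) := by
    linear_combination (h u hu).2
  have hab : a + b = 1 := by simpa using (hcos 0 (by norm_num)).symm
  have hmul : a * b = 0 := by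
    obtain ⟨u, hu, hu4, -, hlt⟩ := exists_cos_mul_mem_Ioo hδ
    have hu2 : |u| ≤ 1 / 2 := by rw [abs_of_pos hu]; linarith
    have hone := Real.sin_sq_add_cos_sq (u * x)
    rw [hcos u hu2, hsin u hu2] at hone
    have hprod : a * b * (Real.cos (u * δ) - 1) = 0 := by
      linear_combination hone / 2 - b ^ 2 / 2 * Real.sin_sq_add_cos_sq (u * δ) -
        (a + b + 1) / 2 * hab
    exact (mul_eq_zero.1 hprod).resolve_right (sub_neg.2 hlt).ne
  rcases mul_eq_zero.1 hmul with rfl | rfl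
  · rw [zero_add] at hab
    refine hxδ (eq_neg_of_add_eq_zero_left (eq_zero_of_forall_sin_mul_eq_zero fun u hu => ?_))
    rw [mul_add, Real.sin_add, hcos u hu, hsin u hu, hab]
    ring
  · refine hx (eq_zero_of_forall_sin_mul_eq_zero fun u hu => ?_)
    rw [hsin u hu, neg_zero, zero_mul]

lemma gram_lt_one (hδ : δ ≠ 0) (hx : x ≠ 0) (hxδ : x ≠ -δ) :
    (1 + limitKernel 0 δ) / 2 * interp limitKernel δ 1 0 x ^ 2 +
      (1 - limitKernel 0 δ) / 2 * interp limitKernel δ (-1) 0 x ^ 2 < 1 := by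
  have hs := abs_limitKernel_zero_lt_one hδ
  have hU {ε : ℝ} (hε : ε ^ 2 = 1) : interp limitKernel δ ε 0 x * (1 + ε * limitKernel 0 δ) =
      limitKernel 0 x + ε * limitKernel 0 (x + δ) :=
    div_mul_cancel₀ _ (one_add_mul_pos hε hs).ne'
  set a := (interp limitKernel δ 1 0 x + interp limitKernel δ (-1) 0 x) / 2 with ha
  set b := (interp limitKernel δ 1 0 x - interp limitKernel δ (-1) 0 x) / 2 with hb
  have hpos : 0 < ∫ u, ((Real.cos (u * x) - a - b * Real.cos (u * δ)) ^ 2 +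
      (Real.sin (u * x) + b * Real.sin (u * δ)) ^ 2) ∂uniformAperture := by
    refine integral_uniformAperture_pos (by fun_prop) (fun u => by positivity) ?_
    obtain ⟨u, hu, hne⟩ := exists_cos_mul_ne_or_sin_mul_ne hδ hx hxδ a b
    exact ⟨u, hu, by rcases hne with hne | hne <;> positivity⟩
  rw [← isAperture_uniformAperture.gramForm_eq_integral] at hpos
  have hform : 1 + a ^ 2 + b ^ 2 - 2 * a * limitKernel 0 x - 2 * b * limitKernel 0 (x + δ) +
      2 * a * b * limitKernel 0 δ = 1 - ((1 + limitKernel 0 δ) / 2 * interp limitKernel δ 1 0 x ^ 2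
        + (1 - limitKernel 0 δ) / 2 * interp limitKernel δ (-1) 0 x ^ 2) := by
    rw [ha, hb]
    linear_combination interp limitKernel δ 1 0 x * hU (one_pow 2) +
      interp limitKernel δ (-1) 0 x * hU (ε := -1) (by norm_num)
  linarith

end Uniform

/-! ### Generic correlations -/

section Countable

lemma countable_setOf_eq_zero {f : ℝ → ℝ} {U : Set ℝ} {x₀ : ℝ} (hf : AnalyticOnNhd ℝ f U)
    (hU : IsPreconnected U) (hx₀ : x₀ ∈ U) (hne : f x₀ ≠ 0) : {x ∈ U | f x = 0}.Countable := by
  refine (countable_setOfPred_isolated_right_within (s := {x ∈ U | f x = 0})).mono fun x hx => ?_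
  refine ⟨hx, ?_⟩
  have hiso : ∀ᶠ z in 𝓝[≠] x, f z ≠ 0 := by
    by_contra hcon
    exact hne (hf.eqOn_zero_of_preconnected_of_frequently_eq_zero hU hx.1
      (not_not.1 fun h => hcon (not_frequently.1 h)) hx₀)
  rw [← eventually_false_iff_eq_bot]
  filter_upwards [hiso.filter_mono (nhdsWithin_mono _ fun z hz => ne_of_gt hz.2),
    eventually_mem_nhdsWithin] with z hz hz'
  exact hz hz'.1.2

lemma deriv_nonpos_of_frequently_right {g : ℝ → ℝ} {g' t : ℝ} {s : Set ℝ} (hg : HasDerivAt g g' t)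
    (ht : g t = 0) (hs : ∀ u ∈ s, g u ≤ 0) (hne : 𝓝[s ∩ Set.Ioi t] t ≠ ⊥) : g' ≤ 0 := by
  have : (𝓝[s ∩ Set.Ioi t] t).NeBot := ⟨hne⟩
  have h := (hasDerivWithinAt_iff_tendsto_slope' (s := s ∩ Set.Ioi t)
    fun h => lt_irrefl t h.2).1 hg.hasDerivWithinAt
  refine le_of_tendsto h (eventually_mem_nhdsWithin.mono fun u hu => ?_)
  rw [slope_def_field, ht, sub_zero]
  exact div_nonpos_of_nonpos_of_nonneg (hs u hu.1) (sub_nonneg.2 (le_of_lt hu.2))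

lemma deriv_nonneg_of_frequently_left {g : ℝ → ℝ} {g' t : ℝ} {s : Set ℝ} (hg : HasDerivAt g g' t)
    (ht : g t = 0) (hs : ∀ u ∈ s, g u ≤ 0) (hne : 𝓝[s ∩ Set.Iio t] t ≠ ⊥) : 0 ≤ g' := by
  have : (𝓝[s ∩ Set.Iio t] t).NeBot := ⟨hne⟩
  have h := (hasDerivWithinAt_iff_tendsto_slope' (s := s ∩ Set.Iio t)
    fun h => lt_irrefl t h.2).1 hg.hasDerivWithinAt
  refine ge_of_tendsto h (eventually_mem_nhdsWithin.mono fun u hu => ?_)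
  rw [slope_def_field, ht, sub_zero]
  exact div_nonneg_of_nonpos (hs u hu.1) (sub_nonpos.2 (le_of_lt hu.2))

-- Where the derivative does not vanish, `t` is isolated from one side in the set `∀ i, g i t ≤ 0`.
lemma countable_setOf_deriv_ne_zero {ι : Type*} {g g' : ι → ℝ → ℝ}
    (hg : ∀ i t, HasDerivAt (g i) (g' i t) t) :
    {t | (∀ i, g i t ≤ 0) ∧ ∃ i, g i t = 0 ∧ g' i t ≠ 0}.Countable := by
  set s : Set ℝ := {t | ∀ i, g i t ≤ 0}
  refine ((countable_setOfPred_isolated_right_within (s := s)).union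
    (countable_setOfPred_isolated_left_within (s := s))).mono ?_
  rintro t ⟨ht, i, hzero, hne⟩
  by_contra hcon
  obtain ⟨hright, hleft⟩ := not_or.1 hcon
  exact hne (le_antisymm
    (deriv_nonpos_of_frequently_right (s := s) (hg i t) hzero (fun u hu => hu i)
      fun h => hright ⟨ht, h⟩)
    (deriv_nonneg_of_frequently_left (s := s) (hg i t) hzero (fun u hu => hu i)
      fun h => hleft ⟨ht, h⟩))

open Polynomial in
lemma countable_setOf_eval_eq_zero {ι : Type*} {P : ι → ℝ[X]} {N : Set ι}
    (hP : ∀ i ∈ N, P i ≠ 0)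
    (hN : {i ∈ N | ∃ t, (P i).eval t = 0 ∧ (P i).derivative.eval t = 0}.Countable) :
    {t | (∀ i, (P i).eval t ≤ 0) ∧ ∃ i ∈ N, (P i).eval t = 0}.Countable := by
  refine ((countable_setOf_deriv_ne_zero fun i t => (P i).hasDerivAt t).union
    (hN.biUnion fun i _ => ((P i).roots.toFinset.finite_toSet).countable)).mono ?_
  rintro t ⟨hle, i, hi, hzero⟩
  by_cases hderiv : (P i).derivative.eval t = 0
  · exact Or.inr (Set.mem_biUnion (x := i) ⟨hi, t, hzero, hderiv⟩ (by simpa [hP i hi] using hzero))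
  · exact Or.inl ⟨hle, i, hzero, hderiv⟩

end Countable

section Discriminant

lemma discr_eq_zero_of_eval_derivative_eq_zero {P : Cubic ℝ} {t : ℝ} (h : P.toPoly.eval t = 0)
    (h' : P.toPoly.derivative.eval t = 0) : P.discr = 0 := by
  obtain ⟨a, b, c, d⟩ := P
  simp only [Cubic.toPoly, Polynomial.derivative_add, Polynomial.derivative_C_mul_X_pow,
    Polynomial.derivative_C_mul_X, Polynomial.derivative_C, Polynomial.eval_add,
    Polynomial.eval_mul, Polynomial.eval_C, Polynomial.eval_pow, Polynomial.eval_X,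
    Polynomial.eval_zero] at h h'
  push_cast at h'
  have hc : c = -(3 * a * t ^ 2 + 2 * b * t) := by linear_combination h'
  have hd : d = 2 * a * t ^ 3 + b * t ^ 2 := by linear_combination h - t * h'
  rw [Cubic.discr, hd, hc]
  ring

variable {α : Type*} {F : Filter α} {a b c d y : α → ℝ} {A B C l e : ℝ}

lemma tendsto_zero_of_tendsto_mul (hy : Tendsto y F atTop)
    (h : Tendsto (fun i => y i * a i) F (𝓝 A)) : Tendsto a F (𝓝 0) := by
  refine (h.div_atTop hy).congr' ?_
  filter_upwards [hy.eventually_gt_atTop 0] with i hi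
  exact mul_div_cancel_left₀ _ hi.ne'

lemma tendsto_sq_mul_discr (hy : Tendsto y F atTop) (ha : Tendsto (fun i => y i * a i) F (𝓝 A))
    (hb : Tendsto (fun i => y i * b i) F (𝓝 B)) (hc : Tendsto (fun i => y i * c i) F (𝓝 C))
    (hd : Tendsto d F (𝓝 e)) :
    Tendsto (fun i => y i ^ 2 * (⟨a i, b i, c i, d i⟩ : Cubic ℝ).discr) F
      (𝓝 (-27 * A ^ 2 * e ^ 2)) := by
  have hb₀ := tendsto_zero_of_tendsto_mul hy hb
  have hc₀ := tendsto_zero_of_tendsto_mul hy hc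
  have h := (((((hb.pow 2).mul (hc₀.pow 2)).sub (((ha.const_mul 4).mul hc).mul (hc₀.pow 2))).sub
    ((((hb.pow 2).const_mul 4).mul hb₀).mul hd)).sub (((ha.pow 2).const_mul 27).mul (hd.pow 2))).add
    ((((ha.const_mul 18).mul hb).mul hc₀).mul hd)
  convert h using 1
  · ext i
    rw [Cubic.discr]
    ring
  · ring_nf

lemma tendsto_mul_discr (hy : Tendsto y F atTop) (ha : Tendsto (fun i => y i * a i) F (𝓝 A))
    (hb : Tendsto (fun i => y i * b i) F (𝓝 B)) (hc : Tendsto c F (𝓝 l))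
    (hd : Tendsto d F (𝓝 e)) :
    Tendsto (fun i => y i * (⟨a i, b i, c i, d i⟩ : Cubic ℝ).discr) F (𝓝 (-4 * A * l ^ 3)) := by
  have ha₀ := tendsto_zero_of_tendsto_mul hy ha
  have hb₀ := tendsto_zero_of_tendsto_mul hy hb
  have h := (((((hb.mul hb₀).mul (hc.pow 2)).sub ((ha.const_mul 4).mul (hc.pow 3))).sub
    (((hb.const_mul 4).mul (hb₀.pow 2)).mul hd)).sub (((ha.const_mul 27).mul ha₀).mul
    (hd.pow 2))).add ((((ha.const_mul 18).mul hb₀).mul hc).mul hd)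
  convert h using 1
  · ext i
    rw [Cubic.discr]
    ring
  · ring_nf

lemma eventually_discr_ne_zero (hy : Tendsto y F atTop)
    (ha : Tendsto (fun i => y i * a i) F (𝓝 A)) (hb : Tendsto (fun i => y i * b i) F (𝓝 B))
    (hc : Tendsto (fun i => y i * (c i - l)) F (𝓝 C)) (hd : Tendsto d F (𝓝 e)) (hA : A ≠ 0)
    (he : e ≠ 0) : ∀ᶠ i in F, (⟨a i, b i, c i, d i⟩ : Cubic ℝ).discr ≠ 0 := by
  by_cases hl : l = 0
  · simp only [hl, sub_zero] at hc
    exact ((tendsto_sq_mul_discr hy ha hb hc hd).eventually_ne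
      (mul_ne_zero (mul_ne_zero (by norm_num) (pow_ne_zero 2 hA)) (pow_ne_zero 2 he))).mono
      fun i => right_ne_zero_of_mul
  · have hcl : Tendsto c F (𝓝 l) := by
      simpa using (tendsto_zero_of_tendsto_mul hy hc).add_const l
    exact ((tendsto_mul_discr hy ha hb hcl hd).eventually_ne
      (mul_ne_zero (mul_ne_zero (by norm_num) hA) (pow_ne_zero 3 hl))).mono
      fun i => right_ne_zero_of_mul

end Discriminant

section Excess

/-- The polynomial in `τ = (D 0 δ - r) / shiftDenom D δ r`, cubic since `relShift` is proportional
to `τ`, that equals `2 * (power - 1)` up to a positive factor. -/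
def excess (D : ℕ → ℝ → ℝ) (δ x : ℝ) : Cubic ℝ where
  a := (D 1 δ / (1 - D 0 δ ^ 2)) ^ 2 * (schurEigen D δ (-1) * residual D δ (-1) 0 x ^ 2 -
    schurEigen D δ 1 * residual D δ 1 0 x ^ 2)
  b := (D 1 δ / (1 - D 0 δ ^ 2)) ^ 2 * ((1 + D 0 δ) * residual D δ 1 0 x ^ 2 +
      (1 - D 0 δ) * residual D δ (-1) 0 x ^ 2) +
    2 * (D 1 δ / (1 - D 0 δ ^ 2)) *
      (schurEigen D δ 1 * (interp D δ 1 0 x * residual D δ 1 0 x) -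
        schurEigen D δ (-1) * (interp D δ (-1) 0 x * residual D δ (-1) 0 x))
  c := -2 * (D 1 δ / (1 - D 0 δ ^ 2)) * ((1 + D 0 δ) * (interp D δ 1 0 x * residual D δ 1 0 x) +
      (1 - D 0 δ) * (interp D δ (-1) 0 x * residual D δ (-1) 0 x)) +
    (schurEigen D δ (-1) * interp D δ (-1) 0 x ^ 2 - schurEigen D δ 1 * interp D δ 1 0 x ^ 2) +
    (schurEigen D δ 1 - schurEigen D δ (-1))
  d := (1 + D 0 δ) * interp D δ 1 0 x ^ 2 + (1 - D 0 δ) * interp D δ (-1) 0 x ^ 2 - 2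

lemma shiftDenom_mul_eval_excess {D : ℕ → ℝ → ℝ} {δ r : ℝ} (hr : shiftDenom D δ r ≠ 0) (x : ℝ) :
    shiftDenom D δ r * (excess D δ x).toPoly.eval ((D 0 δ - r) / shiftDenom D δ r) =
      2 * shiftDenom D δ (D 0 δ) * (power D δ r x - 1) := by
  have hτ : (D 0 δ - r) / shiftDenom D δ r * shiftDenom D δ r = D 0 δ - r := div_mul_cancel₀ _ hr
  set τ := (D 0 δ - r) / shiftDenom D δ r with hτ_def
  have ht : relShift D δ r = D 1 δ / (1 - D 0 δ ^ 2) * τ := by rw [relShift, mul_div_assoc]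
  simp only [Cubic.toPoly, excess, Polynomial.eval_add, Polynomial.eval_mul, Polynomial.eval_C,
    Polynomial.eval_pow, Polynomial.eval_X, power, ampl, ht]
  set c := D 1 δ / (1 - D 0 δ ^ 2)
  rw [shiftDenom] at hτ
  simp only [shiftDenom]
  linear_combination (-schurEigen D δ 1 * (interp D δ 1 0 x - c * τ * residual D δ 1 0 x) ^ 2 +
    schurEigen D δ (-1) * (interp D δ (-1) 0 x - c * τ * residual D δ (-1) 0 x) ^ 2 +
    (schurEigen D δ 1 - schurEigen D δ (-1))) * hτ

end Excess

section LimitKernel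

variable {δ ε x : ℝ}

lemma limitKernel_one_eq (hx : x ≠ 0) :
    limitKernel 1 x = Real.cos (x / 2) / x - 2 * Real.sin (x / 2) / x ^ 2 := by
  have h : HasDerivAt (fun y : ℝ => 2 * Real.sin (y / 2) / y)
      (Real.cos (x / 2) / x - 2 * Real.sin (x / 2) / x ^ 2) x := by
    refine (((((hasDerivAt_id x).div_const 2).sin).const_mul 2).fun_div
      (hasDerivAt_id x) hx).congr_deriv ?_
    simp only [id]
    field_simp
  exact (isKernel_limitKernel.hasDerivAt 0 x).unique (h.congr_of_eventuallyEq
    ((eventually_ne_nhds hx).mono fun y hy => limitKernel_zero_eq hy))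

lemma analyticAt_excess_discr (δ x : ℝ) :
    AnalyticAt ℝ (fun x => (excess limitKernel δ x).discr) x := by
  have hk (j : ℕ) : AnalyticAt ℝ (limitKernel j) x :=
    isAperture_uniformAperture.analyticAt_kernel j x
  have hk' (j : ℕ) : AnalyticAt ℝ (fun x => limitKernel j (x + δ)) x :=
    (isAperture_uniformAperture.analyticAt_kernel j (x + δ)).fun_comp (f := fun x => x + δ)
      (analyticAt_id.fun_add analyticAt_const)
  have hU (ε : ℝ) : AnalyticAt ℝ (interp limitKernel δ ε 0) x :=
    ((hk 0).fun_add (analyticAt_const.fun_mul (hk' 0))).div_const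
  have hW (ε : ℝ) : AnalyticAt ℝ (residual limitKernel δ ε 0) x :=
    ((hk 1).fun_sub (analyticAt_const.fun_mul (hk' 1))).fun_add (analyticAt_const.fun_mul (hU ε))
  have hU₂ := hU (-1)
  have hW₂ := hW (-1)
  simp only [Cubic.discr, excess]
  fun_prop

/-- Arguments tending to infinity at which the trigonometric factors of `limitKernel` take the
values of half-angle `θ`. -/
def phaseSeq (θ : ℝ) (n : ℕ) : ℝ := n * (4 * Real.pi) + 2 * θ

lemma tendsto_phaseSeq (θ : ℝ) : Tendsto (phaseSeq θ) atTop atTop :=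
  tendsto_atTop_add_const_right _ _
    (tendsto_natCast_atTop_atTop.atTop_mul_const (by positivity))

lemma half_phaseSeq_add (θ a : ℝ) (n : ℕ) :
    (phaseSeq θ n + a) / 2 = θ + a / 2 + n * (2 * Real.pi) := by
  rw [phaseSeq]
  ring

lemma tendsto_inv_phaseSeq_add (θ a : ℝ) :
    Tendsto (fun n => (phaseSeq θ n + a)⁻¹) atTop (𝓝 0) :=
  tendsto_inv_atTop_zero.comp (tendsto_atTop_add_const_right _ _ (tendsto_phaseSeq θ))

lemma tendsto_phaseSeq_mul_inv (θ a : ℝ) :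
    Tendsto (fun n => phaseSeq θ n * (phaseSeq θ n + a)⁻¹) atTop (𝓝 1) := by
  have h := ((tendsto_inv_phaseSeq_add θ a).const_mul a).const_sub 1
  rw [mul_zero, sub_zero] at h
  refine h.congr' ?_
  filter_upwards [(tendsto_atTop_add_const_right _ a (tendsto_phaseSeq θ)).eventually_gt_atTop 0]
    with n hn
  field_simp
  ring

lemma tendsto_phaseSeq_mul_limitKernel_zero (θ a : ℝ) :
    Tendsto (fun n => phaseSeq θ n * limitKernel 0 (phaseSeq θ n + a)) atTop
      (𝓝 (2 * Real.sin (θ + a / 2))) := by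
  have h := (tendsto_phaseSeq_mul_inv θ a).mul_const (2 * Real.sin (θ + a / 2))
  rw [one_mul] at h
  refine h.congr' ?_
  filter_upwards [(tendsto_atTop_add_const_right _ a (tendsto_phaseSeq θ)).eventually_gt_atTop 0]
    with n hn
  rw [limitKernel_zero_eq hn.ne', half_phaseSeq_add, Real.sin_add_nat_mul_two_pi]
  ring

lemma tendsto_phaseSeq_mul_limitKernel_one (θ a : ℝ) :
    Tendsto (fun n => phaseSeq θ n * limitKernel 1 (phaseSeq θ n + a)) atTop
      (𝓝 (Real.cos (θ + a / 2))) := by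
  have h := ((tendsto_phaseSeq_mul_inv θ a).mul_const (Real.cos (θ + a / 2))).sub
    (((tendsto_phaseSeq_mul_inv θ a).mul_const (2 * Real.sin (θ + a / 2))).mul
      (tendsto_inv_phaseSeq_add θ a))
  rw [one_mul, mul_zero, sub_zero] at h
  refine h.congr' ?_
  filter_upwards [(tendsto_atTop_add_const_right _ a (tendsto_phaseSeq θ)).eventually_gt_atTop 0]
    with n hn
  rw [limitKernel_one_eq hn.ne', half_phaseSeq_add, Real.sin_add_nat_mul_two_pi,
    Real.cos_add_nat_mul_two_pi]
  field_simp

/-- The limit of `x * interp limitKernel δ ε 0 x` as `x → ∞` along `phaseSeq θ`. -/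
def interpTail (δ ε θ : ℝ) : ℝ :=
  (2 * Real.sin θ + ε * (2 * Real.sin (θ + δ / 2))) / (1 + ε * limitKernel 0 δ)

/-- The limit of `x * residual limitKernel δ ε 0 x` as `x → ∞` along `phaseSeq θ`. -/
def residualTail (δ ε θ : ℝ) : ℝ :=
  Real.cos θ - ε * Real.cos (θ + δ / 2) + ε * limitKernel 1 δ * interpTail δ ε θ

lemma tendsto_phaseSeq_mul_interp (δ ε θ : ℝ) :
    Tendsto (fun n => phaseSeq θ n * interp limitKernel δ ε 0 (phaseSeq θ n)) atTop
      (𝓝 (interpTail δ ε θ)) := by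
  have h := ((tendsto_phaseSeq_mul_limitKernel_zero θ 0).add
    ((tendsto_phaseSeq_mul_limitKernel_zero θ δ).const_mul ε)).div_const (1 + ε * limitKernel 0 δ)
  simp only [zero_div, add_zero] at h
  refine h.congr fun n => ?_
  rw [interp]
  ring

lemma tendsto_phaseSeq_mul_residual (δ ε θ : ℝ) :
    Tendsto (fun n => phaseSeq θ n * residual limitKernel δ ε 0 (phaseSeq θ n)) atTop
      (𝓝 (residualTail δ ε θ)) := by
  have h := ((tendsto_phaseSeq_mul_limitKernel_one θ 0).sub
    ((tendsto_phaseSeq_mul_limitKernel_one θ δ).const_mul ε)).add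
    ((tendsto_phaseSeq_mul_interp δ ε θ).const_mul (ε * limitKernel 1 δ))
  simp only [zero_div, add_zero] at h
  refine h.congr fun n => ?_
  rw [residual]
  ring

lemma tendsto_sq_mul_excess_a (δ θ : ℝ) :
    Tendsto (fun n => phaseSeq θ n ^ 2 * (excess limitKernel δ (phaseSeq θ n)).a) atTop
      (𝓝 ((limitKernel 1 δ / (1 - limitKernel 0 δ ^ 2)) ^ 2 *
        (schurEigen limitKernel δ (-1) * residualTail δ (-1) θ ^ 2 -
          schurEigen limitKernel δ 1 * residualTail δ 1 θ ^ 2))) := by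
  have hW (ε : ℝ) := tendsto_phaseSeq_mul_residual δ ε θ
  refine (((((hW (-1)).pow 2).const_mul (schurEigen limitKernel δ (-1))).sub
    (((hW 1).pow 2).const_mul (schurEigen limitKernel δ 1))).const_mul
      ((limitKernel 1 δ / (1 - limitKernel 0 δ ^ 2)) ^ 2)).congr fun n => ?_
  simp only [excess]
  ring

lemma exists_tendsto_sq_mul_excess_b (δ θ : ℝ) : ∃ B, Tendsto
    (fun n => phaseSeq θ n ^ 2 * (excess limitKernel δ (phaseSeq θ n)).b) atTop (𝓝 B) := by
  have hU (ε : ℝ) := tendsto_phaseSeq_mul_interp δ ε θ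
  have hW (ε : ℝ) := tendsto_phaseSeq_mul_residual δ ε θ
  refine ⟨_, ((((((hW 1).pow 2).const_mul (1 + limitKernel 0 δ)).add
    (((hW (-1)).pow 2).const_mul (1 - limitKernel 0 δ))).const_mul
      ((limitKernel 1 δ / (1 - limitKernel 0 δ ^ 2)) ^ 2)).add
    (((((hU 1).mul (hW 1)).const_mul (schurEigen limitKernel δ 1)).sub
      (((hU (-1)).mul (hW (-1))).const_mul (schurEigen limitKernel δ (-1)))).const_mul
        (2 * (limitKernel 1 δ / (1 - limitKernel 0 δ ^ 2))))).congr fun n => ?_⟩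
  simp only [excess]
  ring

lemma exists_tendsto_sq_mul_excess_c (δ θ : ℝ) : ∃ C, Tendsto
    (fun n => phaseSeq θ n ^ 2 * ((excess limitKernel δ (phaseSeq θ n)).c -
      (schurEigen limitKernel δ 1 - schurEigen limitKernel δ (-1)))) atTop (𝓝 C) := by
  have hU (ε : ℝ) := tendsto_phaseSeq_mul_interp δ ε θ
  have hW (ε : ℝ) := tendsto_phaseSeq_mul_residual δ ε θ
  refine ⟨_, (((((hU 1).mul (hW 1)).const_mul (1 + limitKernel 0 δ)).add
    (((hU (-1)).mul (hW (-1))).const_mul (1 - limitKernel 0 δ))).const_mul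
      (-2 * (limitKernel 1 δ / (1 - limitKernel 0 δ ^ 2)))).add
    ((((hU (-1)).pow 2).const_mul (schurEigen limitKernel δ (-1))).sub
      (((hU 1).pow 2).const_mul (schurEigen limitKernel δ 1))) |>.congr fun n => ?_⟩
  simp only [excess]
  ring

lemma tendsto_excess_d (δ θ : ℝ) :
    Tendsto (fun n => (excess limitKernel δ (phaseSeq θ n)).d) atTop (𝓝 (-2)) := by
  have hU (ε : ℝ) := tendsto_zero_of_tendsto_mul (tendsto_phaseSeq θ)
    (tendsto_phaseSeq_mul_interp δ ε θ)
  simpa [excess] using ((((hU 1).pow 2).const_mul (1 + limitKernel 0 δ)).add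
    (((hU (-1)).pow 2).const_mul (1 - limitKernel 0 δ))).sub_const 2

lemma exists_excess_discr_ne_zero_of_residualTail {θ : ℝ}
    (hc : limitKernel 1 δ / (1 - limitKernel 0 δ ^ 2) ≠ 0)
    (hA : schurEigen limitKernel δ (-1) * residualTail δ (-1) θ ^ 2 -
      schurEigen limitKernel δ 1 * residualTail δ 1 θ ^ 2 ≠ 0) :
    ∃ x, (excess limitKernel δ x).discr ≠ 0 := by
  obtain ⟨B, hb⟩ := exists_tendsto_sq_mul_excess_b δ θ
  obtain ⟨C, hc'⟩ := exists_tendsto_sq_mul_excess_c δ θ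
  obtain ⟨n, hn⟩ := (eventually_discr_ne_zero
    ((tendsto_pow_atTop two_ne_zero).comp (tendsto_phaseSeq θ)) (tendsto_sq_mul_excess_a δ θ) hb
    hc' (tendsto_excess_d δ θ) (mul_ne_zero (pow_ne_zero 2 hc) hA) (by norm_num)).exists
  exact ⟨phaseSeq θ n, hn⟩

end LimitKernel

section Discriminant

variable {δ : ℝ}

lemma residualTail_one_neg_quarter (δ : ℝ) : residualTail δ 1 (-(δ / 4)) = 0 := by
  have h : -(δ / 4) + δ / 2 = δ / 4 := by ring
  rw [residualTail, interpTail, h, Real.cos_neg, Real.sin_neg]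
  ring

lemma residualTail_neg_one_neg_quarter (δ : ℝ) : residualTail δ (-1) (-(δ / 4)) =
    2 * Real.cos (δ / 4) + 4 * limitKernel 1 δ * Real.sin (δ / 4) / (1 - limitKernel 0 δ) := by
  have h : -(δ / 4) + δ / 2 = δ / 4 := by ring
  rw [residualTail, interpTail, h, Real.cos_neg, Real.sin_neg]
  ring

lemma residualTail_neg_one_pi_div_two_sub (δ : ℝ) :
    residualTail δ (-1) (Real.pi / 2 - δ / 4) = 0 := by
  have h : Real.pi / 2 - δ / 4 + δ / 2 = δ / 4 + Real.pi / 2 := by ring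
  rw [residualTail, interpTail, h, Real.cos_add_pi_div_two, Real.sin_add_pi_div_two,
    Real.cos_pi_div_two_sub, Real.sin_pi_div_two_sub]
  ring

lemma residualTail_one_pi_div_two_sub (δ : ℝ) : residualTail δ 1 (Real.pi / 2 - δ / 4) =
    2 * Real.sin (δ / 4) + 4 * limitKernel 1 δ * Real.cos (δ / 4) / (1 + limitKernel 0 δ) := by
  have h : Real.pi / 2 - δ / 4 + δ / 2 = δ / 4 + Real.pi / 2 := by ring
  rw [residualTail, interpTail, h, Real.cos_add_pi_div_two, Real.sin_add_pi_div_two,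
    Real.cos_pi_div_two_sub, Real.sin_pi_div_two_sub]
  ring

lemma residualTail_ne_zero (hδ : δ ≠ 0) : residualTail δ (-1) (-(δ / 4)) ≠ 0 ∨
    residualTail δ 1 (Real.pi / 2 - δ / 4) ≠ 0 := by
  rw [residualTail_neg_one_neg_quarter, residualTail_one_pi_div_two_sub]
  by_contra! ⟨hcos, hsin⟩
  have hs := abs_lt.1 (abs_limitKernel_zero_lt_one hδ)
  have hp : 1 + limitKernel 0 δ ≠ 0 := by linarith
  have hm : 1 - limitKernel 0 δ ≠ 0 := by linarith
  field_simp at hcos hsin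
  have hs_eq : limitKernel 0 δ = Real.cos (δ / 2) := by
    rw [show δ / 2 = 2 * (δ / 4) by ring, Real.cos_two_mul]
    linear_combination Real.sin (δ / 4) / 2 * hsin - Real.cos (δ / 4) / 2 * hcos -
      (1 + limitKernel 0 δ) * Real.sin_sq_add_cos_sq (δ / 4)
  have hD : limitKernel 1 δ = 0 := by
    rw [limitKernel_zero_eq hδ] at hs_eq
    rw [limitKernel_one_eq hδ, ← hs_eq]
    field_simp
    ring
  simp only [hD, mul_zero, zero_mul, add_zero, mul_eq_zero, OfNat.ofNat_ne_zero, false_or, hp, hm,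
    or_false] at hcos hsin
  exact Real.cos_sq_add_sin_sq (δ / 4) |>.not_lt (by simp [hcos, hsin])

lemma exists_excess_discr_ne_zero (hδ : δ ≠ 0)
    (hc : limitKernel 1 δ / (1 - limitKernel 0 δ ^ 2) ≠ 0) :
    ∃ x, (excess limitKernel δ x).discr ≠ 0 := by
  rcases residualTail_ne_zero hδ with h | h
  · refine exists_excess_discr_ne_zero_of_residualTail (θ := -(δ / 4)) hc ?_
    rw [residualTail_one_neg_quarter, zero_pow two_ne_zero, mul_zero, sub_zero]
    exact mul_ne_zero (schurEigen_limitKernel_pos hδ (by norm_num)).ne' (pow_ne_zero 2 h)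
  · refine exists_excess_discr_ne_zero_of_residualTail (θ := Real.pi / 2 - δ / 4) hc ?_
    rw [residualTail_neg_one_pi_div_two_sub, zero_pow two_ne_zero, mul_zero, zero_sub]
    exact neg_ne_zero.2
      (mul_ne_zero (schurEigen_limitKernel_pos hδ (one_pow 2)).ne' (pow_ne_zero 2 h))

end Discriminant

section Touching

variable {δ : ℝ}

lemma excess_d_ne_zero {x : ℝ} (hδ : δ ≠ 0) (hx : x ≠ 0) (hxδ : x ≠ -δ) :
    (excess limitKernel δ x).d ≠ 0 := by
  have h := gram_lt_one hδ hx hxδ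
  simp only [excess]
  linarith

lemma countable_setOf_excess_double_root (hδ : δ ≠ 0) :
    {x ∈ {x | x ≠ 0 ∧ x ≠ -δ} | ∃ t, (excess limitKernel δ x).toPoly.eval t = 0 ∧
      (excess limitKernel δ x).toPoly.derivative.eval t = 0}.Countable := by
  by_cases hc : limitKernel 1 δ / (1 - limitKernel 0 δ ^ 2) = 0
  · refine Set.countable_empty.mono ?_
    rintro x ⟨⟨hx, hxδ⟩, t, ht, ht'⟩
    have ha : (excess limitKernel δ x).a = 0 := by simp [excess, hc]
    have hb : (excess limitKernel δ x).b = 0 := by simp [excess, hc]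
    simp only [Cubic.toPoly, ha, hb, Polynomial.C_0, zero_mul, zero_add, Polynomial.eval_add,
      Polynomial.eval_mul, Polynomial.eval_C, Polynomial.eval_X, Polynomial.derivative_add,
      Polynomial.derivative_C_mul, Polynomial.derivative_X, Polynomial.derivative_C, mul_one,
      add_zero] at ht ht'
    rw [ht', zero_mul, zero_add] at ht
    exact excess_d_ne_zero hδ hx hxδ ht
  · obtain ⟨x₀, hx₀⟩ := exists_excess_discr_ne_zero hδ hc
    refine (countable_setOf_eq_zero (fun x _ => analyticAt_excess_discr δ x) isPreconnected_univ
      (Set.mem_univ x₀) hx₀).mono ?_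
    rintro x ⟨-, t, ht, ht'⟩
    exact ⟨Set.mem_univ x, discr_eq_zero_of_eval_derivative_eq_zero ht ht'⟩

lemma countable_setOf_excess_eval_eq_zero (hδ : δ ≠ 0) :
    {t | (∀ x, (excess limitKernel δ x).toPoly.eval t ≤ 0) ∧
      ∃ x ∈ {x | x ≠ 0 ∧ x ≠ -δ}, (excess limitKernel δ x).toPoly.eval t = 0}.Countable :=
  countable_setOf_eval_eq_zero
    (fun _ hx => Cubic.ne_zero_of_d_ne_zero (excess_d_ne_zero hδ hx.1 hx.2))
    (countable_setOf_excess_double_root hδ)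

lemma injOn_div_shiftDenom (hδ : δ ≠ 0) :
    Set.InjOn (fun r => (limitKernel 0 δ - r) / shiftDenom limitKernel δ r) {r | |r| ≤ 1} := by
  intro r hr r' hr' h
  have hs := shiftDenom_limitKernel_pos hδ (abs_limitKernel_zero_lt_one hδ).le
  rw [div_eq_div_iff (shiftDenom_limitKernel_pos hδ hr).ne'
    (shiftDenom_limitKernel_pos hδ hr').ne'] at h
  simp only [shiftDenom] at h hs
  have h' : (r' - r) * (((1 - limitKernel 0 δ) * schurEigen limitKernel δ 1 +
      (1 + limitKernel 0 δ) * schurEigen limitKernel δ (-1)) / 2) = 0 := by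
    linear_combination h
  linarith [(mul_eq_zero.1 h').resolve_right hs.ne']

lemma countable_setOf_power_eq_one (hδ : δ ≠ 0) :
    {r | |r| ≤ 1 ∧ (∀ x, power limitKernel δ r x ≤ 1) ∧
      ∃ x, x ≠ 0 ∧ x ≠ -δ ∧ power limitKernel δ r x = 1}.Countable := by
  refine Set.MapsTo.countable_of_injOn ?_ ((injOn_div_shiftDenom hδ).mono fun r hr => hr.1)
    (countable_setOf_excess_eval_eq_zero hδ)
  rintro r ⟨hr, hle, x, hx, hxδ, heq⟩
  have hs := shiftDenom_limitKernel_pos hδ (abs_limitKernel_zero_lt_one hδ).le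
  have hr' := shiftDenom_limitKernel_pos hδ hr
  refine ⟨fun y => nonpos_of_mul_nonpos_right ?_ hr', x, ⟨hx, hxδ⟩,
    (mul_eq_zero.1 ?_).resolve_left hr'.ne'⟩
  · rw [shiftDenom_mul_eval_excess hr'.ne']
    exact mul_nonpos_of_nonneg_of_nonpos (by positivity) (sub_nonpos.2 (hle y))
  · rw [shiftDenom_mul_eval_excess hr'.ne', heq, sub_self, mul_zero]

end Touching

section SecondDerivative

variable {δ r : ℝ}

lemma power2_limitKernel_zero_shift (hδ : δ ≠ 0) :
    power2 limitKernel δ (limitKernel 0 δ) 0 =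
      -(schurEigen limitKernel δ 1 + schurEigen limitKernel δ (-1)) := by
  have hs := abs_limitKernel_zero_lt_one hδ
  have hs' := abs_lt.1 hs
  have hp : 1 + limitKernel 0 δ ≠ 0 := by linarith
  have hm : 1 - limitKernel 0 δ ≠ 0 := by linarith
  have ht : relShift limitKernel δ (limitKernel 0 δ) = 0 := by
    rw [relShift, sub_self, mul_zero, zero_div]
  rw [power2, isKernel_limitKernel.ampl_zero_zero (one_pow 2) hs,
    isKernel_limitKernel.ampl_zero_zero (by norm_num) hs,
    isKernel_limitKernel.ampl_one_zero (one_pow 2),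
    isKernel_limitKernel.ampl_one_zero (by norm_num), ht]
  simp only [ampl, interp, schurEigen, zero_mul, zero_add, sub_zero, one_mul,
    neg_mul, sub_neg_eq_add, ← sub_eq_add_neg]
  field_simp
  ring

lemma analyticAt_power2 (hδ : δ ≠ 0) (hr : |r| ≤ 1) :
    AnalyticAt ℝ (fun r => power2 limitKernel δ r 0) r := by
  have hr' := (shiftDenom_limitKernel_pos hδ hr).ne'
  have hshift : AnalyticAt ℝ (relShift limitKernel δ) r := by
    unfold relShift
    refine AnalyticAt.fun_div (by fun_prop) ?_ hr'
    unfold shiftDenom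
    fun_prop
  unfold power2 ampl
  fun_prop

lemma countable_setOf_power2_eq_zero (hδ : δ ≠ 0) :
    {r ∈ Set.Icc (-1) 1 | power2 limitKernel δ r 0 = 0}.Countable := by
  have hs := abs_limitKernel_zero_lt_one hδ
  refine countable_setOf_eq_zero (fun r hr => analyticAt_power2 hδ (abs_le.2 hr))
    isPreconnected_Icc (abs_le.1 hs.le) ?_
  rw [power2_limitKernel_zero_shift hδ]
  have h₁ := schurEigen_limitKernel_pos hδ (one_pow 2)
  have h₂ := schurEigen_limitKernel_pos hδ (ε := -1) (by norm_num)
  linarith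

lemma power2_nonpos {D : ℕ → ℝ → ℝ} (hD : IsKernel D) (hN : IsNondegenerate D δ r)
    (h : ∀ x, power D δ r x ≤ 1) : power2 D δ r 0 ≤ 0 := by
  by_contra! hpos
  have hcont : ContinuousAt (power2 D δ r) 0 := by
    have hV (ε : ℝ) (j : ℕ) : ContinuousAt (ampl D δ ε (relShift D δ r) j) 0 :=
      (hD.hasDerivAt_ampl j 0).continuousAt
    have := hV 1
    have := hV (-1)
    unfold power2
    fun_prop
  obtain ⟨η, hη, hball⟩ := Metric.eventually_nhds_iff.1 (hcont.eventually (lt_mem_nhds hpos))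
  obtain ⟨ζ, hζ, heq⟩ := exists_eq_add_second_deriv hD.hasDerivAt_power hD.hasDerivAt_power1
    (hD.power1_zero hN) (η / 2)
  have hζ' : 0 < power2 D δ r ζ := hball (by
    rw [Real.dist_eq, sub_zero]
    exact hζ.trans_lt (by rw [abs_of_pos (half_pos hη)]; linarith))
  rw [hD.power_zero hN.abs_lt] at heq
  have : 0 < power2 D δ r ζ / 2 * (η / 2) ^ 2 := by positivity
  linarith [h (η / 2)]

end SecondDerivative

lemma exists_countable_strict {δ : ℝ} (hδ : δ ≠ 0) : ∃ B : Set ℝ, B.Countable ∧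
    ∀ r, |r| ≤ 1 → r ∉ B → (∀ x, power limitKernel δ r x ≤ 1) →
      (∀ x, x ≠ 0 → x ≠ -δ → power limitKernel δ r x < 1) ∧ power2 limitKernel δ r 0 < 0 := by
  refine ⟨_, (countable_setOf_power_eq_one hδ).union (countable_setOf_power2_eq_zero hδ),
    fun r hr hB hle => ⟨fun x hx hxδ => ?_, ?_⟩⟩
  · exact lt_of_le_of_ne (hle x) fun h => hB (Or.inl ⟨hr, hle, x, hx, hxδ, h⟩)
  · exact lt_of_le_of_ne
      (power2_nonpos isKernel_limitKernel (isNondegenerate_limitKernel hδ hr) hle)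
      fun h => hB (Or.inr ⟨abs_le.1 hr, h⟩)

/-! ### Coalescing sources -/

lemma limitKernel_four_zero : limitKernel 4 0 = 1 / 80 := by
  have harg : ((4 : ℕ) : ℝ) * (Real.pi / 2) = 2 * Real.pi := by
    push_cast
    ring
  rw [limitKernel, kernel, integral_uniformAperture]
  simp only [mul_zero, zero_add, harg, Real.cos_two_pi, mul_one]
  rw [integral_pow]
  norm_num

-- A function with `f'' = - f / 12` would satisfy `f⁗ 0 = f 0 / 144`.
lemma exists_limitKernel_two_add_ne : ∃ x, limitKernel 2 x + 1 / 12 * limitKernel 0 x ≠ 0 := by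
  by_contra! h
  have hderiv (j : ℕ) (hj : ∀ x, limitKernel (j + 2) x + 1 / 12 * limitKernel j x = 0) (x : ℝ) :
      limitKernel (j + 3) x + 1 / 12 * limitKernel (j + 1) x = 0 := by
    have hd := (isKernel_limitKernel.hasDerivAt (j + 2) x).fun_add
      ((isKernel_limitKernel.hasDerivAt j x).const_mul (1 / 12 : ℝ))
    simp only [hj] at hd
    exact hd.unique (hasDerivAt_const x 0)
  have h4 := hderiv 1 (hderiv 0 h) 0
  simp only [Nat.reduceAdd] at h4
  norm_num [limitKernel_four_zero, limitKernel_two_zero] at h4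

lemma IsKernel.exists_eq_add_mul_add_sq {D : ℕ → ℝ → ℝ} (hD : IsKernel D) (j : ℕ) (x y : ℝ) :
    ∃ ζ, |ζ| ≤ |y| ∧ D j (x + y) = D j x + D (j + 1) x * y + D (j + 2) (x + ζ) / 2 * y ^ 2 := by
  have hd (j : ℕ) (y : ℝ) : HasDerivAt (fun y => D j (x + y)) (D (j + 1) (x + y)) y :=
    (hD.hasDerivAt j (x + y)).comp_const_add x y
  obtain ⟨ζ, hζ, h⟩ := exists_eq_add_second_deriv
    (fun y => (hd j y).fun_sub ((hasDerivAt_id y).const_mul (D (j + 1) x)))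
    (fun y => (hd (j + 1) y).fun_sub (hasDerivAt_const y (D (j + 1) x * 1)))
    (by rw [add_zero, mul_one, sub_self]) y
  refine ⟨ζ, hζ, ?_⟩
  simp only [id, mul_zero, add_zero, sub_zero] at h
  linear_combination h

section Coalescing

variable {δ r : ℕ → ℝ} {r₀ : ℝ}

lemma exists_tendsto_arrayKernel_taylor (hδ : Tendsto δ atTop (𝓝 0)) (j : ℕ) (x : ℝ) :
    ∃ κ : ℕ → ℝ, Tendsto κ atTop (𝓝 (limitKernel (j + 2) x / 2)) ∧
      ∀ᶠ m in atTop, arrayKernel m j (x + δ m) =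
        arrayKernel m j x + arrayKernel m (j + 1) x * δ m + κ m * δ m ^ 2 := by
  have htaylor (m : ℕ) : ∃ ζ, |ζ| ≤ |δ m| ∧ (m ≠ 0 → arrayKernel m j (x + δ m) =
      arrayKernel m j x + arrayKernel m (j + 1) x * δ m +
        arrayKernel m (j + 2) (x + ζ) / 2 * δ m ^ 2) := by
    rcases eq_or_ne m 0 with rfl | hm
    · exact ⟨0, by simp⟩
    · obtain ⟨ζ, hζ, h⟩ := (isKernel_arrayKernel hm).exists_eq_add_mul_add_sq j x (δ m)
      exact ⟨ζ, hζ, fun _ => h⟩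
  choose ζ hζ h using htaylor
  have hζ₀ : Tendsto ζ atTop (𝓝 0) := squeeze_zero_norm hζ (by simpa using hδ.abs)
  refine ⟨fun m => arrayKernel m (j + 2) (x + ζ m) / 2, ?_, (eventually_ne_atTop 0).mono h⟩
  have hx : Tendsto (fun m => x + ζ m) atTop (𝓝 x) := by simpa using hζ₀.const_add x
  exact (tendsto_arrayKernel_apply hx (j + 2)).div_const 2

lemma tendsto_arrayKernel_slope (hδ : Tendsto δ atTop (𝓝 0)) (hne : ∀ᶠ m in atTop, δ m ≠ 0)
    (j : ℕ) (x : ℝ) :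
    Tendsto (fun m => (arrayKernel m j (x + δ m) - arrayKernel m j x) / δ m) atTop
      (𝓝 (limitKernel (j + 1) x)) := by
  obtain ⟨κ, hκ, h⟩ := exists_tendsto_arrayKernel_taylor hδ j x
  have hlim := (tendsto_arrayKernel_apply (tendsto_const_nhds (x := x)) (j + 1)).add (hκ.mul hδ)
  rw [mul_zero, add_zero] at hlim
  refine hlim.congr' ?_
  filter_upwards [h, hne] with m hm hm₀
  rw [hm]
  field_simp
  ring

lemma tendsto_arrayKernel_second_slope (hδ : Tendsto δ atTop (𝓝 0))
    (hne : ∀ᶠ m in atTop, δ m ≠ 0) {j : ℕ} (hj : Even j) :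
    Tendsto (fun m => (arrayKernel m j (δ m) - arrayKernel m j 0) / δ m ^ 2) atTop
      (𝓝 (limitKernel (j + 2) 0 / 2)) := by
  obtain ⟨κ, hκ, h⟩ := exists_tendsto_arrayKernel_taylor hδ j 0
  refine hκ.congr' ?_
  filter_upwards [h, hne, eventually_ne_atTop 0] with m hm hm₀ hm'
  rw [zero_add, (isKernel_arrayKernel hm').apply_zero_of_odd hj.add_one] at hm
  rw [hm]
  field_simp
  ring

lemma tendsto_arrayKernel_one_div (hδ : Tendsto δ atTop (𝓝 0)) (hne : ∀ᶠ m in atTop, δ m ≠ 0) :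
    Tendsto (fun m => arrayKernel m 1 (δ m) / δ m) atTop (𝓝 (-(1 / 12))) := by
  have h := tendsto_arrayKernel_slope hδ hne 1 0
  rw [limitKernel_two_zero] at h
  refine h.congr' ((eventually_ne_atTop 0).mono fun m hm => ?_)
  rw [(isKernel_arrayKernel hm).apply_zero_of_odd odd_one, zero_add, sub_zero]

lemma tendsto_one_sub_arrayKernel_div (hδ : Tendsto δ atTop (𝓝 0))
    (hne : ∀ᶠ m in atTop, δ m ≠ 0) :
    Tendsto (fun m => (1 - arrayKernel m 0 (δ m)) / δ m ^ 2) atTop (𝓝 (1 / 24)) := by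
  have h := (tendsto_arrayKernel_second_slope hδ hne Even.zero).neg
  rw [zero_add, limitKernel_two_zero, show -(-(1 / 12 : ℝ) / 2) = 1 / 24 by norm_num] at h
  refine h.congr' ((eventually_ne_atTop 0).mono fun m hm => ?_)
  rw [(isKernel_arrayKernel hm).one]
  ring

lemma tendsto_arrayKernel_zero_of_coalescing (hδ : Tendsto δ atTop (𝓝 0)) :
    Tendsto (fun m => arrayKernel m 0 (δ m)) atTop (𝓝 1) := by
  simpa only [isKernel_limitKernel.one] using tendsto_arrayKernel_apply hδ 0

lemma eventually_abs_arrayKernel_zero_lt_one (hδ : Tendsto δ atTop (𝓝 0))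
    (hne : ∀ᶠ m in atTop, δ m ≠ 0) : ∀ᶠ m in atTop, |arrayKernel m 0 (δ m)| < 1 := by
  filter_upwards [hne,
    (tendsto_one_sub_arrayKernel_div hδ hne).eventually_const_lt (u := 0) (by norm_num),
    (tendsto_arrayKernel_zero_of_coalescing hδ).eventually_const_lt (u := -1) (by norm_num)]
    with m hm hlt hgt
  have hsub := (div_pos_iff_of_pos_right (by positivity)).1 hlt
  exact abs_lt.2 ⟨hgt, by linarith⟩

lemma tendsto_schurEigen_neg_one_of_coalescing (hδ : Tendsto δ atTop (𝓝 0)) :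
    Tendsto (fun m => schurEigen (arrayKernel m) (δ m) (-1)) atTop (𝓝 0) := by
  have h := tendsto_schurEigen (ε := -1) (tendsto_arrayKernel_apply tendsto_const_nhds 2)
    (tendsto_arrayKernel_zero_of_coalescing hδ) (tendsto_arrayKernel_apply hδ 1)
    (tendsto_arrayKernel_apply hδ 2) (by norm_num)
  simpa [isKernel_limitKernel.apply_zero_of_odd odd_one] using h

lemma tendsto_schurEigen_one_of_coalescing (hδ : Tendsto δ atTop (𝓝 0))
    (hne : ∀ᶠ m in atTop, δ m ≠ 0) :
    Tendsto (fun m => schurEigen (arrayKernel m) (δ m) 1) atTop (𝓝 0) := by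
  have hquot := ((tendsto_arrayKernel_one_div hδ hne).pow 2).div
    (tendsto_one_sub_arrayKernel_div hδ hne) (by norm_num)
  have h := ((tendsto_arrayKernel_apply (tendsto_const_nhds (x := 0)) 2).add
    (tendsto_arrayKernel_apply hδ 2)).neg.sub hquot
  rw [limitKernel_two_zero, show -(-(1 / 12 : ℝ) + -(1 / 12)) - (-(1 / 12)) ^ 2 / (1 / 24) = 0 by
    norm_num] at h
  refine h.congr' ?_
  filter_upwards [hne] with m hm
  rw [schurEigen, one_mul, one_mul, Pi.div_apply, div_pow,
    div_div_div_cancel_right₀ (pow_ne_zero 2 hm)]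

lemma eventually_schurEigen_neg_one_pos (hδ : Tendsto δ atTop (𝓝 0))
    (hne : ∀ᶠ m in atTop, δ m ≠ 0) :
    ∀ᶠ m in atTop, 0 < schurEigen (arrayKernel m) (δ m) (-1) := by
  have h := (tendsto_arrayKernel_second_slope hδ hne even_two).sub
    (((tendsto_arrayKernel_one_div hδ hne).pow 2).div
      ((tendsto_arrayKernel_zero_of_coalescing hδ).const_add 1) (by norm_num))
  rw [limitKernel_four_zero] at h
  filter_upwards [hne, h.eventually_const_lt (u := 0) (by norm_num)] with m hm hpos
  refine (mul_pos hpos (by positivity : 0 < δ m ^ 2)).trans_eq ?_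
  rw [schurEigen, Pi.div_apply, neg_one_mul, neg_one_mul, sub_neg_eq_add, div_pow]
  field_simp
  ring

lemma tendsto_shiftDenom_of_coalescing (hδ : Tendsto δ atTop (𝓝 0))
    (hne : ∀ᶠ m in atTop, δ m ≠ 0) (hr : Tendsto r atTop (𝓝 r₀)) :
    Tendsto (fun m => shiftDenom (arrayKernel m) (δ m) (r m)) atTop (𝓝 0) := by
  have h := (((hr.const_sub 1).mul (tendsto_schurEigen_one_of_coalescing hδ hne)).add
    ((hr.const_add 1).mul (tendsto_schurEigen_neg_one_of_coalescing hδ))).div_const 2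
  simp only [mul_zero, add_zero, zero_div] at h
  exact h

lemma eventually_isNondegenerate_of_coalescing (hδ : Tendsto δ atTop (𝓝 0))
    (hne : ∀ᶠ m in atTop, δ m ≠ 0) (hr : Tendsto r atTop (𝓝 r₀)) (hr₀ : |r₀| < 1) :
    ∀ᶠ m in atTop, IsNondegenerate (arrayKernel m) (δ m) (r m) := by
  filter_upwards [eventually_abs_arrayKernel_zero_lt_one hδ hne,
    eventually_schurEigen_neg_one_pos hδ hne, eventually_ne_atTop 0,
    hr.abs.eventually_lt_const hr₀] with m hs hK hm hrm
  have hK' := (isAperture_arrayAperture hm).schurEigen_nonneg (one_pow 2) hs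
  obtain ⟨hr₁, hr₂⟩ := abs_lt.1 hrm
  refine ⟨hs, ?_, ?_⟩ <;> rw [shiftDenom] <;> nlinarith

lemma tendsto_mul_relShift_mul_shiftDenom (hδ : Tendsto δ atTop (𝓝 0))
    (hne : ∀ᶠ m in atTop, δ m ≠ 0) (hr : Tendsto r atTop (𝓝 r₀)) (hr₀ : |r₀| < 1) :
    Tendsto (fun m => δ m * relShift (arrayKernel m) (δ m) (r m) *
      shiftDenom (arrayKernel m) (δ m) (r m)) atTop (𝓝 (-(1 - r₀))) := by
  have hs := tendsto_arrayKernel_zero_of_coalescing hδ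
  have h := ((tendsto_arrayKernel_one_div hδ hne).div
    ((tendsto_one_sub_arrayKernel_div hδ hne).mul (hs.const_add 1)) (by norm_num)).mul (hs.sub hr)
  rw [show -(1 / 12 : ℝ) / (1 / 24 * (1 + 1)) * (1 - r₀) = -(1 - r₀) by ring] at h
  refine h.congr' ?_
  filter_upwards [hne, eventually_isNondegenerate_of_coalescing hδ hne hr hr₀] with m hm hN
  have hden := hN.shiftDenom_pos.ne'
  rw [relShift, mul_assoc, div_mul_cancel₀ _ hden, Pi.div_apply,
    show 1 - arrayKernel m 0 (δ m) ^ 2 = (1 - arrayKernel m 0 (δ m)) * (1 + arrayKernel m 0 (δ m))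
      by ring]
  field_simp

lemma tendsto_interp_of_coalescing (hδ : Tendsto δ atTop (𝓝 0)) (x : ℝ) :
    Tendsto (fun m => interp (arrayKernel m) (δ m) 1 0 x) atTop (𝓝 (limitKernel 0 x)) := by
  have hx : Tendsto (fun m => x + δ m) atTop (𝓝 x) := by simpa using hδ.const_add x
  convert tendsto_interp (ε := 1) (tendsto_arrayKernel_apply tendsto_const_nhds 0)
    (tendsto_arrayKernel_apply hx 0) (tendsto_arrayKernel_zero_of_coalescing hδ) (by norm_num)
    using 2
  ring

lemma tendsto_residual_div (hδ : Tendsto δ atTop (𝓝 0)) (hne : ∀ᶠ m in atTop, δ m ≠ 0) (x : ℝ) :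
    Tendsto (fun m => residual (arrayKernel m) (δ m) 1 0 x / δ m) atTop
      (𝓝 (-(limitKernel 2 x + 1 / 12 * limitKernel 0 x))) := by
  convert (tendsto_arrayKernel_slope hδ hne 1 x).neg.add
    ((tendsto_arrayKernel_one_div hδ hne).mul (tendsto_interp_of_coalescing hδ x)) using 2
  · rw [residual, zero_add]
    ring
  · ring

lemma tendsto_ampl_mul_shiftDenom (hδ : Tendsto δ atTop (𝓝 0)) (hne : ∀ᶠ m in atTop, δ m ≠ 0)
    (hr : Tendsto r atTop (𝓝 r₀)) (hr₀ : |r₀| < 1) (x : ℝ) :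
    Tendsto (fun m => ampl (arrayKernel m) (δ m) 1 (relShift (arrayKernel m) (δ m) (r m)) 0 x *
      shiftDenom (arrayKernel m) (δ m) (r m)) atTop
      (𝓝 (-((1 - r₀) * (limitKernel 2 x + 1 / 12 * limitKernel 0 x)))) := by
  have h := ((tendsto_interp_of_coalescing hδ x).mul
    (tendsto_shiftDenom_of_coalescing hδ hne hr)).sub
      ((tendsto_mul_relShift_mul_shiftDenom hδ hne hr hr₀).mul (tendsto_residual_div hδ hne x))
  rw [mul_zero, zero_sub, neg_mul_neg] at h
  refine h.congr' ?_
  filter_upwards [hne] with m hm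
  rw [ampl]
  field_simp

-- The shift is of order `1 / (δ * shiftDenom)` and the residual of order `δ`, so the amplitude
-- away from the sources blows up like `1 / shiftDenom`.
lemma exists_eventually_one_lt_power_of_coalescing (hδ : Tendsto δ atTop (𝓝 0))
    (hne : ∀ᶠ m in atTop, δ m ≠ 0) (hr : Tendsto r atTop (𝓝 r₀)) (hr₀ : |r₀| < 1) :
    ∃ x, ∀ᶠ m in atTop, 1 < power (arrayKernel m) (δ m) (r m) x := by
  obtain ⟨x, hx⟩ := exists_limitKernel_two_add_ne
  refine ⟨x, ?_⟩
  obtain ⟨hr₁, hr₂⟩ := abs_lt.1 hr₀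
  have hlim := ((hr.const_add 1).div_const 2).mul
    ((tendsto_ampl_mul_shiftDenom hδ hne hr hr₀ x).pow 2)
  have hpos : 0 < (1 + r₀) / 2 * (-((1 - r₀) * (limitKernel 2 x + 1 / 12 * limitKernel 0 x))) ^ 2 :=
    mul_pos (by linarith)
      (pow_two_pos_of_ne_zero (neg_ne_zero.2 (mul_ne_zero (by linarith) hx)))
  filter_upwards [eventually_isNondegenerate_of_coalescing hδ hne hr hr₀,
    ((tendsto_shiftDenom_of_coalescing hδ hne hr).pow 2).eventually_lt hlim (by simpa using hpos),
    hr.abs.eventually_lt_const hr₀] with m hN hlt hrm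
  have hden := pow_pos hN.shiftDenom_pos 2
  rw [mul_pow, ← mul_assoc, lt_mul_iff_one_lt_left hden] at hlt
  refine hlt.trans_le (le_add_of_nonneg_right (mul_nonneg ?_ (sq_nonneg _)))
  linarith [(abs_lt.1 hrm).2]

end Coalescing

/-! ### Almost all correlations -/

lemma continuous_effCorr (ρ : ℂ) : Continuous (effCorr ρ) := by
  unfold effCorr
  fun_prop

lemma effCorr_exp (ψ a : ℝ) : effCorr (cexp (ψ * I)) a = Real.cos (ψ - a) := by
  rw [effCorr, ← Complex.exp_conj, ← Complex.exp_add, map_mul, conj_I, conj_ofReal,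
    show ψ * I + -I * a = ((ψ - a : ℝ) : ℂ) * I by push_cast; ring, exp_ofReal_mul_I_re]

lemma effCorr_eq_rotation_re (ρ : ℂ) (a : ℝ) : effCorr ρ a = (rotation (Circle.exp (-a)) ρ).re := by
  rw [effCorr, rotation_apply, Circle.coe_exp, ← Complex.exp_conj, map_mul, conj_I, conj_ofReal,
    ofReal_neg, mul_comm ρ, neg_mul, neg_mul, mul_comm I]

lemma countable_setOf_cos_sub_mem {B : Set ℝ} (hB : B.Countable) (a : ℝ) :
    {ψ : ℝ | Real.cos (ψ - a) ∈ B}.Countable := by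
  have hunion : {ψ : ℝ | Real.cos (ψ - a) ∈ B} =
      ⋃ b ∈ B, {ψ | ψ ∈ Set.univ ∧ Real.cos (ψ - a) - b = 0} := by
    ext ψ
    simp [sub_eq_zero]
  rw [hunion]
  refine hB.biUnion fun b _ => ?_
  have hana : AnalyticOnNhd ℝ (fun ψ => Real.cos (ψ - a) - b) Set.univ := fun ψ _ =>
    (AnalyticAt.fun_comp (g := Real.cos) (f := fun ψ => ψ - a) Real.analyticAt_cos
      (analyticAt_id.fun_sub analyticAt_const)).fun_sub analyticAt_const
  obtain rfl | hb := eq_or_ne b 1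
  · refine countable_setOf_eq_zero hana isPreconnected_univ (Set.mem_univ (a + Real.pi)) ?_
    norm_num [Real.cos_pi]
  · refine countable_setOf_eq_zero hana isPreconnected_univ (Set.mem_univ a) ?_
    simpa [sub_eq_zero] using hb.symm

lemma quasiMeasurePreserving_re : Measure.QuasiMeasurePreserving Complex.re :=
  Measure.quasiMeasurePreserving_fst.comp
    volume_preserving_equiv_real_prod.quasiMeasurePreserving

lemma quasiMeasurePreserving_effCorr (a : ℝ) :
    Measure.QuasiMeasurePreserving fun ρ => effCorr ρ a := by
  simp only [effCorr_eq_rotation_re]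
  exact quasiMeasurePreserving_re.comp
    (rotation (Circle.exp (-a))).measurePreserving.quasiMeasurePreserving

lemma almostAll_of_countable (T : ℕ) {P : Matrix (Fin 2) (Fin 2) ℂ → Prop} {B : Set ℝ}
    (hB : B.Countable) (a : ℝ) (h : ∀ ρ : ℂ, ‖ρ‖ ≤ 1 → effCorr ρ a ∉ B → P (corr ρ)) :
    AlmostAll T P := by
  unfold AlmostAll
  split_ifs
  · filter_upwards [(countable_setOf_cos_sub_mem hB a).ae_notMem volume] with ψ hψ
    exact h _ (norm_exp_ofReal_mul_I ψ).le (by rwa [effCorr_exp])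
  · rw [ae_restrict_iff' measurableSet_closedBall]
    filter_upwards [(quasiMeasurePreserving_effCorr a).ae (hB.ae_notMem volume)] with ρ hρ hball
    exact h ρ (mem_closedBall_zero_iff.1 hball) hρ

lemma AlmostAll.mp {T : ℕ} {P Q : Matrix (Fin 2) (Fin 2) ℂ → Prop} (hP : AlmostAll T P)
    (h : AlmostAll T fun Ξ => P Ξ → Q Ξ) : AlmostAll T Q := by
  unfold AlmostAll at *
  split_ifs at * <;> exact hP.mp h

lemma AlmostAll.exists_abs_re_lt_one {T : ℕ} {P : Matrix (Fin 2) (Fin 2) ℂ → Prop}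
    (h : AlmostAll T P) : ∃ ρ : ℂ, ‖ρ‖ ≤ 1 ∧ |ρ.re| < 1 ∧ P (corr ρ) := by
  unfold AlmostAll at h
  split_ifs at h
  · obtain ⟨ψ, hψ, hP⟩ := (Measure.dense_of_ae h).exists_mem_open isOpen_Ioo
      (Set.nonempty_Ioo.2 Real.pi_pos)
    refine ⟨_, (norm_exp_ofReal_mul_I ψ).le, ?_, hψ⟩
    rw [exp_ofReal_mul_I_re, ← sq_lt_one_iff_abs_lt_one]
    linarith [Real.sin_sq_add_cos_sq ψ, pow_pos (Real.sin_pos_of_mem_Ioo hP) 2]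
  · rw [ae_restrict_iff' measurableSet_closedBall] at h
    obtain ⟨ρ, hρ, hball⟩ := (Measure.dense_of_ae h).exists_mem_open Metric.isOpen_ball
      ⟨(0 : ℂ), Metric.mem_ball_self one_pos⟩
    have hnorm : ‖ρ‖ < 1 := mem_ball_zero_iff.1 hball
    exact ⟨ρ, hnorm.le, (abs_re_le_norm ρ).trans_lt hnorm, hρ (Metric.ball_subset_closedBall hball)⟩

/-- The phase `(m - 1) Δφ_m / 2` by which the manifold vectors of two sources at distance `Δφ_m`
differ at the array centre, in terms of the scaled distance `m Δφ_m`. -/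
def arrayPhase (Δφ : ℕ → ℝ) (m : ℕ) : ℝ := (m - 1) / (2 * m) * (m * Δφ m)

section Sequences

variable {Δφ : ℕ → ℝ} {δ : ℝ}

lemma tendsto_arrayPhase (hδ : Tendsto (fun m : ℕ => (m : ℝ) * Δφ m) atTop (𝓝 δ)) :
    Tendsto (arrayPhase Δφ) atTop (𝓝 (1 / 2 * δ)) := by
  have hinv : Tendsto (fun m : ℕ => 1 / 2 - 1 / 2 * (m : ℝ)⁻¹) atTop (𝓝 (1 / 2)) := by
    simpa only [mul_zero, sub_zero] using
      ((tendsto_inv_atTop_nhds_zero_nat (𝕜 := ℝ)).const_mul (1 / 2)).const_sub (1 / 2)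
  refine (hinv.mul hδ).congr' ?_
  filter_upwards [eventually_ne_atTop 0] with m hm
  rw [arrayPhase]
  field_simp

lemma tendsto_effCorr_arrayPhase (hδ : Tendsto (fun m : ℕ => (m : ℝ) * Δφ m) atTop (𝓝 δ)) (ρ : ℂ) :
    Tendsto (fun m => effCorr ρ (arrayPhase Δφ m)) atTop (𝓝 (effCorr ρ (1 / 2 * δ))) :=
  ((continuous_effCorr ρ).tendsto _).comp (tendsto_arrayPhase hδ)

lemma eventuallyConsistentOver_of_power_le_one {ρ : ℂ} (hρ : ‖ρ‖ ≤ 1)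
    (hN : ∀ᶠ m : ℕ in atTop,
      IsNondegenerate (arrayKernel m) (m * Δφ m) (effCorr ρ (arrayPhase Δφ m)))
    (hp : ∀ᶠ m : ℕ in atTop, ∀ x,
      power (arrayKernel m) (m * Δφ m) (effCorr ρ (arrayPhase Δφ m)) x ≤ 1) :
    EventuallyConsistentOver (fun m => ![0, Δφ m]) (corr ρ) := by
  obtain ⟨M, hM⟩ := eventually_atTop.1 (hN.and (hp.and (eventually_ne_atTop 0)))
  refine ⟨M, fun m hm y _ => ?_⟩
  obtain ⟨hNm, hpm, hm₀⟩ := hM m hm.le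
  exact (ula_test_le_one_iff hm₀ hρ hNm y).2 (hpm _)

lemma almostAll_limitTest_imp (T : ℕ) (hδ₀ : δ ≠ 0)
    (hδ : Tendsto (fun m : ℕ => (m : ℝ) * Δφ m) atTop (𝓝 δ)) :
    AlmostAll T fun Ξ => LimitTest δ Ξ → EventuallyConsistentOver (fun m => ![0, Δφ m]) Ξ := by
  obtain ⟨B, hB, hstrict⟩ := exists_countable_strict hδ₀
  refine almostAll_of_countable T hB (1 / 2 * δ) fun ρ hρ hρB htest => ?_
  have hle (a : ℝ) : |effCorr ρ a| ≤ 1 := (abs_effCorr_le ρ a).trans hρ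
  have hN := isNondegenerate_limitKernel hδ₀ (hle (1 / 2 * δ))
  have hr := tendsto_effCorr_arrayPhase hδ ρ
  obtain ⟨hlt, hconcave⟩ := hstrict _ (hle _) hρB ((limitTest_iff hρ hN).1 htest)
  exact eventuallyConsistentOver_of_power_le_one hρ (eventually_isNondegenerate hδ hr hN)
    (eventually_power_le_one_of_tendsto hδ hr (fun _ => hle _) hN hlt hconcave)

lemma almostAsymptoticallyConsistent_of_separated (T : ℕ)
    (hrange : ∀ m, Δφ m ∈ electricalAngles)
    (hδ : Tendsto (fun m : ℕ => (m : ℝ) * Δφ m) atTop atTop) :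
    AlmostAsymptoticallyConsistent T fun m => ![0, Δφ m] := by
  refine almostAll_of_countable T Set.countable_empty 0 fun ρ hρ _ => ?_
  have hr (m : ℕ) : |effCorr ρ (arrayPhase Δφ m)| ≤ 1 := (abs_effCorr_le ρ _).trans hρ
  have hle (m : ℕ) : |(m : ℝ) * Δφ m| ≤ Real.pi * m := by
    rw [abs_mul, Nat.abs_cast, mul_comm]
    exact mul_le_mul_of_nonneg_right (abs_le.2 (hrange m)) m.cast_nonneg
  have hchord := tendsto_chord_of_abs_le hδ hle
  exact eventuallyConsistentOver_of_power_le_one hρ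
    (eventually_isNondegenerate_of_separated hchord hr)
    (eventually_power_le_one_of_separated hchord hr)

lemma not_almostAsymptoticallyConsistent_of_coalescing (T : ℕ) (hne : ∀ m, Δφ m ≠ 0)
    (hδ : Tendsto (fun m : ℕ => (m : ℝ) * Δφ m) atTop (𝓝 0)) :
    ¬ AlmostAsymptoticallyConsistent T fun m => ![0, Δφ m] := by
  intro hcons
  obtain ⟨ρ, hρ, hre, M, hM⟩ := AlmostAll.exists_abs_re_lt_one hcons
  have hr : Tendsto (fun m => effCorr ρ (arrayPhase Δφ m)) atTop (𝓝 ρ.re) := by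
    simpa [effCorr] using tendsto_effCorr_arrayPhase hδ ρ
  have hne' : ∀ᶠ m : ℕ in atTop, (m : ℝ) * Δφ m ≠ 0 :=
    (eventually_ne_atTop 0).mono fun m hm => mul_ne_zero (Nat.cast_ne_zero.2 hm) (hne m)
  obtain ⟨x, hx⟩ := exists_eventually_one_lt_power_of_coalescing hδ hne' hr hre
  have hlarge : ∀ᶠ m : ℕ in atTop, |x| ≤ Real.pi * m :=
    (tendsto_natCast_atTop_atTop.const_mul_atTop Real.pi_pos).eventually_ge_atTop _
  obtain ⟨m, hN, hgt, hxm, hMm, hm₀⟩ := ((eventually_isNondegenerate_of_coalescing hδ hne' hr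
    hre).and (hx.and (hlarge.and ((eventually_gt_atTop M).and (eventually_gt_atTop 0))))).exists
  have hm : (0 : ℝ) < m := Nat.cast_pos.2 hm₀
  have hy : -x / m ∈ electricalAngles := by
    refine abs_le.1 ?_
    rwa [abs_div, abs_neg, abs_of_pos hm, div_le_iff₀ hm]
  have hle := (ula_test_le_one_iff hm₀.ne' hρ hN _).1 (hM m hMm _ hy)
  rw [mul_div_cancel₀ _ hm.ne', neg_neg] at hle
  exact hgt.not_ge hle

end Sequences

end CLASS

end

theorem proposition3 (T : ℕ) (hT : 1 ≤ T) (Δφ : ℕ → ℝ)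
    (hrange : ∀ m, Δφ m ∈ CLASS.electricalAngles) (hne : ∀ m, Δφ m ≠ 0) :
    (∀ δ : ℝ, δ ≠ 0 →
      Filter.Tendsto (fun m : ℕ => (m : ℝ) * Δφ m) Filter.atTop (nhds δ) →
        CLASS.AlmostAll T (fun Ξ => CLASS.LimitTest δ Ξ →
          CLASS.EventuallyConsistentOver (fun m => ![0, Δφ m]) Ξ) ∧
        (CLASS.AlmostAll T (CLASS.LimitTest δ) →
          CLASS.AlmostAsymptoticallyConsistent T (fun m => ![0, Δφ m]))) ∧
    (Filter.Tendsto (fun m : ℕ => (m : ℝ) * Δφ m) Filter.atTop Filter.atTop →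
      CLASS.AlmostAsymptoticallyConsistent T (fun m => ![0, Δφ m])) ∧
    (Filter.Tendsto (fun m : ℕ => (m : ℝ) * Δφ m) Filter.atTop (nhds 0) →
      ¬ CLASS.AlmostAsymptoticallyConsistent T (fun m => ![0, Δφ m])) :=
  ⟨fun _ hδ₀ hδ => ⟨CLASS.almostAll_limitTest_imp T hδ₀ hδ,
      fun htest => CLASS.AlmostAll.mp htest (CLASS.almostAll_limitTest_imp T hδ₀ hδ)⟩,
    CLASS.almostAsymptoticallyConsistent_of_separated T hrange,
    CLASS.not_almostAsymptoticallyConsistent_of_coalescing T hne⟩
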